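/- Let $d\in\{2,3\}$; vectors of $\mathbb R^2$ are regarded as horizontal vectors of $\mathbb R^3$ when vector products are taken. An *outer Kepler map* $\mathcal C$ is a canonical ($C^1$) change of coordinates $$(\Lambda_2,\ell_2,u,v)\in\mathcal A\times\mathbb T\times V\ \longmapsto\ (y^{(1)},y^{(2)},x^{(1)},x^{(2)})\in(\mathbb R^d)^4,$$ with $\mathcal A\subset(0,\infty)$ open and nonempty, $V\subset\mathbb R^{4d-2}$ open, nonempty and connected, with $\Lambda_2,u$ the momenta conjugate to the positions $\ell_2,v$ (it carries $d\Lambda_2\wedge d\ell_2+du\wedge dv$ to $dy^{(1)}\wedge dx^{(1)}+dy^{(2)}\wedge dx^{(2)}$; angles among the $v$ may be lifted to $\mathbb R$), with values in the collisionless phase space $x^{(1)}\ne0$, $x^{(2)}\ne 0$, $x^{(1)}\ne x^{(2)}$, and such that for some $\mathfrak m_2,\mathfrak M_2>0$ $$\frac{|y^{(2)}|^2}{2\mathfrak m_2}-\frac{\mathfrak m_2\mathfrak M_2}{|x^{(2)}|}=-\frac{\mathfrak m_2^3\mathfrak M_2^2}{2\Lambda_2^2}.$$ For such a map put $C^{(i)}=x^{(i)}\times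 y^{(i)}$, $C=C^{(1)}+C^{(2)}$, $a_2=\Lambda_2^2/(\mathfrak M_2\mathfrak m_2^2)$, $G_2=|C^{(2)}|$, $e_2=\sqrt{1-G_2^2/\Lambda_2^2}$, let $P^{(2)}$ be the unit vector in the direction of the perihelion of the Keplerian orbit $\ell_2\mapsto x^{(2)}$ (any direction if $e_2=0$), let $$\langle f_{\mathcal C}\rangle_{\ell_2}=\frac1{2\pi}\int_{\mathbb T}\frac{d\ell_2}{|x^{(1)}-x^{(2)}|},$$ and let $\mathcal G_{\mathcal C}\ge 0$ be defined by $$\frac{\mathcal G_{\mathcal C}^2}{\Lambda_2^2}=\frac{G_2^2}{\Lambda_2^2}-e_2\,\frac{x^{(1)}\cdot P^{(2)}}{a_2}.$$ The right-hand side is everywhere positive if $|x^{(1)}|<|x^{(2)}|$ on the whole domain of $\mathcal C$. **Theorem.** Let $\mathcal C$ be an outer Kepler map for which this right-hand side is everywhere positive. Let $I_1,\dots,I_{2d-1}$ be the functions $G=|C|$, $Z=C_3$, $\Lambda_2$, $r_1=|x^{(1)}|$, $\Theta=C^{(2)}\cdot x^{(1)}/r_1$ if $d=3$, and $G,\Lambda_2,r_1$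 if $d=2$. Then $\mathcal G_{\mathcal C}\in\sigma(\langle f_{\mathcal C}\rangle_{\ell_2})$, that is: $\langle f_{\mathcal C}\rangle_{\ell_2},I_1,\dots,I_{2d-1}$ pairwise Poisson-commute and are functionally independent; and $\mathcal G_{\mathcal C}$ is a first integral of $\langle f_{\mathcal C}\rangle_{\ell_2}$ (their Poisson bracket vanishes identically), Poisson-commutes with each $I_j$, is functionally independent of $I_1,\dots,I_{2d-1}$, and is not the function $\langle f_{\mathcal C}\rangle_{\ell_2}$. The functions $\langle f_{\mathcal C}\rangle_{\ell_2}$ and $\mathcal G_{\mathcal C}$ are differentiable on the whole domain. Functional independence means that on an open dense subset of the domain the functions are differentiable with linearly independent differentials; brackets with $G$ are meant where $C\neq0$. -/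

import Mathlib

noncomputable section

namespace ThreeBody

/-- The configuration space `ℝ^d` of one body, with its Euclidean norm. -/
abbrev E (d : ℕ) : Type := EuclideanSpace ℝ (Fin d)

/-- Cartesian phase space of the two planets: points `(y⁽¹⁾, y⁽²⁾, x⁽¹⁾, x⁽²⁾)`, where `y` are the
impulses and `x` the heliocentric positions. -/
abbrev Phase (d : ℕ) : Type := E d × E d × E d × E d

/-- The standard symplectic form `dy⁽¹⁾ ∧ dx⁽¹⁾ + dy⁽²⁾ ∧ dx⁽²⁾` on the Cartesian phase space. -/
def phaseForm {d : ℕ} (p q : Phase d) : ℝ :=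
  (inner ℝ p.1 q.2.2.1 - inner ℝ q.1 p.2.2.1) +
    (inner ℝ p.2.1 q.2.2.2 - inner ℝ q.2.1 p.2.2.2)

/-- Coordinates `(Λ, ℓ, u, v)`: `Λ` and `u` are momenta, `ℓ` and `v` are the respective conjugate
positions. There are `n + 1` degrees of freedom. The angle `ℓ` is represented by its lift
to `ℝ`. -/
abbrev Coord (n : ℕ) : Type := ℝ × ℝ × (Fin n → ℝ) × (Fin n → ℝ)

namespace Coord

variable {n : ℕ}

/-- The momentum `Λ`. -/
def mom (z : Coord n) : ℝ := z.1

/-- The position `ℓ`. -/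
def ang (z : Coord n) : ℝ := z.2.1

/-- The momenta `u`. -/
def u (z : Coord n) : Fin n → ℝ := z.2.2.1

/-- The positions `v`. -/
def v (z : Coord n) : Fin n → ℝ := z.2.2.2

/-- The point with the same `Λ, u, v` as `z` and with `ℓ = s`. -/
def setAng (z : Coord n) (s : ℝ) : Coord n := (z.1, s, z.2.2.1, z.2.2.2)

end Coord

/-- The standard symplectic form `dΛ ∧ dℓ + du ∧ dv` on the space of coordinates. -/
def coordForm {n : ℕ} (ξ η : Coord n) : ℝ :=
  (ξ.mom * η.ang - η.mom * ξ.ang) + ∑ i, (ξ.u i * η.v i - η.u i * ξ.v i)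

/-- The Poisson bracket
`∂_Λ f ∂_ℓ g - ∂_ℓ f ∂_Λ g + ∑ i, (∂_{u i} f ∂_{v i} g - ∂_{v i} f ∂_{u i} g)` at `z`. -/
def poisson {n : ℕ} (f g : Coord n → ℝ) (z : Coord n) : ℝ :=
  (fderiv ℝ f z (1, 0, 0, 0) * fderiv ℝ g z (0, 1, 0, 0) -
      fderiv ℝ f z (0, 1, 0, 0) * fderiv ℝ g z (1, 0, 0, 0)) +
    ∑ i : Fin n,
      (fderiv ℝ f z (0, 0, Pi.single i 1, 0) * fderiv ℝ g z (0, 0, 0, Pi.single i 1) -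
        fderiv ℝ f z (0, 0, 0, Pi.single i 1) * fderiv ℝ g z (0, 0, Pi.single i 1, 0))

/-- Functional independence on `D`: there is an open dense subset of `D` at every point of which
the functions are differentiable and their differentials are linearly independent. -/
def FunctionallyIndependent {n k : ℕ} (D : Set (Coord n)) (F : Fin k → Coord n → ℝ) : Prop :=
  ∃ U : Set (Coord n), IsOpen U ∧ U ⊆ D ∧ D ⊆ closure U ∧
    ∀ z ∈ U, (∀ i, DifferentiableAt ℝ (F i) z) ∧
      LinearIndependent ℝ (fun i => fderiv ℝ (F i) z)

/-- `InSigma D h I g`: on the domain `D` with `n + 1` degrees of freedom, the Hamiltonian `h` and the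
`n` functions `I` are a set of independent, pairwise commuting functions (so `h` is
integrable by quadratures), and `g` is a first integral of `h` which commutes with the functions
`I`, is functionally independent of them, and differs from `h`. -/
structure InSigma {n : ℕ} (D : Set (Coord n)) (h : Coord n → ℝ) (I : Fin n → Coord n → ℝ)
    (g : Coord n → ℝ) : Prop where
  differentiable_ham : ∀ z ∈ D, DifferentiableAt ℝ h z
  ham_comm : ∀ i, ∀ z ∈ D, poisson h (I i) z = 0
  comm : ∀ i j, ∀ z ∈ D, poisson (I i) (I j) z = 0
  ham_indep : FunctionallyIndependent D (Fin.cons h I : Fin (n + 1) → Coord n → ℝ)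
  differentiable_integral : ∀ z ∈ D, DifferentiableAt ℝ g z
  first_integral : ∀ z ∈ D, poisson h g z = 0
  integral_comm : ∀ i, ∀ z ∈ D, poisson g (I i) z = 0
  integral_indep : FunctionallyIndependent D (Fin.cons g I : Fin (n + 1) → Coord n → ℝ)
  ne_ham : ∃ z ∈ D, g z ≠ h z

/-- The inclusion of `ℝ^d` in `ℝ³` by zero padding: the identity for `d = 3`, the inclusion of
the horizontal plane for `d = 2`. -/
def toSpace {d : ℕ} (x : E d) : E 3 :=
  WithLp.toLp 2 (fun i : Fin 3 => if h : (i : ℕ) < d then x ⟨i, h⟩ else 0)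

/-- The vector product `x × y`, as a vector of `ℝ³`. -/
def cross {d : ℕ} (x y : E d) : E 3 :=
  WithLp.toLp 2 (crossProduct (WithLp.ofLp (toSpace x)) (WithLp.ofLp (toSpace y)))

/-- An outer Kepler map in dimension `d`: a canonical change of coordinates
`(Λ₂, ℓ₂, u, v) ∈ A × 𝕋 × V ↦ (y⁽¹⁾, y⁽²⁾, x⁽¹⁾, x⁽²⁾)` which puts the Keplerian energy
of the outer body in the form `-𝔪₂³ 𝔐₂² / (2 Λ₂²)`. Its image lies in the collisionless phase
space. Periodicity in `ℓ₂` expresses that `ℓ₂ ∈ 𝕋 = ℝ / 2πℤ`. Global injectivity is not imposed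
(a canonical map is a local diffeomorphism), so that further angles among the coordinates `v` may
be represented by their lifts to `ℝ`. -/
structure OuterKeplerMap (d : ℕ) where
  /-- The reduced mass `𝔪₂`. -/
  m₂ : ℝ
  /-- The mass `𝔐₂`. -/
  M₂ : ℝ
  m₂_pos : 0 < m₂
  M₂_pos : 0 < M₂
  /-- The domain of `Λ₂`. -/
  A : Set ℝ
  /-- The domain of `(u, v)`, in `ℝ^(4d-2)`. -/
  V : Set ((Fin (2 * d - 1) → ℝ) × (Fin (2 * d - 1) → ℝ))
  isOpen_A : IsOpen A
  nonempty_A : A.Nonempty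
  A_pos : A ⊆ Set.Ioi 0
  isOpen_V : IsOpen V
  isConnected_V : IsConnected V
  /-- The map `(Λ₂, ℓ₂, u, v) ↦ (y⁽¹⁾, y⁽²⁾, x⁽¹⁾, x⁽²⁾)`. -/
  toFun : Coord (2 * d - 1) → Phase d
  contDiffOn : ContDiffOn ℝ 1 toFun {z | z.mom ∈ A ∧ (z.u, z.v) ∈ V}
  periodic : ∀ z : Coord (2 * d - 1), z.mom ∈ A → (z.u, z.v) ∈ V →
    toFun (z.setAng (z.ang + 2 * Real.pi)) = toFun z
  canonical : ∀ z : Coord (2 * d - 1), z.mom ∈ A → (z.u, z.v) ∈ V →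
    ∀ ξ η : Coord (2 * d - 1),
      phaseForm (fderiv ℝ toFun z ξ) (fderiv ℝ toFun z η) = coordForm ξ η
  x₁_ne_zero : ∀ z : Coord (2 * d - 1), z.mom ∈ A → (z.u, z.v) ∈ V → (toFun z).2.2.1 ≠ 0
  x₂_ne_zero : ∀ z : Coord (2 * d - 1), z.mom ∈ A → (z.u, z.v) ∈ V → (toFun z).2.2.2 ≠ 0
  x₁_ne_x₂ : ∀ z : Coord (2 * d - 1), z.mom ∈ A → (z.u, z.v) ∈ V →
    (toFun z).2.2.1 ≠ (toFun z).2.2.2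
  kepler : ∀ z : Coord (2 * d - 1), z.mom ∈ A → (z.u, z.v) ∈ V →
    ‖(toFun z).2.1‖ ^ 2 / (2 * m₂) - m₂ * M₂ / ‖(toFun z).2.2.2‖ =
      -(m₂ ^ 3 * M₂ ^ 2) / (2 * z.mom ^ 2)

namespace OuterKeplerMap

variable {d : ℕ} (C : OuterKeplerMap d)

/-- The domain `A × 𝕋 × V`, with `𝕋` lifted to `ℝ`. -/
def domain : Set (Coord (2 * d - 1)) := {z | z.mom ∈ C.A ∧ (z.u, z.v) ∈ C.V}

/-- The impulse `y⁽¹⁾` of the inner body. -/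
def y₁ (z : Coord (2 * d - 1)) : E d := (C.toFun z).1

/-- The impulse `y⁽²⁾` of the outer body. -/
def y₂ (z : Coord (2 * d - 1)) : E d := (C.toFun z).2.1

/-- The position `x⁽¹⁾` of the inner body. -/
def x₁ (z : Coord (2 * d - 1)) : E d := (C.toFun z).2.2.1

/-- The position `x⁽²⁾` of the outer body. -/
def x₂ (z : Coord (2 * d - 1)) : E d := (C.toFun z).2.2.2

/-- The angular momentum `C⁽¹⁾ = x⁽¹⁾ × y⁽¹⁾`. -/
def C₁ (z : Coord (2 * d - 1)) : E 3 := cross (C.x₁ z) (C.y₁ z)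

/-- The angular momentum `C⁽²⁾ = x⁽²⁾ × y⁽²⁾`. -/
def C₂ (z : Coord (2 * d - 1)) : E 3 := cross (C.x₂ z) (C.y₂ z)

/-- The total angular momentum. -/
def Ctot (z : Coord (2 * d - 1)) : E 3 := C.C₁ z + C.C₂ z

/-- The semi-major axis `a₂ = Λ₂² / (𝔐₂ 𝔪₂²)`. -/
def a₂ (z : Coord (2 * d - 1)) : ℝ := 1 / C.M₂ * (z.mom ^ 2 / C.m₂ ^ 2)

/-- `G₂ = |C⁽²⁾|`. -/
def G₂ (z : Coord (2 * d - 1)) : ℝ := ‖C.C₂ z‖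

/-- The eccentricity `e₂ = √(1 - G₂² / Λ₂²)`. -/
def e₂ (z : Coord (2 * d - 1)) : ℝ := Real.sqrt (1 - C.G₂ z ^ 2 / z.mom ^ 2)

/-- A value of `ℓ₂` at which the Keplerian orbit `ℓ₂ ↦ x⁽²⁾` through `z` is closest to the
origin. -/
def periAngle (z : Coord (2 * d - 1)) : ℝ :=
  Classical.epsilon fun s : ℝ => ∀ t : ℝ, ‖C.x₂ (z.setAng s)‖ ≤ ‖C.x₂ (z.setAng t)‖

/-- The (unit) direction `P⁽²⁾` of the perihelion of the Keplerian orbit `ℓ₂ ↦ x⁽²⁾` through `z`.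
On a circular orbit this is an arbitrary direction; there `e₂ = 0`. -/
def P₂ (z : Coord (2 * d - 1)) : E d :=
  ‖C.x₂ (z.setAng (C.periAngle z))‖⁻¹ • C.x₂ (z.setAng (C.periAngle z))

/-- The outer averaged Newtonian potential `⟨f_C⟩_{ℓ₂}`, the average of `1 / |x⁽¹⁾ - x⁽²⁾|` over
`ℓ₂`, as a function of `(Λ₂, ℓ₂, u, v)` that does not depend on `ℓ₂`. -/
def avgPotential (z : Coord (2 * d - 1)) : ℝ :=
  1 / (2 * Real.pi) *
    ∫ s in (0 : ℝ)..(2 * Real.pi), 1 / ‖C.x₁ (z.setAng s) - C.x₂ (z.setAng s)‖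

/-- `𝒢²`, given by `𝒢² / Λ₂² = G₂² / Λ₂² - e₂ (x⁽¹⁾ · P⁽²⁾) / a₂`. -/
def calGSq (z : Coord (2 * d - 1)) : ℝ :=
  z.mom ^ 2 * (C.G₂ z ^ 2 / z.mom ^ 2 - C.e₂ z * (inner ℝ (C.x₁ z) (C.P₂ z) / C.a₂ z))

/-- The function `𝒢`. -/
def calG (z : Coord (2 * d - 1)) : ℝ := Real.sqrt (C.calGSq z)

/-- The length `G = |C|` of the total angular momentum. -/
def G (z : Coord (2 * d - 1)) : ℝ := ‖C.Ctot z‖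

/-- The third component `Z` of the total angular momentum. -/
def Z (z : Coord (2 * d - 1)) : ℝ := C.Ctot z 2

/-- The semi-major axis action `Λ₂`. -/
def L₂ (_C : OuterKeplerMap d) (z : Coord (2 * d - 1)) : ℝ := z.mom

/-- `r₁ = |x⁽¹⁾|`. -/
def r₁ (z : Coord (2 * d - 1)) : ℝ := ‖C.x₁ z‖

/-- The projection `Θ = C⁽²⁾ · x⁽¹⁾ / r₁`. -/
def Theta (z : Coord (2 * d - 1)) : ℝ := inner ℝ (C.C₂ z) (toSpace (C.x₁ z)) / C.r₁ z

end OuterKeplerMap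

/-- The standard integrals `G, Λ₂, r₁` of the outer average in the plane. -/
def planarIntegrals (C : OuterKeplerMap 2) : Fin (2 * 2 - 1) → Coord (2 * 2 - 1) → ℝ :=
  ![C.G, C.L₂, C.r₁]

/-- The standard integrals `G, Z, Λ₂, r₁, Θ` of the outer average in space. -/
def spatialIntegrals (C : OuterKeplerMap 3) : Fin (2 * 3 - 1) → Coord (2 * 3 - 1) → ℝ :=
  ![C.G, C.Z, C.L₂, C.r₁, C.Theta]

end ThreeBody

end

/-! By canonicity `∂/∂ℓ₂` is, up to sign, the Hamiltonian field of `Λ₂`, which is a function of the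
outer Keplerian energy. Along `ℓ₂` the inner body is therefore frozen and the outer one follows a
rescaled Kepler flow (`fderiv_ang`). Periodicity excludes rectilinear motion, the angular momentum
and the Laplace vector are constant, and `𝒢²` becomes `gsq - lap · x⁽¹⁾` (`calGSq_eq`), an
expression that stays smooth through circular orbits.

Brackets. A function independent of `ℓ₂` has the same Hamiltonian vector all along the orbit, so its
bracket with the average is the average of its bracket with `1 / |x⁽¹⁾ - x⁽²⁾|`
(`poisson_avgPotential`). For `𝒢²` that bracket is the exact `ℓ₂`-derivative of a periodic function
(`poisson_avgPotential_calGSq`). The remaining brackets are invariances: components of `C` generate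
rotations, `Θ` rotates the outer body about `x⁽¹⁾`, `r₁` moves only `y⁽¹⁾`, and `Λ₂` moves only
`ℓ₂`.

Independence. Variations of the inner body alone leave `Λ₂` fixed. Testing on them reduces
independence to one claim: the derivative of the average, or of `𝒢`, as `x⁽¹⁾` rotates about `C⁽²⁾`
with the outer orbit fixed (`planeRot`), vanishes on no open set. For `𝒢` this is algebra. For the
average, vanishing would make the potential of a fixed orbit locally invariant under small
rotations. That potential is real analytic along entire paths off the orbit and diverges
logarithmically on it. Continuing the invariance along a path that ends at an apsis of a noncircular
orbit makes one side diverge while the other stays analytic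
(`not_analytic_continuation_ringPotential_sq`, `false_of_ringPotential_turn`). In the plane a path
may be forced to cross the orbit, and there a circular arc is used instead. The same singularity
separates the average from `𝒢`, because `𝒢²` is affine in `x⁽¹⁾`. -/

noncomputable section

open MeasureTheory Filter Topology Set

/-! ### Integrals depending on a parameter -/

section ParametricIntegral

variable {X F : Type*} [TopologicalSpace X] [NormedAddCommGroup F]

/-- Supplies the dominating constant for the integrals below. The function is bounded on the compact
slice over `x₀`, the bound increased by one holds on an open set, and the tube lemma makes this
uniform in `s`. -/
theorem exists_nhds_bound_of_continuousOn {f : X → ℝ → F} {W : Set (X × ℝ)} (hW : IsOpen W)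
    (hf : ContinuousOn (Function.uncurry f) W) {x₀ : X} {a b : ℝ}
    (hx : ∀ s ∈ uIcc a b, (x₀, s) ∈ W) :
    ∃ u ∈ 𝓝 x₀, ∃ B : ℝ, ∀ x ∈ u, ∀ s ∈ uIcc a b, (x, s) ∈ W ∧ ‖f x s‖ ≤ B := by
  have hc : ContinuousOn (fun s => f x₀ s) (uIcc a b) :=
    hf.comp (f := fun s => (x₀, s)) (by fun_prop) hx
  obtain ⟨B, hB⟩ := isCompact_uIcc.exists_bound_of_continuousOn hc
  have hW' : IsOpen (W ∩ (fun p => ‖Function.uncurry f p‖) ⁻¹' Iio (B + 1)) :=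
    hf.norm.isOpen_inter_preimage hW isOpen_Iio
  obtain ⟨u, v, hu, -, hxu, hv, huv⟩ := generalized_tube_lemma (isCompact_singleton (x := x₀))
    (isCompact_uIcc (a := a) (b := b)) hW' (by
      rintro ⟨x, s⟩ ⟨h1, h2⟩
      obtain rfl : x = x₀ := h1
      exact ⟨hx s h2, lt_of_le_of_lt (hB s h2) (lt_add_one B)⟩)
  refine ⟨u, hu.mem_nhds (hxu rfl), B + 1, fun x hx s hs => ?_⟩
  have := huv (show (x, s) ∈ u ×ˢ v from ⟨hx, hv hs⟩)
  exact ⟨this.1, le_of_lt this.2⟩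

theorem continuousAt_intervalIntegral_of_continuousOn [NormedSpace ℝ F]
    {f : X → ℝ → F} [FirstCountableTopology X] {W : Set (X × ℝ)}
    (hW : IsOpen W) (hf : ContinuousOn (Function.uncurry f) W) {x₀ : X} {a b : ℝ}
    (hx : ∀ s ∈ uIcc a b, (x₀, s) ∈ W) :
    ContinuousAt (fun x => ∫ s in a..b, f x s) x₀ := by
  obtain ⟨u, hu, B, hB⟩ := exists_nhds_bound_of_continuousOn hW hf hx
  refine intervalIntegral.continuousAt_of_dominated_interval (bound := fun _ => B) ?_ ?_
    intervalIntegrable_const ?_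
  · filter_upwards [hu] with x hx
    refine ContinuousOn.aestronglyMeasurable ?_ measurableSet_uIoc
    exact (hf.comp (f := fun s => (x, s)) (by fun_prop)
      (fun s hs => (hB x hx s hs).1)).mono uIoc_subset_uIcc
  · filter_upwards [hu] with x hx
    exact ae_of_all _ fun s hs => (hB x hx s (uIoc_subset_uIcc hs)).2
  · refine ae_of_all _ fun s hs => ?_
    exact (hf.continuousAt (hW.mem_nhds (hx s (uIoc_subset_uIcc hs)))).comp
      (f := fun x => (x, s)) (by fun_prop)

theorem hasFDerivAt_intervalIntegral_of_continuousOn {𝕜 H : Type*} [RCLike 𝕜]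
    [NormedSpace ℝ F] [NormedSpace 𝕜 F]
    [NormedAddCommGroup H] [NormedSpace 𝕜 H] {f : H → ℝ → F} {f' : H → ℝ → H →L[𝕜] F}
    {W : Set (H × ℝ)} (hW : IsOpen W) (hf : ContinuousOn (Function.uncurry f) W)
    (hf' : ContinuousOn (Function.uncurry f') W)
    (hd : ∀ p ∈ W, HasFDerivAt (fun x => f x p.2) (f' p.1 p.2) p.1)
    {x₀ : H} {a b : ℝ} (hx : ∀ s ∈ uIcc a b, (x₀, s) ∈ W) :
    HasFDerivAt (fun x => ∫ s in a..b, f x s) (∫ s in a..b, f' x₀ s) x₀ := by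
  obtain ⟨u, hu, B, hB⟩ := exists_nhds_bound_of_continuousOn hW hf' hx
  have hm : ∀ x ∈ u, ContinuousOn (f x) (uIcc a b) := fun x hx =>
    hf.comp (f := fun s => (x, s)) (by fun_prop) (fun s hs => (hB x hx s hs).1)
  refine intervalIntegral.hasFDerivAt_integral_of_dominated_of_fderiv_le (bound := fun _ => B)
    (F' := f') hu ?_ ?_ ?_ ?_ intervalIntegrable_const ?_
  · filter_upwards [hu] with x hx
    exact ((hm x hx).mono uIoc_subset_uIcc).aestronglyMeasurable measurableSet_uIoc
  · exact (hm x₀ (mem_of_mem_nhds hu)).intervalIntegrable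
  · refine ContinuousOn.aestronglyMeasurable ?_ measurableSet_uIoc
    exact (hf'.comp (f := fun s => (x₀, s)) (by fun_prop) hx).mono uIoc_subset_uIcc
  · exact ae_of_all _ fun s hs x hx => (hB x hx s (uIoc_subset_uIcc hs)).2
  · exact ae_of_all _ fun s hs x hx => hd (x, s) (hB x hx s (uIoc_subset_uIcc hs)).1

end ParametricIntegral

/-! ### The averaged potential of a closed curve and its singularity on the curve -/

namespace ThreeBody

/-- The average over `s ∈ [0, 2π]` of the Newtonian potential `1 / |x - X s|`. -/
def ringPotential {d : ℕ} (X : ℝ → E d) (x : E d) : ℝ :=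
  1 / (2 * Real.pi) * ∫ s in (0 : ℝ)..(2 * Real.pi), 1 / ‖x - X s‖

/-- The path `γ` has entire components. -/
def EntirePath {d : ℕ} (γ : ℝ → E d) : Prop :=
  ∃ c : ℂ → Fin d → ℂ, (∀ i, Differentiable ℂ fun τ => c τ i) ∧ ∀ (t : ℝ) i, c t i = (γ t i : ℂ)

section RingPotential

variable {d : ℕ} {X : ℝ → E d} {γ : ℝ → E d}

theorem EntirePath.continuous (hγ : EntirePath γ) : Continuous γ := by
  obtain ⟨c, hc, h⟩ := hγ
  have : Continuous fun t i => γ t i := by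
    refine continuous_pi fun i => ?_
    have : (fun t => γ t i) = fun t : ℝ => (c t i).re := by
      funext t; rw [h]; simp
    rw [this]
    have := (hc i).continuous
    fun_prop
  exact (PiLp.continuous_toLp 2 _).comp this

theorem cpow_neg_half_ofReal_sq {r : ℝ} (hr : 0 ≤ r) :
    (((r ^ 2 : ℝ) : ℂ)) ^ (-(1 / 2) : ℂ) = ((1 / r : ℝ) : ℂ) := by
  have : (-(1 / 2) : ℂ) = ((-(1 / 2) : ℝ) : ℂ) := by push_cast; rfl
  rw [this, ← Complex.ofReal_cpow (by positivity), Real.rpow_neg (by positivity),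
    ← Real.sqrt_eq_rpow, Real.sqrt_sq hr, one_div]

/-- The squared distance extends to the complex function `∑ (c τ i - X s i) ^ 2`, holomorphic in `τ`
and positive at `t₀`. Near `t₀` it stays in the slit plane, uniformly in `s`, where the power `-1/2`
is holomorphic. Differentiation under the integral makes the average holomorphic, and its real part
on the real axis is the potential. The curve `X` itself need only be continuous. -/
theorem analyticAt_ringPotential_comp (hX : Continuous X) (hγ : EntirePath γ) {t₀ : ℝ}
    (h : ∀ s, γ t₀ ≠ X s) : AnalyticAt ℝ (fun t => ringPotential X (γ t)) t₀ := by
  obtain ⟨c, hc, hcr⟩ := hγ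
  let N : ℂ → ℝ → ℂ := fun τ s => ∑ i, (c τ i - (X s i : ℂ)) ^ 2
  have hcc : ∀ i, Continuous fun τ => c τ i := fun i => (hc i).continuous
  have hXi : ∀ i, Continuous fun s => X s i := fun i => by fun_prop
  have hcd : ∀ i, Continuous fun τ => deriv (fun τ => c τ i) τ := fun i =>
    ((hc i).contDiff (n := 1)).continuous_deriv le_rfl
  have hN : Continuous (Function.uncurry N) := by
    refine continuous_finsetSum _ fun i _ => ?_
    have h1 : Continuous fun p : ℂ × ℝ => c p.1 i := (hcc i).comp continuous_fst
    have h2 : Continuous fun p : ℂ × ℝ => X p.2 i := (hXi i).comp continuous_snd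
    fun_prop
  have hNr : ∀ (t s : ℝ), N t s = ((‖γ t - X s‖ ^ 2 : ℝ) : ℂ) := by
    intro t s
    rw [EuclideanSpace.norm_sq_eq]
    push_cast
    refine Finset.sum_congr rfl fun i _ => ?_
    rw [hcr, ← Complex.ofReal_sub, ← Complex.ofReal_pow, ← Complex.ofReal_pow]
    simp
  let W : Set (ℂ × ℝ) := Function.uncurry N ⁻¹' Complex.slitPlane
  have hW : IsOpen W := Complex.isOpen_slitPlane.preimage hN
  let f : ℂ → ℝ → ℂ := fun τ s => N τ s ^ (-(1 / 2) : ℂ)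
  let f' : ℂ → ℝ → ℂ := fun τ s => -(1 / 2) * N τ s ^ (-(1 / 2) - 1 : ℂ) *
    ∑ i, 2 * (c τ i - (X s i : ℂ)) * deriv (fun τ => c τ i) τ
  have hf : ContinuousOn (Function.uncurry f) W :=
    hN.continuousOn.cpow_const fun p hp => hp
  have hf' : ContinuousOn (Function.uncurry f') W := by
    refine ContinuousOn.mul (continuousOn_const.mul (hN.continuousOn.cpow_const fun p hp => hp))
      (Continuous.continuousOn ?_)
    refine continuous_finsetSum _ fun i _ => ?_
    have h1 : Continuous fun p : ℂ × ℝ => c p.1 i := (hcc i).comp continuous_fst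
    have h2 : Continuous fun p : ℂ × ℝ => X p.2 i := (hXi i).comp continuous_snd
    have h3 : Continuous fun p : ℂ × ℝ => deriv (fun τ => c τ i) p.1 := (hcd i).comp continuous_fst
    fun_prop
  have hd : ∀ p ∈ W, HasDerivAt (fun τ => f τ p.2) (f' p.1 p.2) p.1 := by
    intro p hp
    have h1 : HasDerivAt (fun τ => N τ p.2)
        (∑ i, 2 * (c p.1 i - (X p.2 i : ℂ)) * deriv (fun τ => c τ i) p.1) p.1 := by
      refine HasDerivAt.fun_sum fun i _ => ?_
      have := (((hc i) p.1).hasDerivAt.sub_const (X p.2 i : ℂ)).pow 2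
      simpa using! this
    exact h1.cpow_const hp
  have hmem : ∀ s ∈ uIcc 0 (2 * Real.pi), ((t₀ : ℂ), s) ∈ W := by
    intro s _
    change N t₀ s ∈ Complex.slitPlane
    rw [hNr]
    exact Complex.ofReal_mem_slitPlane.2 (by have := norm_pos_iff.2 (sub_ne_zero.2 (h s)); positivity)
  obtain ⟨u, hu, _, hB⟩ := exists_nhds_bound_of_continuousOn hW hf hmem
  have hdiff : ∀ᶠ τ in 𝓝 (t₀ : ℂ),
      DifferentiableAt ℂ (fun τ => ∫ s in (0 : ℝ)..(2 * Real.pi), f τ s) τ := by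
    filter_upwards [hu] with τ hτ
    refine (hasFDerivAt_intervalIntegral_of_continuousOn (𝕜 := ℂ)
      (f' := fun τ s => ContinuousLinearMap.toSpanSingleton ℂ (f' τ s)) hW hf ?_
      (fun p hp => (hd p hp).hasFDerivAt) (fun s hs => (hB τ hτ s hs).1)).differentiableAt
    exact (ContinuousLinearMap.toSpanSingletonCLE (𝕜 := ℂ) (E := ℂ)).continuous.comp_continuousOn hf'
  have han := (Complex.analyticAt_iff_eventually_differentiableAt.2 hdiff).re_ofReal
  have : (fun t => ringPotential X (γ t)) = fun t : ℝ => 1 / (2 * Real.pi) *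
      (∫ s in (0 : ℝ)..(2 * Real.pi), f t s).re := by
    funext t
    have : (fun s => f t s) = fun s => ((1 / ‖γ t - X s‖ : ℝ) : ℂ) := by
      funext s
      change N t s ^ (-(1 / 2) : ℂ) = _
      rw [hNr, cpow_neg_half_ofReal_sq (norm_nonneg _)]
    rw [this, intervalIntegral.integral_ofReal, Complex.ofReal_re]
    rfl
  rw [this]
  exact analyticAt_const.mul han

/-- A curve of speed at most `K` is at distance at most `ε + K (s - s₀)` from `x`, where `ε` is the
distance at `s₀`. The reciprocal of this bound integrates to a logarithm, which diverges as `ε`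
tends to zero. -/
theorem le_ringPotential (hX : Continuous X) (hp : Function.Periodic X (2 * Real.pi)) {K : ℝ}
    (hK : 0 < K) (hL : ∀ s t, ‖X s - X t‖ ≤ K * |s - t|) {x : E d} (hx : ∀ s, x ≠ X s) (s₀ : ℝ) :
    1 / (2 * Real.pi) * (Real.log (1 + 2 * Real.pi * K / ‖x - X s₀‖) / K) ≤ ringPotential X x := by
  unfold ringPotential
  refine mul_le_mul_of_nonneg_left ?_ (by positivity)
  -- By periodicity the period can be taken to start at `s₀`, so that `s - s₀` is nonnegative on it.
  have hper : Function.Periodic (fun s => 1 / ‖x - X s‖) (2 * Real.pi) := fun s => by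
    simp only [hp s]
  have h0 := hper.intervalIntegral_add_eq 0 s₀
  rw [zero_add] at h0
  rw [h0]
  set ε := ‖x - X s₀‖ with hε
  have hε0 : 0 < ε := norm_pos_iff.2 (sub_ne_zero.2 (hx s₀))
  have hint : ∫ s in s₀..(s₀ + 2 * Real.pi), 1 / (ε + K * (s - s₀)) =
      Real.log (1 + 2 * Real.pi * K / ε) / K := by
    have hd : ∀ s ∈ uIcc s₀ (s₀ + 2 * Real.pi),
        HasDerivAt (fun s => Real.log (ε + K * (s - s₀)) / K) (1 / (ε + K * (s - s₀))) s := by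
      intro s hs
      rw [uIcc_of_le (by linarith [Real.pi_pos])] at hs
      have hpos : 0 < ε + K * (s - s₀) := by
        have := mul_nonneg hK.le (sub_nonneg.2 hs.1); linarith
      have h1 : HasDerivAt (fun s => ε + K * (s - s₀)) K s := by
        simpa using (((hasDerivAt_id s).sub_const s₀).const_mul K).const_add ε
      have := (h1.log hpos.ne').div_const K
      rwa [div_right_comm, div_self hK.ne'] at this
    rw [intervalIntegral.integral_eq_sub_of_hasDerivAt hd]
    · rw [← sub_div, ← Real.log_div]
      · have : (ε + K * (s₀ + 2 * Real.pi - s₀)) / (ε + K * (s₀ - s₀)) =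
            1 + 2 * Real.pi * K / ε := by
          rw [sub_self, mul_zero, add_zero, add_div, div_self hε0.ne']
          ring
        rw [this]
      · have := Real.pi_pos
        have : ε + K * (s₀ + 2 * Real.pi - s₀) = ε + K * (2 * Real.pi) := by ring
        rw [this]; positivity
      · simp [hε0.ne']
    · refine ContinuousOn.intervalIntegrable (ContinuousOn.div continuousOn_const (by fun_prop) ?_)
      intro s hs
      rw [uIcc_of_le (by linarith [Real.pi_pos])] at hs
      have := mul_nonneg hK.le (sub_nonneg.2 hs.1)
      positivity
  rw [← hint]
  refine intervalIntegral.integral_mono_on (by linarith [Real.pi_pos]) ?_ ?_ ?_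
  · refine ContinuousOn.intervalIntegrable (ContinuousOn.div continuousOn_const (by fun_prop) ?_)
    intro s hs
    rw [uIcc_of_le (by linarith [Real.pi_pos])] at hs
    have := mul_nonneg hK.le (sub_nonneg.2 hs.1)
    positivity
  · refine Continuous.intervalIntegrable (Continuous.div continuous_const (by fun_prop) ?_) _ _
    exact fun s => norm_ne_zero_iff.2 (sub_ne_zero.2 (hx s))
  · intro s hs
    have h1 : ‖x - X s‖ ≤ ε + K * (s - s₀) := by
      calc ‖x - X s‖ = ‖(x - X s₀) + (X s₀ - X s)‖ := by congr 1; abel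
        _ ≤ ε + ‖X s₀ - X s‖ := norm_add_le _ _
        _ ≤ _ := by
          have := hL s₀ s
          rw [abs_sub_comm, abs_of_nonneg (sub_nonneg.2 hs.1)] at this
          linarith
    exact one_div_le_one_div_of_le (norm_pos_iff.2 (sub_ne_zero.2 (hx s))) h1

/-- Up to the first time at which `γ` meets the curve the potential is analytic, so its square
equals `b` by the identity theorem. At that time the square diverges while `b` has a finite limit.
The square allows comparison with `𝒢²`, which is affine in `x⁽¹⁾`. -/
theorem not_analytic_continuation_ringPotential_sq (hX : Continuous X)
    (hp : Function.Periodic X (2 * Real.pi)) {K : ℝ}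
    (hK : 0 < K) (hL : ∀ s t, ‖X s - X t‖ ≤ K * |s - t|) (hγ : EntirePath γ) {b : ℝ → ℝ}
    (hb : ∀ t ∈ Icc (0 : ℝ) 1, AnalyticAt ℝ b t)
    (h0 : ∀ᶠ t in 𝓝 0, ringPotential X (γ t) ^ 2 = b t)
    (hγ0 : ∀ s, γ 0 ≠ X s) {s₁ : ℝ} (hγ1 : γ 1 = X s₁) : False := by
  have hγc := hγ.continuous
  -- The meeting times in `[0, 1]`. Restricting `s` to one period makes this set compact, so a first
  -- meeting time exists; it may precede `1`.
  let S : Set ℝ := Prod.fst '' {p : ℝ × ℝ | p ∈ Icc (0 : ℝ) 1 ×ˢ Icc 0 (2 * Real.pi) ∧ γ p.1 = X p.2}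
  have hScomp : IsCompact S := by
    refine IsCompact.image ?_ continuous_fst
    exact (isCompact_Icc.prod isCompact_Icc).inter_right
      (isClosed_eq (hγc.comp continuous_fst) (hX.comp continuous_snd))
  have hmem : ∀ t ∈ Icc (0 : ℝ) 1, ∀ s, γ t = X s → t ∈ S := by
    intro t ht s hs
    obtain ⟨s', hs', he⟩ := hp.exists_mem_Ico₀ (by positivity) s
    exact ⟨(t, s'), ⟨⟨ht, Ico_subset_Icc_self hs'⟩, hs.trans he⟩, rfl⟩
  obtain ⟨τ, hτS, hτ⟩ := hScomp.exists_isLeast ⟨1, hmem 1 (by simp) s₁ hγ1⟩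
  obtain ⟨⟨τ', s₀⟩, ⟨⟨hτ01, -⟩, hτX⟩, rfl⟩ := hτS
  have hτ0 : 0 < τ' := lt_of_le_of_ne hτ01.1 (by rintro rfl; exact hγ0 s₀ hτX)
  simp only at hτ hτ01 hτX
  have hoff : ∀ t ∈ Ico 0 τ', ∀ s, γ t ≠ X s := fun t ht s hs =>
    absurd (hτ (hmem t ⟨ht.1, ht.2.le.trans hτ01.2⟩ s hs)) (not_le.2 ht.2)
  have heq : EqOn (fun t => ringPotential X (γ t) ^ 2) b (Ico 0 τ') := by
    refine AnalyticOnNhd.eqOn_of_preconnected_of_eventuallyEq (𝕜 := ℝ) ?_ ?_ isPreconnected_Ico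
      (z₀ := 0) ⟨le_rfl, hτ0⟩ h0
    · exact fun t ht => (analyticAt_ringPotential_comp hX hγ (hoff t ht)).pow 2
    · exact fun t ht => hb t ⟨ht.1, ht.2.le.trans hτ01.2⟩
  have hlim : Tendsto (fun t => ‖γ t - X s₀‖) (𝓝[<] τ') (𝓝[>] 0) := by
    refine tendsto_nhdsWithin_iff.2 ⟨?_, ?_⟩
    · have : Tendsto (fun t => ‖γ t - X s₀‖) (𝓝 τ') (𝓝 ‖γ τ' - X s₀‖) := by
        apply Continuous.tendsto; fun_prop
      rw [hτX, sub_self, norm_zero] at this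
      exact this.mono_left nhdsWithin_le_nhds
    · filter_upwards [Ico_mem_nhdsLT hτ0] with t ht
      exact norm_pos_iff.2 (sub_ne_zero.2 (hoff t ht s₀))
  have hlog : Tendsto (fun t => 1 / (2 * Real.pi) *
      (Real.log (1 + 2 * Real.pi * K / ‖γ t - X s₀‖) / K)) (𝓝[<] τ') atTop := by
    refine Tendsto.const_mul_atTop (by positivity) (Tendsto.atTop_div_const hK ?_)
    refine Real.tendsto_log_atTop.comp (tendsto_atTop_add_const_left _ _ ?_)
    refine Tendsto.const_mul_atTop (by positivity) ?_
    exact tendsto_inv_nhdsGT_zero.comp hlim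
  have hF : Tendsto (fun t => ringPotential X (γ t)) (𝓝[<] τ') atTop := by
    refine tendsto_atTop_mono' _ ?_ hlog
    filter_upwards [Ico_mem_nhdsLT hτ0] with t ht
    exact le_ringPotential hX hp hK hL (hoff t ht) s₀
  have hF2 : Tendsto b (𝓝[<] τ') atTop := by
    refine ((tendsto_pow_atTop (n := 2) two_ne_zero).comp hF).congr' ?_
    filter_upwards [Ico_mem_nhdsLT hτ0] with t ht
    exact heq ht
  exact not_tendsto_atTop_of_tendsto_nhds
    ((hb τ' hτ01).continuousAt.tendsto.mono_left nhdsWithin_le_nhds) hF2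

end RingPotential


/-! ### Linear symplectic algebra and the Poisson bracket -/

section Symplectic

variable {n d : ℕ}

theorem poisson_antisymm (f g : Coord n → ℝ) (z : Coord n) : poisson f g z = -poisson g f z := by
  unfold poisson
  rw [neg_add, ← Finset.sum_neg_distrib]
  congr 1
  · ring
  · exact Finset.sum_congr rfl fun i _ => by ring

theorem coord_decomposition (ξ : Coord n) :
    ξ = ξ.mom • (1, 0, 0, 0) + ξ.ang • (0, 1, 0, 0) +
      ∑ i, (ξ.u i • ((0, 0, Pi.single i 1, 0) : Coord n) +
        ξ.v i • ((0, 0, 0, Pi.single i 1) : Coord n)) := by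
  have h : ∀ w : Fin n → ℝ, w = ∑ i, w i • (Pi.single i 1 : Fin n → ℝ) := fun w => by
    simpa using (pi_eq_sum_univ' w)
  obtain ⟨a, b, u, v⟩ := ξ
  refine Prod.ext ?_ (Prod.ext ?_ (Prod.ext ?_ ?_))
  · simp [Coord.mom, Prod.fst_sum]
  · simp [Coord.ang, Prod.fst_sum, Prod.snd_sum]
  · simpa [Coord.u, Prod.fst_sum, Prod.snd_sum] using h u
  · simpa [Coord.v, Prod.snd_sum] using h v

theorem coordForm_mom (ξ : Coord n) : coordForm ξ (0, 1, 0, 0) = ξ.mom := by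
  simp [coordForm, Coord.mom, Coord.ang, Coord.u, Coord.v]

theorem coordForm_ang (ξ : Coord n) : coordForm ξ (1, 0, 0, 0) = -ξ.ang := by
  simp [coordForm, Coord.mom, Coord.ang, Coord.u, Coord.v]

theorem coordForm_u (ξ : Coord n) (i : Fin n) :
    coordForm ξ (0, 0, 0, Pi.single i 1) = ξ.u i := by
  simp [coordForm, Coord.mom, Coord.ang, Coord.u, Coord.v, Pi.single_apply]

theorem coordForm_v (ξ : Coord n) (i : Fin n) :
    coordForm ξ (0, 0, Pi.single i 1, 0) = -ξ.v i := by
  simp [coordForm, Coord.mom, Coord.ang, Coord.u, Coord.v, Pi.single_apply]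

theorem eq_zero_of_coordForm_eq_zero {ξ : Coord n} (h : ∀ η, coordForm ξ η = 0) : ξ = 0 := by
  rw [coord_decomposition ξ, ← coordForm_mom, ← neg_neg ξ.ang, ← coordForm_ang, h, h]
  have hu : ∀ i, ξ.u i = 0 := fun i => by rw [← coordForm_u, h]
  have hv : ∀ i, ξ.v i = 0 := fun i => by rw [← neg_neg (ξ.v i), ← coordForm_v, h, neg_zero]
  simp [hu, hv]

/-- Here `ξ` is the Hamiltonian vector of `g`, so a bracket becomes a single directional derivative.
Only the linear maps `fderiv` enter, hence the identity also holds at points where a function is not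
differentiable. -/
theorem poisson_eq_of_coordForm {f g : Coord n → ℝ} {z ξ : Coord n}
    (h : ∀ η, coordForm ξ η = fderiv ℝ g z η) : poisson f g z = fderiv ℝ f z ξ := by
  conv_rhs => rw [coord_decomposition ξ]
  simp only [map_add, map_smul, map_sum, smul_eq_mul]
  unfold poisson
  have h3 : ∀ i, ξ.u i = fderiv ℝ g z (0, 0, 0, Pi.single i 1) := fun i => by
    rw [← h, coordForm_u]
  have h4 : ∀ i, ξ.v i = -fderiv ℝ g z (0, 0, Pi.single i 1, 0) := fun i => by
    rw [← h, coordForm_v, neg_neg]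
  rw [← h, ← h, coordForm_mom, coordForm_ang]
  congr 1
  · ring
  · exact Finset.sum_congr rfl fun i _ => by rw [h3, h4]; ring

theorem exists_coordForm_eq (L : Coord n →L[ℝ] ℝ) : ∃ ξ, ∀ η, coordForm ξ η = L η := by
  refine ⟨(L (0, 1, 0, 0), -L (1, 0, 0, 0), fun i => L (0, 0, 0, Pi.single i 1),
    fun i => -L (0, 0, Pi.single i 1, 0)), fun η => ?_⟩
  conv_rhs => rw [coord_decomposition η]
  simp only [map_add, map_smul, map_sum, smul_eq_mul]
  simp only [coordForm, Coord.mom, Coord.ang, Coord.u, Coord.v]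
  congr 1
  · ring
  · exact Finset.sum_congr rfl fun i _ => by ring

theorem eq_of_phaseForm_eq {p q : Phase d} (h : ∀ w, phaseForm p w = phaseForm q w) : p = q := by
  obtain ⟨a, b, c, e⟩ := p
  obtain ⟨a', b', c', e'⟩ := q
  have h1 : a = a' := ext_inner_right ℝ fun w => by simpa [phaseForm] using h (0, 0, w, 0)
  have h2 : b = b' := ext_inner_right ℝ fun w => by simpa [phaseForm] using h (0, 0, 0, w)
  have h3 : c = c' := ext_inner_left ℝ fun w => by simpa [phaseForm] using h (w, 0, 0, 0)
  have h4 : e = e' := ext_inner_left ℝ fun w => by simpa [phaseForm] using h (0, w, 0, 0)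
  rw [h1, h2, h3, h4]

end Symplectic

/-! ### Canonical maps as local diffeomorphisms -/

namespace OuterKeplerMap

variable {d : ℕ} (C : OuterKeplerMap d) {z : Coord (2 * d - 1)}

theorem isOpen_domain : IsOpen C.domain := by
  have h1 : Continuous fun z : Coord (2 * d - 1) => z.mom := continuous_fst
  have h2 : Continuous fun z : Coord (2 * d - 1) => (z.u, z.v) :=
    continuous_snd.comp continuous_snd
  exact (C.isOpen_A.preimage h1).inter (C.isOpen_V.preimage h2)

theorem nonempty_domain : C.domain.Nonempty := by
  obtain ⟨a, ha⟩ := C.nonempty_A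
  obtain ⟨⟨u, v⟩, hv⟩ := C.isConnected_V.nonempty
  exact ⟨(a, 0, u, v), ha, hv⟩

variable {C}

theorem setAng_mem (hz : z ∈ C.domain) (s : ℝ) : z.setAng s ∈ C.domain := hz

theorem mom_pos (hz : z ∈ C.domain) : 0 < z.mom := C.A_pos hz.1

theorem contDiffAt (hz : z ∈ C.domain) : ContDiffAt ℝ 1 C.toFun z :=
  C.contDiffOn.contDiffAt (C.isOpen_domain.mem_nhds hz)

theorem differentiableAt (hz : z ∈ C.domain) : DifferentiableAt ℝ C.toFun z :=
  (contDiffAt hz).differentiableAt (by norm_num)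

/-- A kernel vector pairs to zero with every vector under `coordForm`, by canonicity, and that form
is nondegenerate. -/
theorem injective_fderiv (hz : z ∈ C.domain) : Function.Injective (fderiv ℝ C.toFun z) := by
  rw [injective_iff_map_eq_zero]
  intro ξ hξ
  refine eq_zero_of_coordForm_eq_zero fun η => ?_
  rw [← C.canonical z hz.1 hz.2, hξ]
  simp [phaseForm]

theorem bijective_fderiv (hd : 0 < d) (hz : z ∈ C.domain) :
    Function.Bijective (fderiv ℝ C.toFun z) := by
  refine ⟨injective_fderiv hz, ?_⟩
  -- Both dimensions are `4 * d`. For `d = 0` truncated subtraction would give `2` against `0`.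
  have hr : Module.finrank ℝ (Coord (2 * d - 1)) = Module.finrank ℝ (Phase d) := by
    simp only [Module.finrank_prod, Module.finrank_self, Module.finrank_fin_fun,
      finrank_euclideanSpace_fin]
    omega
  exact (LinearMap.injective_iff_surjective_of_finrank_eq_finrank
    (f := (fderiv ℝ C.toFun z).toLinearMap) hr).1 (injective_fderiv hz)

/-- The Cartesian form of the Hamiltonian vector: brackets with `g` are computed by letting the
phase point move with velocity `w`. Every concrete bracket below comes from such a `w`. -/
theorem exists_poisson_eq (hd : 0 < d) (hz : z ∈ C.domain) {g : Coord (2 * d - 1) → ℝ} {w : Phase d}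
    (hg : ∀ η, fderiv ℝ g z η = phaseForm w (fderiv ℝ C.toFun z η)) :
    ∃ ξ, fderiv ℝ C.toFun z ξ = w ∧ ∀ f, poisson f g z = fderiv ℝ f z ξ := by
  obtain ⟨ξ, rfl⟩ := (bijective_fderiv hd hz).2 w
  exact ⟨ξ, rfl, fun f => poisson_eq_of_coordForm fun η => by
    rw [hg, C.canonical z hz.1 hz.2]⟩

theorem map_nhds (hd : 0 < d) (hz : z ∈ C.domain) : map C.toFun (𝓝 z) = 𝓝 (C.toFun z) := by
  have h := (contDiffAt hz).hasStrictFDerivAt (by norm_num)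
  refine h.map_nhds_eq_of_surj ?_
  exact LinearMap.range_eq_top.2 (bijective_fderiv hd hz).2

theorem hasDerivAt_line (hz : z ∈ C.domain) (η : Coord (2 * d - 1)) :
    HasDerivAt (fun t : ℝ => C.toFun (z + t • η)) (fderiv ℝ C.toFun z η) 0 :=
  (differentiableAt hz).hasFDerivAt.hasLineDerivAt η

theorem hasDerivAt_components {σ : ℝ → Phase d} {σ' : Phase d} {t : ℝ} (h : HasDerivAt σ σ' t) :
    HasDerivAt (fun t => (σ t).1) σ'.1 t ∧ HasDerivAt (fun t => (σ t).2.1) σ'.2.1 t ∧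
    HasDerivAt (fun t => (σ t).2.2.1) σ'.2.2.1 t ∧ HasDerivAt (fun t => (σ t).2.2.2) σ'.2.2.2 t := by
  have h := h.hasFDerivAt
  exact ⟨by simpa using! h.fst.hasDerivAt, by simpa using! h.snd.fst.hasDerivAt,
    by simpa using! h.snd.snd.fst.hasDerivAt, by simpa using! h.snd.snd.snd.hasDerivAt⟩

theorem hasDerivAt_y₁ (hz : z ∈ C.domain) (η : Coord (2 * d - 1)) :
    HasDerivAt (fun t : ℝ => C.y₁ (z + t • η)) (fderiv ℝ C.toFun z η).1 0 :=
  (hasDerivAt_components (hasDerivAt_line hz η)).1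

theorem hasDerivAt_y₂ (hz : z ∈ C.domain) (η : Coord (2 * d - 1)) :
    HasDerivAt (fun t : ℝ => C.y₂ (z + t • η)) (fderiv ℝ C.toFun z η).2.1 0 :=
  (hasDerivAt_components (hasDerivAt_line hz η)).2.1

theorem hasDerivAt_x₁ (hz : z ∈ C.domain) (η : Coord (2 * d - 1)) :
    HasDerivAt (fun t : ℝ => C.x₁ (z + t • η)) (fderiv ℝ C.toFun z η).2.2.1 0 :=
  (hasDerivAt_components (hasDerivAt_line hz η)).2.2.1

theorem hasDerivAt_x₂ (hz : z ∈ C.domain) (η : Coord (2 * d - 1)) :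
    HasDerivAt (fun t : ℝ => C.x₂ (z + t • η)) (fderiv ℝ C.toFun z η).2.2.2 0 :=
  (hasDerivAt_components (hasDerivAt_line hz η)).2.2.2

theorem fderiv_eq_of_hasDerivAt {F : Coord (2 * d - 1) → ℝ} (hF : DifferentiableAt ℝ F z)
    {η : Coord (2 * d - 1)} {D : ℝ} (h : HasDerivAt (fun t : ℝ => F (z + t • η)) D 0) :
    fderiv ℝ F z η = D :=
  (hF.hasFDerivAt.hasLineDerivAt η).unique h

end OuterKeplerMap

theorem hasDerivAt_norm_of_ne {V : Type*} [NormedAddCommGroup V] [InnerProductSpace ℝ V]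
    {x : ℝ → V} {x' : V} {t : ℝ} (h : HasDerivAt x x' t) (hx : x t ≠ 0) :
    HasDerivAt (fun t => ‖x t‖) (inner ℝ (x t) x' / ‖x t‖) t := by
  have h1 := h.norm_sq.sqrt (by simpa using hx)
  simp only [Real.sqrt_sq (norm_nonneg _)] at h1
  convert h1 using 1
  rw [mul_div_mul_left _ _ two_ne_zero]

/-! ### Kepler motion along `ℓ₂` -/

namespace OuterKeplerMap

variable {d : ℕ} {C : OuterKeplerMap d} {z : Coord (2 * d - 1)}

variable (C) in
/-- The rate `dt / dℓ₂` divided by the mass, in `dx⁽²⁾/dℓ₂ = rate • y⁽²⁾`. -/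
def rate (z : Coord (2 * d - 1)) : ℝ := z.mom ^ 3 / (C.m₂ ^ 4 * C.M₂ ^ 2)

variable (C) in
/-- The coefficient `𝔪₂² 𝔐₂`. -/
def mass : ℝ := C.m₂ ^ 2 * C.M₂

theorem mass_pos : 0 < C.mass := mul_pos (pow_pos C.m₂_pos 2) C.M₂_pos

theorem rate_pos (hz : z ∈ C.domain) : 0 < C.rate z :=
  div_pos (pow_pos (mom_pos hz) 3) (mul_pos (pow_pos C.m₂_pos 4) (pow_pos C.M₂_pos 2))

theorem eventually_line_mem (hz : z ∈ C.domain) (η : Coord (2 * d - 1)) :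
    ∀ᶠ t : ℝ in 𝓝 0, z + t • η ∈ C.domain := by
  have : ContinuousAt (fun t : ℝ => z + t • η) 0 := by fun_prop
  exact this.eventually_mem (by simpa using C.isOpen_domain.mem_nhds hz)

theorem x₁_ne (hz : z ∈ C.domain) : C.x₁ z ≠ 0 := C.x₁_ne_zero z hz.1 hz.2
theorem x₂_ne (hz : z ∈ C.domain) : C.x₂ z ≠ 0 := C.x₂_ne_zero z hz.1 hz.2
theorem x₁_ne_x₂' (hz : z ∈ C.domain) : C.x₁ z ≠ C.x₂ z := C.x₁_ne_x₂ z hz.1 hz.2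

theorem norm_x₂_pos (hz : z ∈ C.domain) : 0 < ‖C.x₂ z‖ := norm_pos_iff.2 (x₂_ne hz)

theorem norm_sq_y₂ (hz : z ∈ C.domain) :
    ‖C.y₂ z‖ ^ 2 = 2 * C.mass / ‖C.x₂ z‖ - C.mass ^ 2 / z.mom ^ 2 := by
  have h := C.kepler z hz.1 hz.2
  change ‖C.y₂ z‖ ^ 2 / (2 * C.m₂) - C.m₂ * C.M₂ / ‖C.x₂ z‖ = _ at h
  have hm := C.m₂_pos
  have h1 : ‖C.y₂ z‖ ^ 2 = 2 * C.m₂ * (‖C.y₂ z‖ ^ 2 / (2 * C.m₂)) := by field_simp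
  rw [h1, eq_add_of_sub_eq h, mass]
  have := mom_pos hz
  have := norm_x₂_pos hz
  field_simp
  ring

/-- Obtained by differentiating the energy law along `η`. It expresses the differential of `Λ₂`
through the variations of `x⁽²⁾` and `y⁽²⁾` alone. -/
theorem fderiv_kepler (hz : z ∈ C.domain) (η : Coord (2 * d - 1)) :
    inner ℝ (C.y₂ z) (fderiv ℝ C.toFun z η).2.1 +
      C.mass / ‖C.x₂ z‖ ^ 3 * inner ℝ (C.x₂ z) (fderiv ℝ C.toFun z η).2.2.2 =
    C.mass ^ 2 / z.mom ^ 3 * η.mom := by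
  have hΛ := mom_pos hz
  have hr := norm_x₂_pos hz
  have hz0 : z + (0 : ℝ) • η = z := by simp
  have h1 := (hasDerivAt_y₂ hz η).norm_sq
  have h2 := hasDerivAt_norm_of_ne (hasDerivAt_x₂ hz η) (by rw [hz0]; exact x₂_ne hz)
  have h3 := (h2.inv (by rw [hz0]; exact hr.ne')).const_mul (2 * C.mass)
  have h4 : HasDerivAt (fun t : ℝ => (z + t • η).mom) η.mom 0 := by
    have : HasDerivAt (fun t : ℝ => z.mom + t * η.mom) η.mom 0 := by
      simpa using ((hasDerivAt_id (0 : ℝ)).mul_const η.mom).const_add z.mom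
    exact this
  have h5 := (((h4.pow 2).inv (by simpa [hz0] using hΛ.ne')).const_mul (C.mass ^ 2))
  have h6 := h1.unique ((h3.sub h5).congr_of_eventuallyEq (by
    filter_upwards [eventually_line_mem hz η] with t ht
    simpa [div_eq_mul_inv] using norm_sq_y₂ ht))
  simp only [hz0, Pi.pow_apply] at h6
  have hne := hΛ.ne'
  field_simp at h6 ⊢
  simp at h6
  refine mul_left_cancel₀ (mul_ne_zero two_ne_zero hne) ?_
  linarith

/-- The vector `∂/∂ℓ₂` represents `-dΛ₂` for the symplectic form. By canonicity its image represents
the same form in Cartesian variables, where `fderiv_kepler` evaluates it, and nondegeneracy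
identifies the image. -/
theorem fderiv_ang (hd : 0 < d) (hz : z ∈ C.domain) :
    fderiv ℝ C.toFun z (0, 1, 0, 0) =
      (0, (-(C.mass * C.rate z / ‖C.x₂ z‖ ^ 3)) • C.x₂ z, 0, C.rate z • C.y₂ z) := by
  refine eq_of_phaseForm_eq fun w => ?_
  obtain ⟨η, rfl⟩ := (bijective_fderiv hd hz).2 w
  rw [C.canonical z hz.1 hz.2]
  have h := fderiv_kepler hz η
  have h0 : coordForm ((0, 1, 0, 0) : Coord (2 * d - 1)) η = -η.mom := by
    simp [coordForm, Coord.mom, Coord.ang, Coord.u, Coord.v]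
  -- `rate` is the reciprocal of the coefficient of `dΛ₂` in `fderiv_kepler`.
  have hk : C.mass ^ 2 / z.mom ^ 3 * C.rate z = 1 := by
    have := mom_pos hz
    have := C.m₂_pos
    have := C.M₂_pos
    unfold mass rate
    field_simp
  have h1 : η.mom = C.rate z * (C.mass ^ 2 / z.mom ^ 3 * η.mom) := by
    linear_combination (-η.mom) * hk
  rw [h0, h1, ← h]
  simp only [phaseForm, inner_smul_left, inner_smul_right, inner_zero_left, inner_zero_right]
  rw [real_inner_comm (C.y₂ z)]
  simp
  ring

theorem hasDerivAt_setAng (z : Coord (2 * d - 1)) (s : ℝ) :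
    HasDerivAt (fun s => z.setAng s) (0, 1, 0, 0) s := by
  unfold Coord.setAng
  exact (hasDerivAt_const _ _).prodMk ((hasDerivAt_id s).prodMk
    ((hasDerivAt_const _ _).prodMk (hasDerivAt_const _ _)))

theorem hasDerivAt_toFun_setAng (hd : 0 < d) (hz : z ∈ C.domain) (s : ℝ) :
    HasDerivAt (fun s => C.toFun (z.setAng s))
      (0, (-(C.mass * C.rate z / ‖C.x₂ (z.setAng s)‖ ^ 3)) • C.x₂ (z.setAng s), 0,
        C.rate z • C.y₂ (z.setAng s)) s := by
  have h := (differentiableAt (setAng_mem hz s)).hasFDerivAt.comp_hasDerivAt s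
    (hasDerivAt_setAng z s)
  rwa [fderiv_ang hd (setAng_mem hz s)] at h

theorem hasDerivAt_x₂_setAng (hd : 0 < d) (hz : z ∈ C.domain) (s : ℝ) :
    HasDerivAt (fun s => C.x₂ (z.setAng s)) (C.rate z • C.y₂ (z.setAng s)) s :=
  (hasDerivAt_components (hasDerivAt_toFun_setAng hd hz s)).2.2.2

theorem hasDerivAt_y₂_setAng (hd : 0 < d) (hz : z ∈ C.domain) (s : ℝ) :
    HasDerivAt (fun s => C.y₂ (z.setAng s))
      ((-(C.mass * C.rate z / ‖C.x₂ (z.setAng s)‖ ^ 3)) • C.x₂ (z.setAng s)) s :=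
  (hasDerivAt_components (hasDerivAt_toFun_setAng hd hz s)).2.1

theorem setAng_ang (z : Coord (2 * d - 1)) : z.setAng z.ang = z := rfl

theorem eq_of_forall_hasDerivAt_zero {V : Type*} [NormedAddCommGroup V] [NormedSpace ℝ V]
    {f : ℝ → V} (h : ∀ s, HasDerivAt f 0 s) (s t : ℝ) : f s = f t :=
  is_const_of_deriv_eq_zero (fun s => (h s).differentiableAt) (fun s => (h s).deriv) s t

theorem x₁_setAng (hd : 0 < d) (hz : z ∈ C.domain) (s : ℝ) : C.x₁ (z.setAng s) = C.x₁ z :=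
  eq_of_forall_hasDerivAt_zero (f := fun s => C.x₁ (z.setAng s)) (fun s =>
    (hasDerivAt_components (hasDerivAt_toFun_setAng hd hz s)).2.2.1) s z.ang

theorem y₁_setAng (hd : 0 < d) (hz : z ∈ C.domain) (s : ℝ) : C.y₁ (z.setAng s) = C.y₁ z :=
  eq_of_forall_hasDerivAt_zero (f := fun s => C.y₁ (z.setAng s)) (fun s =>
    (hasDerivAt_components (hasDerivAt_toFun_setAng hd hz s)).1) s z.ang

theorem periodic_toFun (hz : z ∈ C.domain) :
    Function.Periodic (fun s => C.toFun (z.setAng s)) (2 * Real.pi) :=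
  fun s => C.periodic (z.setAng s) hz.1 hz.2

theorem periodic_x₂ (hz : z ∈ C.domain) :
    Function.Periodic (fun s => C.x₂ (z.setAng s)) (2 * Real.pi) :=
  fun s => congrArg (fun p : Phase d => p.2.2.2) (periodic_toFun hz s)

theorem periodic_y₂ (hz : z ∈ C.domain) :
    Function.Periodic (fun s => C.y₂ (z.setAng s)) (2 * Real.pi) :=
  fun s => congrArg (fun p : Phase d => p.2.1) (periodic_toFun hz s)

end OuterKeplerMap

theorem inner_toSpace {d : ℕ} (hd : d ≤ 3) (x y : E d) :
    inner ℝ (toSpace x) (toSpace y) = inner ℝ x y := by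
  interval_cases d
  · simp [toSpace, PiLp.inner_apply]
    rfl
  all_goals simp [toSpace, PiLp.inner_apply, Fin.sum_univ_succ]

/-- Lagrange's identity, checked in coordinates. It identifies `G₂²` with the polynomial `gsq` used
below. -/
theorem norm_cross_sq {d : ℕ} (hd : d ≤ 3) (x y : E d) :
    ‖cross x y‖ ^ 2 = ‖x‖ ^ 2 * ‖y‖ ^ 2 - inner ℝ x y ^ 2 := by
  rw [← real_inner_self_eq_norm_sq x, ← real_inner_self_eq_norm_sq y, ← inner_toSpace hd,
    ← inner_toSpace hd, ← inner_toSpace hd, EuclideanSpace.norm_sq_eq]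
  simp only [cross, cross_apply, PiLp.inner_apply, Fin.sum_univ_three, Real.norm_eq_abs, sq_abs]
  simp
  ring

/-! ### Lipschitz bound for the Kepler vector field -/

section InverseCube

variable {V : Type*} [NormedAddCommGroup V] [NormedSpace ℝ V]

theorem norm_inv_cube_smul_sub_le {ρ : ℝ} (hρ : 0 < ρ) {x y : V} (hx : ρ ≤ ‖x‖) (hy : ρ ≤ ‖y‖) :
    ‖(‖x‖ ^ 3)⁻¹ • x - (‖y‖ ^ 3)⁻¹ • y‖ ≤ 4 / ρ ^ 3 * ‖x - y‖ := by
  have hx0 := hρ.trans_le hx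
  have hy0 := hρ.trans_le hy
  have h1 : (‖x‖ ^ 3)⁻¹ • x - (‖y‖ ^ 3)⁻¹ • y =
      (‖x‖ ^ 3)⁻¹ • (x - y) + ((‖x‖ ^ 3)⁻¹ - (‖y‖ ^ 3)⁻¹) • y := by
    rw [smul_sub, sub_smul]; abel
  have h2 : |(‖x‖ ^ 3)⁻¹ - (‖y‖ ^ 3)⁻¹| * ‖y‖ =
      |‖y‖ - ‖x‖| * ((‖x‖ ^ 3)⁻¹ + (‖x‖ ^ 2 * ‖y‖)⁻¹ + (‖x‖ * ‖y‖ ^ 2)⁻¹) := by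
    rw [← abs_of_pos hy0, ← abs_mul, abs_of_pos hy0]
    have hp : 0 < (‖x‖ ^ 3)⁻¹ + (‖x‖ ^ 2 * ‖y‖)⁻¹ + (‖x‖ * ‖y‖ ^ 2)⁻¹ := by positivity
    rw [← abs_of_pos hp, ← abs_mul]
    congr 1
    field_simp
    ring
  have hi1 : (‖x‖ ^ 3)⁻¹ ≤ (ρ ^ 3)⁻¹ := by gcongr
  have hi2 : (‖x‖ ^ 2 * ‖y‖)⁻¹ ≤ (ρ ^ 3)⁻¹ := by
    rw [show ρ ^ 3 = ρ ^ 2 * ρ by ring]; gcongr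
  have hi3 : (‖x‖ * ‖y‖ ^ 2)⁻¹ ≤ (ρ ^ 3)⁻¹ := by
    rw [show ρ ^ 3 = ρ * ρ ^ 2 by ring]; gcongr
  have h3 : |‖y‖ - ‖x‖| ≤ ‖x - y‖ := by
    rw [norm_sub_rev]; exact abs_norm_sub_norm_le y x
  calc _ ≤ ‖(‖x‖ ^ 3)⁻¹ • (x - y)‖ + ‖((‖x‖ ^ 3)⁻¹ - (‖y‖ ^ 3)⁻¹) • y‖ := by
        rw [h1]; exact norm_add_le _ _
    _ = (‖x‖ ^ 3)⁻¹ * ‖x - y‖ +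
        |‖y‖ - ‖x‖| * ((‖x‖ ^ 3)⁻¹ + (‖x‖ ^ 2 * ‖y‖)⁻¹ + (‖x‖ * ‖y‖ ^ 2)⁻¹) := by
        rw [norm_smul, norm_smul, ← h2, Real.norm_of_nonneg (by positivity), Real.norm_eq_abs]
    _ ≤ (ρ ^ 3)⁻¹ * ‖x - y‖ + ‖x - y‖ * ((ρ ^ 3)⁻¹ + (ρ ^ 3)⁻¹ + (ρ ^ 3)⁻¹) := by gcongr
    _ = _ := by ring

/-- The inverse-cube force is Lipschitz away from the origin. This feeds the uniqueness theorem for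
differential equations in `x₂_setAng_add_eq`. -/
theorem lipschitzOnWith_keplerField (c k : ℝ) {ρ : ℝ} (hρ : 0 < ρ) :
    ∃ K, LipschitzOnWith K (fun p : V × V => (c • p.2, (-(k / ‖p.1‖ ^ 3)) • p.1))
      {p | ρ ≤ ‖p.1‖} := by
  refine ⟨(|c| + |k| * (4 / ρ ^ 3)).toNNReal, LipschitzOnWith.of_dist_le_mul fun p hp q hq => ?_⟩
  have h4 : 0 ≤ 4 / ρ ^ 3 := by positivity
  rw [Real.coe_toNNReal _ (by positivity), dist_eq_norm, dist_eq_norm, Prod.norm_def]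
  have h1 : ‖p.1 - q.1‖ ≤ ‖p - q‖ := norm_fst_le (p - q)
  have h2 : ‖p.2 - q.2‖ ≤ ‖p - q‖ := norm_snd_le (p - q)
  refine max_le ?_ ?_
  · simp only [Prod.fst_sub, ← smul_sub, norm_smul, Real.norm_eq_abs]
    refine mul_le_mul ?_ h2 (norm_nonneg _) (by positivity)
    have : 0 ≤ |k| * (4 / ρ ^ 3) := by positivity
    linarith
  · have : (-(k / ‖p.1‖ ^ 3)) • p.1 - (-(k / ‖q.1‖ ^ 3)) • q.1 =
        (-k) • ((‖p.1‖ ^ 3)⁻¹ • p.1 - (‖q.1‖ ^ 3)⁻¹ • q.1) := by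
      rw [smul_sub, smul_smul, smul_smul]
      congr 2 <;> ring
    simp only [Prod.snd_sub]
    rw [this, norm_smul, norm_neg, Real.norm_eq_abs]
    calc _ ≤ |k| * (4 / ρ ^ 3 * ‖p.1 - q.1‖) := by
          gcongr; exact norm_inv_cube_smul_sub_le hρ hp hq
      _ ≤ |k| * (4 / ρ ^ 3 * ‖p - q‖) := by gcongr
      _ ≤ _ := by
        have : 0 ≤ |c| * ‖p - q‖ := by positivity
        linarith

end InverseCube

/-! ### Conserved quantities and geometry of the outer orbit -/

namespace OuterKeplerMap

variable {d : ℕ} {C : OuterKeplerMap d} {z : Coord (2 * d - 1)}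

variable (C) in
/-- The Laplace vector of the outer body. -/
def lap (z : Coord (2 * d - 1)) : E d :=
  ‖C.y₂ z‖ ^ 2 • C.x₂ z - inner ℝ (C.x₂ z) (C.y₂ z) • C.y₂ z - (C.mass / ‖C.x₂ z‖) • C.x₂ z

variable (C) in
/-- The square of the angular momentum of the outer body. -/
def gsq (z : Coord (2 * d - 1)) : ℝ :=
  ‖C.x₂ z‖ ^ 2 * ‖C.y₂ z‖ ^ 2 - inner ℝ (C.x₂ z) (C.y₂ z) ^ 2

theorem mom_setAng (s : ℝ) : (z.setAng s).mom = z.mom := rfl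

theorem gsq_setAng (hd : 0 < d) (hz : z ∈ C.domain) (s : ℝ) : C.gsq (z.setAng s) = C.gsq z := by
  refine eq_of_forall_hasDerivAt_zero (f := fun s => C.gsq (z.setAng s)) (fun s => ?_) s z.ang
  have hx := hasDerivAt_x₂_setAng hd hz s
  have hy := hasDerivAt_y₂_setAng hd hz s
  have h := (hx.norm_sq.mul hy.norm_sq).sub ((hx.inner ℝ hy).pow 2)
  refine h.congr_deriv ?_
  have hr := (norm_x₂_pos (setAng_mem hz s)).ne'
  simp only [inner_smul_left, inner_smul_right, real_inner_self_eq_norm_sq,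
    real_inner_comm (C.x₂ (z.setAng s)) (C.y₂ (z.setAng s))]
  simp
  field_simp
  ring

theorem lap_setAng (hd : 0 < d) (hz : z ∈ C.domain) (s : ℝ) : C.lap (z.setAng s) = C.lap z := by
  refine eq_of_forall_hasDerivAt_zero (f := fun s => C.lap (z.setAng s)) (fun s => ?_) s z.ang
  have hx := hasDerivAt_x₂_setAng hd hz s
  have hy := hasDerivAt_y₂_setAng hd hz s
  have hn := hasDerivAt_norm_of_ne hx (x₂_ne (setAng_mem hz s))
  have hr := (norm_x₂_pos (setAng_mem hz s)).ne'
  have h := ((hy.norm_sq.smul hx).sub ((hx.inner ℝ hy).smul hy)).sub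
    (((hasDerivAt_const s C.mass).div hn hr).smul hx)
  refine h.congr_deriv ?_
  simp only [inner_smul_left, inner_smul_right, real_inner_self_eq_norm_sq,
    real_inner_comm (C.x₂ (z.setAng s)) (C.y₂ (z.setAng s))]
  simp only [conj_trivial, zero_mul, zero_sub, Pi.div_apply]
  match_scalars <;> field_simp <;> ring

/-- The focal equation of the conic: since `lap` and `gsq` are constant, `‖x₂‖` is an affine
function of `x₂` along the orbit. -/
theorem inner_lap_x₂ (hz : z ∈ C.domain) :
    inner ℝ (C.lap z) (C.x₂ z) = C.gsq z - C.mass * ‖C.x₂ z‖ := by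
  have hr := (norm_x₂_pos hz).ne'
  simp only [lap, gsq, inner_sub_left, inner_smul_left, real_inner_self_eq_norm_sq,
    real_inner_comm (C.x₂ z) (C.y₂ z)]
  simp
  field_simp

/-- The force points to the origin, so on an orbit confined to an open half-space the component of
`y₂` along `B` would increase strictly, against periodicity. -/
theorem not_forall_inner_x₂_neg (hd : 0 < d) (hz : z ∈ C.domain) (B : E d) :
    ¬ ∀ s, inner ℝ B (C.x₂ (z.setAng s)) < 0 := by
  intro h
  have hmono : StrictMono fun s => inner ℝ B (C.y₂ (z.setAng s)) := by
    refine strictMono_of_deriv_pos fun s => ?_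
    have hy := (hasDerivAt_const s B).inner ℝ (hasDerivAt_y₂_setAng hd hz s)
    rw [hy.deriv, inner_smul_right, inner_zero_left, add_zero]
    have h1 : 0 < C.mass * C.rate z / ‖C.x₂ (z.setAng s)‖ ^ 3 :=
      div_pos (mul_pos mass_pos (rate_pos hz)) (pow_pos (norm_x₂_pos (setAng_mem hz s)) 3)
    have := mul_pos h1 (neg_pos.2 (h s))
    linarith
  have h1 := hmono (show (0 : ℝ) < 0 + 2 * Real.pi by positivity)
  have h2 := periodic_y₂ hz 0
  simp only at h1 h2
  rw [h2] at h1
  exact lt_irrefl _ h1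

/-- With zero angular momentum the focal equation would read `lap · x₂ = -mass * ‖x₂‖`, which
confines the orbit to an open half-space. -/
theorem gsq_pos (hd : 0 < d) (hz : z ∈ C.domain) : 0 < C.gsq z := by
  have h0 : 0 ≤ C.gsq z := by
    have := real_inner_mul_inner_self_le (C.x₂ z) (C.y₂ z)
    simp only [real_inner_self_eq_norm_sq] at this
    unfold gsq
    nlinarith
  refine lt_of_le_of_ne h0 fun h => ?_
  refine not_forall_inner_x₂_neg hd hz (C.lap z) fun s => ?_
  rw [← lap_setAng hd hz s, inner_lap_x₂ (setAng_mem hz s), gsq_setAng hd hz, ← h, zero_sub,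
    neg_neg_iff_pos]
  exact mul_pos mass_pos (norm_x₂_pos (setAng_mem hz s))

theorem continuous_x₂_setAng (hd : 0 < d) (hz : z ∈ C.domain) :
    Continuous fun s => C.x₂ (z.setAng s) :=
  continuous_iff_continuousAt.2 fun s => (hasDerivAt_x₂_setAng hd hz s).continuousAt

/-- Compactness of one period provides a minimiser, so the choice made in `periAngle` does satisfy
its specification. -/
theorem norm_x₂_periAngle_le (hd : 0 < d) (hz : z ∈ C.domain) (t : ℝ) :
    ‖C.x₂ (z.setAng (C.periAngle z))‖ ≤ ‖C.x₂ (z.setAng t)‖ := by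
  revert t
  apply Classical.epsilon_spec (p := fun s : ℝ => ∀ t : ℝ, ‖C.x₂ (z.setAng s)‖ ≤ ‖C.x₂ (z.setAng t)‖)
  obtain ⟨s, -, hs⟩ := isCompact_Icc.exists_isMinOn (s := Icc 0 (2 * Real.pi))
    ⟨0, by simp [Real.pi_pos.le]⟩ (continuous_x₂_setAng hd hz).norm.continuousOn
  refine ⟨s, fun t => ?_⟩
  obtain ⟨t', ht', he⟩ := (periodic_x₂ hz).exists_mem_Ico₀ (by positivity) t
  rw [he]
  exact hs (Ico_subset_Icc_self ht')

theorem exists_aphelion (hd : 0 < d) (hz : z ∈ C.domain) :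
    ∃ s, ∀ t, ‖C.x₂ (z.setAng t)‖ ≤ ‖C.x₂ (z.setAng s)‖ := by
  obtain ⟨s, -, hs⟩ := isCompact_Icc.exists_isMaxOn (s := Icc 0 (2 * Real.pi))
    ⟨0, by simp [Real.pi_pos.le]⟩ (continuous_x₂_setAng hd hz).norm.continuousOn
  refine ⟨s, fun t => ?_⟩
  obtain ⟨t', ht', he⟩ := (periodic_x₂ hz).exists_mem_Ico₀ (by positivity) t
  rw [he]
  exact hs (Ico_subset_Icc_self ht')

theorem inner_eq_zero_of_isLocalExtr (hd : 0 < d) (hz : z ∈ C.domain) {s : ℝ}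
    (h : IsLocalExtr (fun s => ‖C.x₂ (z.setAng s)‖) s) :
    inner ℝ (C.x₂ (z.setAng s)) (C.y₂ (z.setAng s)) = 0 := by
  have h1 := h.hasDerivAt_eq_zero
    (hasDerivAt_norm_of_ne (hasDerivAt_x₂_setAng hd hz s) (x₂_ne (setAng_mem hz s)))
  have hr := (norm_x₂_pos (setAng_mem hz s)).ne'
  have hc := (rate_pos hz).ne'
  rw [inner_smul_right] at h1
  simpa [hr, hc] using h1

theorem lap_eq_of_inner_eq_zero (hd : 0 < d) (hz : z ∈ C.domain) {s : ℝ}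
    (h : inner ℝ (C.x₂ (z.setAng s)) (C.y₂ (z.setAng s)) = 0) :
    C.lap z = (C.mass / ‖C.x₂ (z.setAng s)‖ - C.mass ^ 2 / z.mom ^ 2) • C.x₂ (z.setAng s) := by
  rw [← lap_setAng hd hz s, lap, h, norm_sq_y₂ (setAng_mem hz s), zero_smul, sub_zero, ← sub_smul,
    mom_setAng]
  congr 1
  ring

/-- By the focal equation equal radii have equal components along `lap`, which at an apsis is a
nonzero multiple of the position. Then `x₂ t · x₂ s = ‖x₂ s‖²` and the difference has norm zero.
Consequently an apsis of a noncircular orbit, once rotated to a different point, lies off the orbit.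
-/
theorem x₂_eq_of_norm_eq (hd : 0 < d) (hz : z ∈ C.domain) (hA : C.lap z ≠ 0) {s t : ℝ}
    (h : inner ℝ (C.x₂ (z.setAng s)) (C.y₂ (z.setAng s)) = 0)
    (hst : ‖C.x₂ (z.setAng t)‖ = ‖C.x₂ (z.setAng s)‖) : C.x₂ (z.setAng t) = C.x₂ (z.setAng s) := by
  have h1 := lap_eq_of_inner_eq_zero hd hz h
  have h2 := inner_lap_x₂ (setAng_mem hz s)
  have h3 := inner_lap_x₂ (setAng_mem hz t)
  rw [lap_setAng hd hz, gsq_setAng hd hz] at h2 h3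
  rw [hst, ← h2] at h3
  set c := C.mass / ‖C.x₂ (z.setAng s)‖ - C.mass ^ 2 / z.mom ^ 2
  have hc : c ≠ 0 := by
    rintro hc
    rw [hc, zero_smul] at h1
    exact hA h1
  rw [h1, inner_smul_left, inner_smul_left] at h3
  have h4 := mul_left_cancel₀ (by simpa using hc) h3
  rw [← sub_eq_zero, ← norm_eq_zero, ← sq_eq_zero_iff, norm_sub_sq_real, real_inner_comm, h4,
    real_inner_self_eq_norm_sq, hst]
  ring

theorem perihelion (hd : 0 < d) (hd3 : d ≤ 3) (hz : z ∈ C.domain) :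
    ∃ r, 0 < r ∧ (∀ t, r ≤ ‖C.x₂ (z.setAng t)‖) ∧ (∃ s, ‖C.x₂ (z.setAng s)‖ = r) ∧ ‖C.P₂ z‖ = 1 ∧
      C.e₂ z = 1 - C.mass * r / z.mom ^ 2 ∧
      C.gsq z = 2 * C.mass * r - C.mass ^ 2 * r ^ 2 / z.mom ^ 2 ∧
      C.lap z = (C.mass * C.e₂ z) • C.P₂ z := by
  set s := C.periAngle z with hs
  have hzs := setAng_mem hz s
  have hr := norm_x₂_pos hzs
  have hΛ := mom_pos hz
  have hmin := norm_x₂_periAngle_le hd hz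
  have h0 := inner_eq_zero_of_isLocalExtr hd hz (s := s) (Or.inl (Eventually.of_forall hmin))
  have hlap := lap_eq_of_inner_eq_zero hd hz h0
  have hg : C.gsq z = 2 * C.mass * ‖C.x₂ (z.setAng s)‖ -
      C.mass ^ 2 * ‖C.x₂ (z.setAng s)‖ ^ 2 / z.mom ^ 2 := by
    rw [← gsq_setAng hd hz s, gsq, h0, norm_sq_y₂ hzs, mom_setAng]
    field_simp
    ring
  have hP : C.P₂ z = ‖C.x₂ (z.setAng s)‖⁻¹ • C.x₂ (z.setAng s) := rfl
  -- The perihelion distance is at most the semi-major axis `Λ₂² / mass`; otherwise the focal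
  -- equation would keep the orbit in an open half-space. This fixes the sign of the square root
  -- defining `e₂`.
  have hρ : 0 ≤ 1 - C.mass * ‖C.x₂ (z.setAng s)‖ / z.mom ^ 2 := by
    by_contra hneg
    push Not at hneg
    refine not_forall_inner_x₂_neg hd hz (C.lap z) fun t => ?_
    have h3 := inner_lap_x₂ (setAng_mem hz t)
    rw [lap_setAng hd hz, gsq_setAng hd hz, hg] at h3
    rw [h3]
    have h5 := mul_le_mul_of_nonneg_left (hmin t) (mass_pos (C := C)).le
    have h6 := mul_neg_of_pos_of_neg (mul_pos (mass_pos (C := C)) hr) hneg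
    have h7 : C.mass ^ 2 * ‖C.x₂ (z.setAng s)‖ ^ 2 / z.mom ^ 2 =
      C.mass * ‖C.x₂ (z.setAng s)‖ * (C.mass * ‖C.x₂ (z.setAng s)‖ / z.mom ^ 2) := by ring
    rw [h7]
    linarith
  have he : C.e₂ z = 1 - C.mass * ‖C.x₂ (z.setAng s)‖ / z.mom ^ 2 := by
    rw [e₂, ← Real.sqrt_sq hρ]
    congr 1
    have : C.G₂ z ^ 2 = C.gsq z := norm_cross_sq hd3 _ _
    rw [this, hg]
    field_simp
    ring
  refine ⟨‖C.x₂ (z.setAng s)‖, hr, hmin, ⟨s, rfl⟩, ?_, he, hg, ?_⟩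
  · rw [hP, norm_smul, norm_inv, norm_norm, inv_mul_cancel₀ hr.ne']
  · rw [hlap, he, hP, smul_smul]
    congr 1
    field_simp

/-- Since `lap = mass * e₂ • P₂` and `Λ₂² / a₂ = mass`, both the eccentricity and the perihelion
direction disappear into the Laplace vector, which is differentiable at circular orbits too. -/
theorem calGSq_eq (hd : 0 < d) (hd3 : d ≤ 3) (hz : z ∈ C.domain) :
    C.calGSq z = C.gsq z - inner ℝ (C.lap z) (C.x₁ z) := by
  obtain ⟨r, hr, -, -, -, -, -, hlap⟩ := perihelion hd hd3 hz
  have hΛ := mom_pos hz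
  have h1 := C.m₂_pos
  have h2 := C.M₂_pos
  have : C.G₂ z ^ 2 = C.gsq z := norm_cross_sq hd3 _ _
  rw [calGSq, this, hlap, inner_smul_left, a₂, real_inner_comm, mass]
  simp
  field_simp

/-- As `x₁` does not depend on `ℓ₂`, the hypothesis at perihelion gives `‖x₁‖ < r`. With `gsq = mass
* r * (1 + e₂)` and `lap · x₁ ≤ mass * e₂ * r`, the difference is at least `mass * r`. -/
theorem calGSq_pos_of_lt (hd : 0 < d) (hd3 : d ≤ 3)
    (h : ∀ z ∈ C.domain, ‖C.x₁ z‖ < ‖C.x₂ z‖) (hz : z ∈ C.domain) : 0 < C.calGSq z := by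
  obtain ⟨r, hr, -, ⟨s, hs⟩, hP, he, hg, hlap⟩ := perihelion hd hd3 hz
  have hΛ := mom_pos hz
  have hlt : ‖C.x₁ z‖ < r := by
    rw [← hs, ← x₁_setAng hd hz s]
    exact h _ (setAng_mem hz s)
  have he0 : 0 ≤ C.e₂ z := Real.sqrt_nonneg _
  rw [calGSq_eq hd hd3 hz, hlap, inner_smul_left]
  have h1 : inner ℝ (C.P₂ z) (C.x₁ z) ≤ r := by
    refine (real_inner_le_norm _ _).trans ?_
    rw [hP, one_mul]; exact hlt.le
  have h2 := mul_le_mul_of_nonneg_left h1 (mul_nonneg (mass_pos (C := C)).le he0)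
  have h3 := mul_pos (mass_pos (C := C)) hr
  have h4 : C.gsq z = C.mass * r + C.mass * r * C.e₂ z := by
    rw [hg, he]; ring
  rw [conj_trivial, h4]
  nlinarith

theorem lipschitz_x₂ (hd : 0 < d) (hd3 : d ≤ 3) (hz : z ∈ C.domain) :
    ∃ K > 0, ∀ s t, ‖C.x₂ (z.setAng s) - C.x₂ (z.setAng t)‖ ≤ K * |s - t| := by
  obtain ⟨r, hr, hmin, -⟩ := perihelion hd hd3 hz
  have hc := rate_pos hz
  have hm := mass_pos (C := C)
  refine ⟨C.rate z * Real.sqrt (2 * C.mass / r), by positivity, fun s t => ?_⟩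
  refine convex_univ.norm_image_sub_le_of_norm_hasDerivWithin_le
    (f := fun s => C.x₂ (z.setAng s)) (x := t) (y := s)
    (fun s _ => (hasDerivAt_x₂_setAng hd hz s).hasDerivWithinAt) (fun s _ => ?_) trivial trivial
  rw [norm_smul, Real.norm_of_nonneg hc.le]
  refine mul_le_mul_of_nonneg_left (Real.le_sqrt_of_sq_le ?_) hc.le
  rw [norm_sq_y₂ (setAng_mem hz s)]
  have h1 : 2 * C.mass / ‖C.x₂ (z.setAng s)‖ ≤ 2 * C.mass / r := by gcongr; exact hmin s
  have h2 : 0 ≤ C.mass ^ 2 / (z.setAng s).mom ^ 2 := by positivity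
  linarith

theorem mom_eq_of_eq {z' : Coord (2 * d - 1)} (hz : z ∈ C.domain) (hz' : z' ∈ C.domain)
    (hx : C.x₂ z' = C.x₂ z) (hy : C.y₂ z' = C.y₂ z) : z'.mom = z.mom := by
  have h1 := norm_sq_y₂ hz
  have h2 := norm_sq_y₂ hz'
  rw [hx, hy, h1, sub_right_inj] at h2
  have hm := (mass_pos (C := C)).ne'
  have h3 := (mom_pos hz).ne'
  have h4 := (mom_pos hz').ne'
  field_simp at h2
  exact (pow_left_inj₀ (mom_pos hz').le (mom_pos hz).le two_ne_zero).1 h2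

/-- Both orbits solve the same Kepler equation with the same initial data and stay outside a common
ball around the origin, where the field is Lipschitz. The shifts by `ang` are needed because the two
points may carry different values of `ℓ₂`. -/
theorem x₂_setAng_add_eq (hd : 0 < d) (hd3 : d ≤ 3) {z' : Coord (2 * d - 1)} (hz : z ∈ C.domain)
    (hz' : z' ∈ C.domain) (hx : C.x₂ z' = C.x₂ z) (hy : C.y₂ z' = C.y₂ z) (s : ℝ) :
    C.x₂ (z'.setAng (s + z'.ang)) = C.x₂ (z.setAng (s + z.ang)) := by
  obtain ⟨r, hr, hmin, -⟩ := perihelion hd hd3 hz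
  obtain ⟨r', hr', hmin', -⟩ := perihelion hd hd3 hz'
  have hrate : C.rate z' = C.rate z := by rw [rate, rate, mom_eq_of_eq hz hz' hx hy]
  obtain ⟨K, hK⟩ := lipschitzOnWith_keplerField (V := E d) (C.rate z) (C.mass * C.rate z)
    (lt_min hr hr')
  have key : ∀ w ∈ C.domain, C.rate w = C.rate z → (∀ t, min r r' ≤ ‖C.x₂ (w.setAng t)‖) → ∀ t,
      HasDerivAt (fun s => (C.x₂ (w.setAng (s + w.ang)), C.y₂ (w.setAng (s + w.ang))))
        ((fun p : E d × E d => (C.rate z • p.2, (-(C.mass * C.rate z / ‖p.1‖ ^ 3)) • p.1))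
          (C.x₂ (w.setAng (t + w.ang)), C.y₂ (w.setAng (t + w.ang)))) t ∧
      (C.x₂ (w.setAng (t + w.ang)), C.y₂ (w.setAng (t + w.ang))) ∈
        {p : E d × E d | min r r' ≤ ‖p.1‖} := by
    intro w hw hwr hwm t
    refine ⟨?_, hwm _⟩
    have h1 := (hasDerivAt_x₂_setAng hd hw (t + w.ang)).comp_add_const t w.ang
    have h2 := (hasDerivAt_y₂_setAng hd hw (t + w.ang)).comp_add_const t w.ang
    rw [hwr] at h1 h2
    exact h1.prodMk h2
  have := ODE_solution_unique_univ (fun _ => hK)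
    (key z' hz' hrate fun t => (min_le_right _ _).trans (hmin' t))
    (key z hz rfl fun t => (min_le_left _ _).trans (hmin t)) (t₀ := 0) (by
      simp only [zero_add]
      rw [setAng_ang, setAng_ang, hx, hy])
  exact congrArg Prod.fst (congrFun this s)

theorem avgPotential_eq_ringPotential (hd : 0 < d) (hz : z ∈ C.domain) :
    C.avgPotential z = ringPotential (fun s => C.x₂ (z.setAng s)) (C.x₁ z) := by
  simp only [avgPotential, ringPotential, x₁_setAng hd hz]

/-- A difference of phase is invisible to an integral over a full period. Hence the average depends
on `x⁽¹⁾` and on the outer state only. -/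
theorem intervalIntegral_orbit_eq (hd : 0 < d) (hd3 : d ≤ 3) {z' : Coord (2 * d - 1)}
    (hz : z ∈ C.domain) (hz' : z' ∈ C.domain) (hx : C.x₂ z' = C.x₂ z) (hy : C.y₂ z' = C.y₂ z)
    (h : E d → ℝ) :
    ∫ s in (0 : ℝ)..(2 * Real.pi), h (C.x₂ (z'.setAng s)) =
      ∫ s in (0 : ℝ)..(2 * Real.pi), h (C.x₂ (z.setAng s)) := by
  have key : ∀ w ∈ C.domain, ∫ s in (0 : ℝ)..(2 * Real.pi), h (C.x₂ (w.setAng s)) =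
      ∫ s in (0 : ℝ)..(2 * Real.pi), h (C.x₂ (w.setAng (s + w.ang))) := by
    intro w hw
    have hp : Function.Periodic (fun s => h (C.x₂ (w.setAng s))) (2 * Real.pi) :=
      fun s => congrArg h (periodic_x₂ hw s)
    rw [intervalIntegral.integral_comp_add_right (fun s => h (C.x₂ (w.setAng s))), zero_add,
      add_comm (2 * Real.pi), ← hp.intervalIntegral_add_eq 0, zero_add]
  rw [key z hz, key z' hz']
  simp only [x₂_setAng_add_eq hd hd3 hz hz' hx hy]

theorem avgPotential_eq_of_eq (hd : 0 < d) (hd3 : d ≤ 3) {z' : Coord (2 * d - 1)}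
    (hz : z ∈ C.domain) (hz' : z' ∈ C.domain) (hx : C.x₂ z' = C.x₂ z) (hy : C.y₂ z' = C.y₂ z) :
    C.avgPotential z' = ringPotential (fun s => C.x₂ (z.setAng s)) (C.x₁ z') := by
  rw [avgPotential_eq_ringPotential hd hz', ringPotential, ringPotential,
    intervalIntegral_orbit_eq hd hd3 hz hz' hx hy fun x => 1 / ‖C.x₁ z' - x‖]

end OuterKeplerMap
-- Averaging over `ℓ₂` and the bracket of the average with `𝒢²`
namespace OuterKeplerMap

variable {d : ℕ} {C : OuterKeplerMap d} {z : Coord (2 * d - 1)}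

theorem contDiffAt_y₁ (hz : z ∈ C.domain) : ContDiffAt ℝ 1 C.y₁ z := (contDiffAt hz).fst
theorem contDiffAt_y₂ (hz : z ∈ C.domain) : ContDiffAt ℝ 1 C.y₂ z := (contDiffAt hz).snd.fst
theorem contDiffAt_x₁ (hz : z ∈ C.domain) : ContDiffAt ℝ 1 C.x₁ z := (contDiffAt hz).snd.snd.fst
theorem contDiffAt_x₂ (hz : z ∈ C.domain) : ContDiffAt ℝ 1 C.x₂ z := (contDiffAt hz).snd.snd.snd

theorem differentiableAt_y₁ (hz : z ∈ C.domain) : DifferentiableAt ℝ C.y₁ z :=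
  (contDiffAt_y₁ hz).differentiableAt one_ne_zero
theorem differentiableAt_y₂ (hz : z ∈ C.domain) : DifferentiableAt ℝ C.y₂ z :=
  (contDiffAt_y₂ hz).differentiableAt one_ne_zero
theorem differentiableAt_x₁ (hz : z ∈ C.domain) : DifferentiableAt ℝ C.x₁ z :=
  (contDiffAt_x₁ hz).differentiableAt one_ne_zero
theorem differentiableAt_x₂ (hz : z ∈ C.domain) : DifferentiableAt ℝ C.x₂ z :=
  (contDiffAt_x₂ hz).differentiableAt one_ne_zero

variable (C) in
/-- The Newtonian potential `1 / |x⁽¹⁾ - x⁽²⁾|`. -/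
def pot (z : Coord (2 * d - 1)) : ℝ := 1 / ‖C.x₁ z - C.x₂ z‖

theorem contDiffAt_pot (hz : z ∈ C.domain) : ContDiffAt ℝ 1 C.pot z := by
  have hne : C.x₁ z - C.x₂ z ≠ 0 := sub_ne_zero.2 (x₁_ne_x₂' hz)
  exact contDiffAt_const.div (((contDiffAt_x₁ hz).sub (contDiffAt_x₂ hz)).norm ℝ hne)
    (norm_ne_zero_iff.2 hne)

theorem differentiableAt_pot (hz : z ∈ C.domain) : DifferentiableAt ℝ C.pot z :=
  (contDiffAt_pot hz).differentiableAt one_ne_zero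

theorem continuousOn_fderiv_pot : ContinuousOn (fderiv ℝ C.pot) C.domain := by
  have : ContDiffOn ℝ 1 C.pot C.domain := fun z hz => (contDiffAt_pot hz).contDiffWithinAt
  exact this.continuousOn_fderiv_of_isOpen C.isOpen_domain le_rfl

/-- The projection `(Λ, ℓ, u, v) ↦ (Λ, 0, u, v)`. -/
def dropAng (n : ℕ) : Coord n →L[ℝ] Coord n :=
  (ContinuousLinearMap.fst ℝ ℝ (ℝ × (Fin n → ℝ) × (Fin n → ℝ))).prod
    ((0 : Coord n →L[ℝ] ℝ).prod ((ContinuousLinearMap.snd ℝ ℝ ((Fin n → ℝ) × (Fin n → ℝ))).comp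
      (ContinuousLinearMap.snd ℝ ℝ (ℝ × (Fin n → ℝ) × (Fin n → ℝ)))))

theorem setAng_eq_dropAng_add {n : ℕ} (z : Coord n) (s : ℝ) :
    z.setAng s = dropAng n z + (0, s, 0, 0) := by
  simp [Coord.setAng, dropAng]

theorem eq_dropAng_add {n : ℕ} (z : Coord n) : z = dropAng n z + z.ang • (0, 1, 0, 0) := by
  obtain ⟨a, b, u, v⟩ := z
  simp [dropAng, Coord.ang]

theorem hasFDerivAt_setAng {n : ℕ} (z : Coord n) (s : ℝ) :
    HasFDerivAt (fun z : Coord n => z.setAng s) (dropAng n) z := by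
  simp only [setAng_eq_dropAng_add]
  exact (dropAng n).hasFDerivAt.add_const _

theorem continuous_setAng {n : ℕ} : Continuous fun p : Coord n × ℝ => p.1.setAng p.2 := by
  unfold Coord.setAng
  fun_prop

theorem hasFDerivAt_avgPotential (hz : z ∈ C.domain) :
    HasFDerivAt C.avgPotential ((1 / (2 * Real.pi)) • ∫ s in (0 : ℝ)..(2 * Real.pi),
      (fderiv ℝ C.pot (z.setAng s)).comp (dropAng (2 * d - 1))) z := by
  have hW : IsOpen {p : Coord (2 * d - 1) × ℝ | p.1 ∈ C.domain} :=
    C.isOpen_domain.preimage continuous_fst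
  have hm : MapsTo (fun p : Coord (2 * d - 1) × ℝ => p.1.setAng p.2)
    {p : Coord (2 * d - 1) × ℝ | p.1 ∈ C.domain} C.domain := fun p hp => hp
  have h := hasFDerivAt_intervalIntegral_of_continuousOn (𝕜 := ℝ)
    (f := fun w s => C.pot (w.setAng s))
    (f' := fun w s => (fderiv ℝ C.pot (w.setAng s)).comp (dropAng (2 * d - 1)))
    (W := {p | p.1 ∈ C.domain}) hW ?_ ?_ ?_ (x₀ := z) (a := 0) (b := 2 * Real.pi) (fun _ _ => hz)
  · exact h.const_smul (1 / (2 * Real.pi))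
  · have : ContinuousOn C.pot C.domain := fun w hw =>
      (contDiffAt_pot hw).continuousAt.continuousWithinAt
    exact this.comp continuous_setAng.continuousOn hm
  · have := continuousOn_fderiv_pot.comp continuous_setAng.continuousOn hm
    exact this.clm_comp continuousOn_const
  · rintro ⟨w, s⟩ hw
    exact (differentiableAt_pot (setAng_mem hw s)).hasFDerivAt.comp w (hasFDerivAt_setAng w s)

theorem continuous_fderiv_pot_setAng (hz : z ∈ C.domain) :
    Continuous fun s => fderiv ℝ C.pot (z.setAng s) :=
  continuousOn_fderiv_pot.comp_continuous (continuous_setAng.comp (by fun_prop : Continuous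
    fun s : ℝ => (z, s))) fun _ => hz

theorem fderiv_avgPotential_apply (hz : z ∈ C.domain) (η : Coord (2 * d - 1)) :
    fderiv ℝ C.avgPotential z η = 1 / (2 * Real.pi) * ∫ s in (0 : ℝ)..(2 * Real.pi),
      fderiv ℝ C.pot (z.setAng s) (dropAng (2 * d - 1) η) := by
  rw [(hasFDerivAt_avgPotential hz).fderiv, smul_apply, smul_eq_mul]
  congr 1
  have hi : IntervalIntegrable (fun s => (fderiv ℝ C.pot (z.setAng s)).comp (dropAng (2 * d - 1)))
      volume 0 (2 * Real.pi) :=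
    ((continuous_fderiv_pot_setAng hz).clm_comp continuous_const).intervalIntegrable _ _
  rw [ContinuousLinearMap.intervalIntegral_apply hi]
  rfl

theorem integral_fderiv_pot_ang (hz : z ∈ C.domain) :
    ∫ s in (0 : ℝ)..(2 * Real.pi), fderiv ℝ C.pot (z.setAng s) (0, 1, 0, 0) = 0 := by
  rw [intervalIntegral.integral_eq_sub_of_hasDerivAt (f := fun s => C.pot (z.setAng s))
    (fun s _ => (differentiableAt_pot (setAng_mem hz s)).hasFDerivAt.comp_hasDerivAt s
      (hasDerivAt_setAng z s))
    (((continuous_fderiv_pot_setAng hz).clm_apply continuous_const).intervalIntegrable _ _)]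
  have := periodic_toFun hz 0
  simp only [zero_add] at this
  simp only [pot, x₁, x₂, this, sub_self]

theorem fderiv_setAng_eq {J : Coord (2 * d - 1) → ℝ}
    (hJ : ∀ w ∈ C.domain, ∀ s, J (w.setAng s) = J w) (hz : z ∈ C.domain) (s : ℝ) :
    fderiv ℝ J (z.setAng s) = fderiv ℝ J z := by
  let a : Coord (2 * d - 1) := (0, s - z.ang, 0, 0)
  have ha : ∀ w : Coord (2 * d - 1), w + a = w.setAng (w.ang + (s - z.ang)) := fun w => by
    simp [a, Coord.setAng, Prod.ext_iff, Coord.ang]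
  have h1 : z.setAng s = z + a := by rw [ha]; congr 1; ring
  rw [h1, ← fderiv_comp_add_right]
  refine Filter.EventuallyEq.fderiv_eq ?_
  filter_upwards [C.isOpen_domain.mem_nhds hz] with w hw
  rw [ha, hJ w hw]

theorem fderiv_ang_eq_zero {J : Coord (2 * d - 1) → ℝ}
    (hJ : ∀ w ∈ C.domain, ∀ s, J (w.setAng s) = J w) (hz : z ∈ C.domain) :
    fderiv ℝ J z (0, 1, 0, 0) = 0 := by
  by_cases hd : DifferentiableAt ℝ J z
  · have h1 := (hd.hasFDerivAt (x := z.setAng z.ang)).comp_hasDerivAt z.ang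
      (hasDerivAt_setAng z z.ang)
    have h2 : (J ∘ fun s => z.setAng s) = fun _ => J z := funext fun s => hJ z hz s
    rw [h2] at h1
    exact h1.unique (hasDerivAt_const _ _)
  · rw [fderiv_zero_of_not_differentiableAt hd]; rfl

/-- The Hamiltonian vector `ξ` of `J` is the same at all points of the orbit, so the bracket passes
under the integral. The `ℓ₂`-component of `ξ` acts on `pot` but not on its average; its contribution
is the integral of `∂pot/∂ℓ₂` over a period, which is zero. -/
theorem poisson_avgPotential {J : Coord (2 * d - 1) → ℝ}
    (hJ : ∀ w ∈ C.domain, ∀ s, J (w.setAng s) = J w) (hz : z ∈ C.domain) :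
    poisson C.avgPotential J z = 1 / (2 * Real.pi) * ∫ s in (0 : ℝ)..(2 * Real.pi),
      poisson C.pot J (z.setAng s) := by
  obtain ⟨ξ, hξ⟩ := exists_coordForm_eq (fderiv ℝ J z)
  have h1 : ∀ s, poisson C.pot J (z.setAng s) =
      fderiv ℝ C.pot (z.setAng s) (dropAng (2 * d - 1) ξ) +
        ξ.ang * fderiv ℝ C.pot (z.setAng s) (0, 1, 0, 0) := by
    intro s
    rw [poisson_eq_of_coordForm (ξ := ξ) (by rw [fderiv_setAng_eq hJ hz]; exact hξ)]
    conv_lhs => rw [eq_dropAng_add ξ]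
    rw [map_add, map_smul, smul_eq_mul]
  have hc := continuous_fderiv_pot_setAng hz
  rw [poisson_eq_of_coordForm hξ, fderiv_avgPotential_apply hz]
  simp only [h1]
  rw [intervalIntegral.integral_add, intervalIntegral.integral_const_mul,
    integral_fderiv_pot_ang hz, mul_zero, add_zero]
  · exact (hc.clm_apply continuous_const).intervalIntegrable _ _
  · exact ((hc.clm_apply continuous_const).const_smul ξ.ang).intervalIntegrable _ _

theorem hasDerivAt_inner_line {f g : Coord (2 * d - 1) → E d} {η : Coord (2 * d - 1)} {f' g' : E d}
    (hf : HasDerivAt (fun t : ℝ => f (z + t • η)) f' 0)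
    (hg : HasDerivAt (fun t : ℝ => g (z + t • η)) g' 0) :
    HasDerivAt (fun t : ℝ => inner ℝ (f (z + t • η)) (g (z + t • η)))
      (inner ℝ (f z) g' + inner ℝ f' (g z)) 0 := by
  simpa using hf.inner ℝ hg

/-- The derivative of `𝒢²` along `(X, Y, P) = (δx⁽²⁾, δy⁽²⁾, δx⁽¹⁾)` at
`(x, y, p) = (x⁽²⁾, y⁽²⁾, x⁽¹⁾)`. -/
def dCalGSq (m : ℝ) (x y p X Y P : E d) : ℝ :=
  2 * inner ℝ x X * ‖y‖ ^ 2 + ‖x‖ ^ 2 * (2 * inner ℝ y Y) -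
    2 * inner ℝ x y * (inner ℝ x Y + inner ℝ X y) -
    (2 * inner ℝ y Y * inner ℝ x p + ‖y‖ ^ 2 * (inner ℝ x P + inner ℝ X p) -
      ((inner ℝ x Y + inner ℝ X y) * inner ℝ y p + inner ℝ x y * (inner ℝ y P + inner ℝ Y p)) -
      m * ((inner ℝ x P + inner ℝ X p) / ‖x‖ - inner ℝ x p * inner ℝ x X / ‖x‖ ^ 3))

theorem gsq_sub_inner_lap (z : Coord (2 * d - 1)) :
    C.gsq z - inner ℝ (C.lap z) (C.x₁ z) = ‖C.x₂ z‖ ^ 2 * ‖C.y₂ z‖ ^ 2 -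
      inner ℝ (C.x₂ z) (C.y₂ z) ^ 2 - (‖C.y₂ z‖ ^ 2 * inner ℝ (C.x₂ z) (C.x₁ z) -
      inner ℝ (C.x₂ z) (C.y₂ z) * inner ℝ (C.y₂ z) (C.x₁ z) -
      C.mass * (inner ℝ (C.x₂ z) (C.x₁ z) * ‖C.x₂ z‖⁻¹)) := by
  simp only [gsq, lap, inner_sub_left, inner_smul_left]
  simp
  ring

theorem eventuallyEq_calGSq (hd : 0 < d) (hd3 : d ≤ 3) (hz : z ∈ C.domain) :
    C.calGSq =ᶠ[𝓝 z] fun z => C.gsq z - inner ℝ (C.lap z) (C.x₁ z) := by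
  filter_upwards [C.isOpen_domain.mem_nhds hz] with w hw using calGSq_eq hd hd3 hw

theorem differentiableAt_calGSq (hd : 0 < d) (hd3 : d ≤ 3) (hz : z ∈ C.domain) :
    DifferentiableAt ℝ C.calGSq z := by
  rw [(eventuallyEq_calGSq hd hd3 hz).differentiableAt_iff]
  have h1 := differentiableAt_x₁ hz
  have h2 := differentiableAt_x₂ hz
  have h3 := differentiableAt_y₂ hz
  have h4 := h2.norm ℝ (x₂_ne hz)
  have h5 := (norm_x₂_pos hz).ne'
  simp only [gsq_sub_inner_lap]
  have h6 := h2.inner ℝ h1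
  have h7 := h2.inner ℝ h3
  have h8 := h3.inner ℝ h1
  have h9 := h3.norm_sq ℝ
  have h10 := h4.inv h5
  fun_prop

theorem fderiv_calGSq (hd : 0 < d) (hd3 : d ≤ 3) (hz : z ∈ C.domain) (η : Coord (2 * d - 1)) :
    fderiv ℝ C.calGSq z η = dCalGSq C.mass (C.x₂ z) (C.y₂ z) (C.x₁ z)
      (fderiv ℝ C.toFun z η).2.2.2 (fderiv ℝ C.toFun z η).2.1 (fderiv ℝ C.toFun z η).2.2.1 := by
  have hz0 : z + (0 : ℝ) • η = z := by simp
  have h := eventuallyEq_calGSq hd hd3 hz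
  rw [h.fderiv_eq]
  refine fderiv_eq_of_hasDerivAt (h.differentiableAt_iff.1 (differentiableAt_calGSq hd hd3 hz)) ?_
  simp only [gsq_sub_inner_lap]
  have hx := hasDerivAt_x₂ hz η
  have hy := hasDerivAt_y₂ hz η
  have hp := hasDerivAt_x₁ hz η
  have hr := (norm_x₂_pos hz).ne'
  have hn := (hasDerivAt_norm_of_ne hx (by rw [hz0]; exact x₂_ne hz)).inv (by rw [hz0]; exact hr)
  have hxy := hasDerivAt_inner_line hx hy
  have hxp := hasDerivAt_inner_line hx hp
  have hyp := hasDerivAt_inner_line hy hp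
  refine (((hx.norm_sq.mul hy.norm_sq).sub (hxy.pow 2)).sub
    (((hy.norm_sq.mul hxp).sub (hxy.mul hyp)).sub ((hxp.mul hn).const_mul C.mass))).congr_deriv ?_
  simp only [hz0, dCalGSq, Pi.inv_apply]
  field_simp
  ring

theorem calGSq_setAng (hd : 0 < d) (hd3 : d ≤ 3) (hz : z ∈ C.domain) (s : ℝ) :
    C.calGSq (z.setAng s) = C.calGSq z := by
  rw [calGSq_eq hd hd3 hz, calGSq_eq hd hd3 (setAng_mem hz s), gsq_setAng hd hz, lap_setAng hd hz,
    x₁_setAng hd hz]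

theorem fderiv_pot (hz : z ∈ C.domain) (η : Coord (2 * d - 1)) :
    fderiv ℝ C.pot z η = -(inner ℝ (C.x₁ z - C.x₂ z) ((fderiv ℝ C.toFun z η).2.2.1 -
      (fderiv ℝ C.toFun z η).2.2.2) / ‖C.x₁ z - C.x₂ z‖ ^ 3) := by
  have hz0 : z + (0 : ℝ) • η = z := by simp
  have hne := sub_ne_zero.2 (x₁_ne_x₂' hz)
  have hr := norm_ne_zero_iff.2 hne
  refine fderiv_eq_of_hasDerivAt (differentiableAt_pot hz) ?_
  have hn := hasDerivAt_norm_of_ne ((hasDerivAt_x₁ hz η).sub (hasDerivAt_x₂ hz η))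
    (by simpa [hz0] using hne)
  have := hn.inv (by simpa [hz0] using hr)
  simp only [pot, one_div]
  refine this.congr_deriv ?_
  simp only [hz0, Pi.sub_apply]
  field_simp

theorem poisson_calGSq_pot (hd : 0 < d) (hd3 : d ≤ 3) (hz : z ∈ C.domain) :
    poisson C.calGSq C.pot z = dCalGSq C.mass (C.x₂ z) (C.y₂ z) (C.x₁ z) 0
      ((‖C.x₁ z - C.x₂ z‖ ^ 3)⁻¹ • (C.x₁ z - C.x₂ z)) 0 := by
  obtain ⟨ξ, h1, h2⟩ := exists_poisson_eq hd hz (g := C.pot)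
    (w := (-((‖C.x₁ z - C.x₂ z‖ ^ 3)⁻¹ • (C.x₁ z - C.x₂ z)),
      (‖C.x₁ z - C.x₂ z‖ ^ 3)⁻¹ • (C.x₁ z - C.x₂ z), 0, 0)) (fun η => by
      rw [fderiv_pot hz]
      simp only [phaseForm, inner_neg_left, inner_smul_left, inner_zero_right, inner_sub_right]
      simp
      ring)
  rw [h2, fderiv_calGSq hd hd3 hz, h1]

/-- The heart of the bracket computations. Along the orbit the bracket of `pot` with `𝒢²` is the
`ℓ₂`-derivative of `rate⁻¹ * ((x₁ - x₂) · x₁) / ‖x₁ - x₂‖`, and this primitive is periodic. -/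
theorem poisson_avgPotential_calGSq (hd : 0 < d) (hd3 : d ≤ 3) (hz : z ∈ C.domain) :
    poisson C.avgPotential C.calGSq z = 0 := by
  rw [poisson_avgPotential (fun w hw s => calGSq_setAng hd hd3 hw s) hz]
  have hW : ∀ s, HasDerivAt (fun s => (C.rate z)⁻¹ * (inner ℝ (C.x₁ z - C.x₂ (z.setAng s)) (C.x₁ z) /
      ‖C.x₁ z - C.x₂ (z.setAng s)‖)) (poisson C.pot C.calGSq (z.setAng s)) s := by
    intro s
    have hzs := setAng_mem hz s
    have hne : C.x₁ z - C.x₂ (z.setAng s) ≠ 0 := by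
      rw [← x₁_setAng hd hz s]; exact sub_ne_zero.2 (x₁_ne_x₂' hzs)
    have hr := norm_ne_zero_iff.2 hne
    have hq := (hasDerivAt_x₂_setAng hd hz s).const_sub (C.x₁ z)
    have h1 := ((hq.inner ℝ (hasDerivAt_const s (C.x₁ z))).div
      (hasDerivAt_norm_of_ne hq hne) hr).const_mul (C.rate z)⁻¹
    refine h1.congr_deriv ?_
    rw [poisson_antisymm, poisson_calGSq_pot hd hd3 hzs, x₁_setAng hd hz]
    have hc := (rate_pos hz).ne'
    set q := C.x₁ z - C.x₂ (z.setAng s) with hqdef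
    set y := C.y₂ (z.setAng s)
    set p := C.x₁ z
    have hx : C.x₂ (z.setAng s) = p - q := by rw [hqdef]; abel
    rw [hx]
    simp only [dCalGSq, inner_sub_left, inner_smul_left, inner_smul_right, inner_neg_left,
      inner_neg_right, inner_zero_left, inner_zero_right, norm_sub_sq_real,
      real_inner_self_eq_norm_sq, real_inner_comm p q, real_inner_comm y q, real_inner_comm y p]
    simp
    field_simp
    ring
  have hcont : Continuous fun s => poisson C.pot C.calGSq (z.setAng s) := by
    have h : ∀ s, poisson C.pot C.calGSq (z.setAng s) = - dCalGSq C.mass (C.x₂ (z.setAng s))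
        (C.y₂ (z.setAng s)) (C.x₁ z) 0 ((‖C.x₁ z - C.x₂ (z.setAng s)‖ ^ 3)⁻¹ •
          (C.x₁ z - C.x₂ (z.setAng s))) 0 := fun s => by
      rw [poisson_antisymm, poisson_calGSq_pot hd hd3 (setAng_mem hz s), x₁_setAng hd hz]
    simp only [h, dCalGSq]
    have h1 : Continuous fun s => C.x₂ (z.setAng s) := continuous_x₂_setAng hd hz
    have h2 : Continuous fun s => C.y₂ (z.setAng s) :=
      continuous_iff_continuousAt.2 fun s => (hasDerivAt_y₂_setAng hd hz s).continuousAt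
    have h3 : ∀ s, ‖C.x₁ z - C.x₂ (z.setAng s)‖ ^ 3 ≠ 0 := fun s => by
      rw [← x₁_setAng hd hz s]
      exact pow_ne_zero 3 (norm_ne_zero_iff.2 (sub_ne_zero.2 (x₁_ne_x₂' (setAng_mem hz s))))
    have h4 : ∀ s, ‖C.x₂ (z.setAng s)‖ ≠ 0 := fun s => (norm_x₂_pos (setAng_mem hz s)).ne'
    have h5 : Continuous fun s => (‖C.x₁ z - C.x₂ (z.setAng s)‖ ^ 3)⁻¹ :=
      Continuous.inv₀ (by fun_prop) h3
    simp only [inner_zero_left, inner_zero_right, mul_zero, zero_mul, add_zero, zero_div, sub_zero]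
    fun_prop
  rw [intervalIntegral.integral_eq_sub_of_hasDerivAt (fun s _ => hW s)
    (hcont.intervalIntegrable _ _)]
  have := periodic_x₂ hz 0
  simp only [zero_add] at this
  simp only [this, sub_self, mul_zero]

end OuterKeplerMap

/-! ### Vector products and infinitesimal rotations -/

section Rotation

variable {d : ℕ}

theorem toSpace_add (x y : E d) : toSpace (x + y) = toSpace x + toSpace y := by
  ext i; by_cases h : (i : ℕ) < d <;> simp [toSpace, h]

theorem toSpace_smul (c : ℝ) (x : E d) : toSpace (c • x) = c • toSpace x := by
  ext i; by_cases h : (i : ℕ) < d <;> simp [toSpace, h]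

theorem cross_add_left (x x' y : E d) : cross (x + x') y = cross x y + cross x' y := by
  simp [cross, toSpace_add]

theorem cross_add_right (x y y' : E d) : cross x (y + y') = cross x y + cross x y' := by
  simp [cross, toSpace_add]

theorem cross_smul_left (c : ℝ) (x y : E d) : cross (c • x) y = c • cross x y := by
  simp [cross, toSpace_smul]

theorem cross_smul_right (c : ℝ) (x y : E d) : cross x (c • y) = c • cross x y := by
  simp [cross, toSpace_smul]

theorem cross_self (x : E d) : cross x x = 0 := by
  simp [cross]

/-- The vector product as a bilinear map. -/
def crossₗ (d : ℕ) : E d →ₗ[ℝ] E d →ₗ[ℝ] E 3 :=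
  LinearMap.mk₂ ℝ cross cross_add_left cross_smul_left cross_add_right
    (fun c x y => cross_smul_right c x y)

/-- The vector product as a continuous bilinear map. -/
def crossL (d : ℕ) : E d →L[ℝ] E d →L[ℝ] E 3 := (crossₗ d).toContinuousBilinearMap

theorem hasDerivAt_cross {x y : ℝ → E d} {x' y' : E d} {t : ℝ} (hx : HasDerivAt x x' t)
    (hy : HasDerivAt y y' t) :
    HasDerivAt (fun t => cross (x t) (y t)) (cross (x t) y' + cross x' (y t)) t :=
  (crossL d).hasDerivAt_of_bilinear (fun _ => hx) (fun _ => hy)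

theorem differentiableAt_cross {V : Type*} [NormedAddCommGroup V] [NormedSpace ℝ V] {x y : V → E d}
    {z : V} (hx : DifferentiableAt ℝ x z) (hy : DifferentiableAt ℝ y z) :
    DifferentiableAt ℝ (fun t => cross (x t) (y t)) z :=
  ((crossL d).hasFDerivAt_of_bilinear hx.hasFDerivAt hy.hasFDerivAt).differentiableAt

/-- The projection to `ℝ^d` of the vector product `n × x`. -/
def rot (n : E 3) (x : E d) : E d :=
  WithLp.toLp 2 fun i => if h : (i : ℕ) < 3 then
    crossProduct (WithLp.ofLp n) (WithLp.ofLp (toSpace x)) ⟨i, h⟩ else 0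

theorem inner_rot_left (hd : d ≤ 3) (n : E 3) (x y : E d) :
    inner ℝ (rot n x) y = inner ℝ n (cross x y) := by
  interval_cases d <;>
    simp [rot, cross, toSpace, cross_apply, PiLp.inner_apply, Fin.sum_univ_succ] <;> ring

theorem inner_rot_right (hd : d ≤ 3) (n : E 3) (x y : E d) :
    inner ℝ x (rot n y) = -inner ℝ (rot n x) y := by
  rw [real_inner_comm, inner_rot_left hd, inner_rot_left hd]
  simp only [cross, cross_apply, PiLp.inner_apply, Fin.sum_univ_three]
  simp
  ring

theorem inner_rot_self (hd : d ≤ 3) (n : E 3) (x : E d) : inner ℝ x (rot n x) = 0 := by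
  have h := inner_rot_right hd n x x
  rw [real_inner_comm] at h
  rw [real_inner_comm]
  linarith

theorem rot_sub (n : E 3) (x y : E d) : rot n (x - y) = rot n x - rot n y := by
  have : toSpace (x - y) = toSpace x - toSpace y := by
    rw [sub_eq_add_neg, ← neg_one_smul ℝ, toSpace_add, toSpace_smul, neg_one_smul, ← sub_eq_add_neg]
  ext i
  by_cases h : (i : ℕ) < 3 <;> simp [rot, h, this]

/-- `𝒢²` is built from inner products of `x`, `y` and `p`, which a common rotation preserves. -/
theorem OuterKeplerMap.dCalGSq_rot (hd : d ≤ 3) (m : ℝ) (n : E 3) (x y p : E d) :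
    dCalGSq m x y p (-rot n x) (-rot n y) (-rot n p) = 0 := by
  simp only [dCalGSq, inner_neg_left, inner_neg_right, inner_rot_self hd, inner_rot_right hd]
  simp

end Rotation

/-! ### Angular momentum, `r₁`, `Λ₂` and their brackets -/

namespace OuterKeplerMap

variable {d : ℕ} {C : OuterKeplerMap d} {z : Coord (2 * d - 1)}

theorem hasDerivAt_Ctot (hz : z ∈ C.domain) (η : Coord (2 * d - 1)) :
    HasDerivAt (fun t : ℝ => C.Ctot (z + t • η))
      ((cross (C.x₁ z) (fderiv ℝ C.toFun z η).1 + cross (fderiv ℝ C.toFun z η).2.2.1 (C.y₁ z)) +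
        (cross (C.x₂ z) (fderiv ℝ C.toFun z η).2.1 +
          cross (fderiv ℝ C.toFun z η).2.2.2 (C.y₂ z))) 0 := by
  have h := (hasDerivAt_cross (hasDerivAt_x₁ hz η) (hasDerivAt_y₁ hz η)).add
    (hasDerivAt_cross (hasDerivAt_x₂ hz η) (hasDerivAt_y₂ hz η))
  simp only [zero_smul, add_zero] at h
  exact h

theorem differentiableAt_C₂ (hz : z ∈ C.domain) : DifferentiableAt ℝ C.C₂ z :=
  differentiableAt_cross (differentiableAt_x₂ hz) (differentiableAt_y₂ hz)

theorem differentiableAt_Ctot (hz : z ∈ C.domain) : DifferentiableAt ℝ C.Ctot z :=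
  (differentiableAt_cross (differentiableAt_x₁ hz) (differentiableAt_y₁ hz)).add
    (differentiableAt_C₂ hz)

variable (C) in
/-- Minus the generator of the rotations with axis `n`, at the point `z`. -/
def rotField (n : E 3) (z : Coord (2 * d - 1)) : Phase d :=
  (-rot n (C.y₁ z), -rot n (C.y₂ z), -rot n (C.x₁ z), -rot n (C.x₂ z))

/-- Components of the total angular momentum generate the rotations of both bodies; the identity is
a cyclic permutation of triple products. -/
theorem inner_dCtot (hd3 : d ≤ 3) (n : E 3) (z : Coord (2 * d - 1)) (w : Phase d) :
    inner ℝ n ((cross (C.x₁ z) w.1 + cross w.2.2.1 (C.y₁ z)) +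
      (cross (C.x₂ z) w.2.1 + cross w.2.2.2 (C.y₂ z))) = phaseForm (C.rotField n z) w := by
  have h1 : ∀ X y : E d, inner ℝ n (cross X y) = -inner ℝ (rot n y) X := fun X y => by
    rw [← inner_rot_left hd3, ← inner_rot_right hd3, real_inner_comm]
  have h2 : ∀ x Y : E d, inner ℝ n (cross x Y) = inner ℝ Y (rot n x) := fun x Y => by
    rw [← inner_rot_left hd3, real_inner_comm]
  simp only [inner_add_right, h1 w.2.2.1, h1 w.2.2.2, h2 _ w.1, h2 _ w.2.1, phaseForm, rotField,
    inner_neg_left, inner_neg_right]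
  ring

theorem fderiv_inner_Ctot (hd3 : d ≤ 3) (hz : z ∈ C.domain) (n : E 3) (η : Coord (2 * d - 1)) :
    fderiv ℝ (fun z => inner ℝ n (C.Ctot z)) z η =
      phaseForm (C.rotField n z) (fderiv ℝ C.toFun z η) := by
  rw [← inner_dCtot hd3]
  refine fderiv_eq_of_hasDerivAt
    ((differentiableAt_const n).inner ℝ (differentiableAt_Ctot hz)) ?_
  simpa using (hasDerivAt_const 0 n).inner ℝ (hasDerivAt_Ctot hz η)

theorem fderiv_G (hd3 : d ≤ 3) (hz : z ∈ C.domain) (η : Coord (2 * d - 1)) :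
    fderiv ℝ C.G z η =
      phaseForm (C.rotField (‖C.Ctot z‖⁻¹ • C.Ctot z) z) (fderiv ℝ C.toFun z η) := by
  rw [← inner_dCtot hd3]
  -- Where `C` vanishes `G` is minimal, so its `fderiv` is zero whether or not it is differentiable
  -- there. The right side is zero as well, because `‖0‖⁻¹ • 0 = 0`.
  by_cases h : C.Ctot z = 0
  · have hmin : IsLocalMin C.G z := Eventually.of_forall fun w => by
      simp [G, h]
    rw [hmin.fderiv_eq_zero, h]
    simp
  · refine fderiv_eq_of_hasDerivAt ((differentiableAt_Ctot hz).norm ℝ h) ?_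
    have := hasDerivAt_norm_of_ne (hasDerivAt_Ctot hz η) (by simpa using h)
    simp only [zero_smul, add_zero] at this
    refine this.congr_deriv ?_
    rw [inner_smul_left]
    simp only [conj_trivial]
    ring

theorem fderiv_r₁ (hz : z ∈ C.domain) (η : Coord (2 * d - 1)) :
    fderiv ℝ C.r₁ z η = inner ℝ (C.x₁ z) (fderiv ℝ C.toFun z η).2.2.1 / ‖C.x₁ z‖ := by
  refine fderiv_eq_of_hasDerivAt ((differentiableAt_x₁ hz).norm ℝ (x₁_ne hz)) ?_
  simpa using hasDerivAt_norm_of_ne (hasDerivAt_x₁ hz η) (by simpa using x₁_ne hz)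

theorem fderiv_r₁_eq_phaseForm (hz : z ∈ C.domain) (η : Coord (2 * d - 1)) :
    fderiv ℝ C.r₁ z η = phaseForm (‖C.x₁ z‖⁻¹ • C.x₁ z, 0, 0, 0) (fderiv ℝ C.toFun z η) := by
  rw [fderiv_r₁ hz]
  simp [phaseForm, inner_smul_left]
  ring

theorem fderiv_L₂ (z η : Coord (2 * d - 1)) : fderiv ℝ C.L₂ z η = η.mom := by
  have : HasFDerivAt C.L₂ (ContinuousLinearMap.fst ℝ ℝ _) z := hasFDerivAt_fst
  rw [this.fderiv]
  rfl

theorem C₂_setAng (hd : 0 < d) (hz : z ∈ C.domain) (s : ℝ) : C.C₂ (z.setAng s) = C.C₂ z := by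
  refine eq_of_forall_hasDerivAt_zero (f := fun s => C.C₂ (z.setAng s)) (fun s => ?_) s z.ang
  refine (hasDerivAt_cross (hasDerivAt_x₂_setAng hd hz s)
    (hasDerivAt_y₂_setAng hd hz s)).congr_deriv ?_
  simp only [cross_smul_left, cross_smul_right, cross_self, smul_zero, add_zero]

theorem Ctot_setAng (hd : 0 < d) (hz : z ∈ C.domain) (s : ℝ) : C.Ctot (z.setAng s) = C.Ctot z := by
  rw [Ctot, Ctot, C₂_setAng hd hz, C₁, C₁, x₁_setAng hd hz, y₁_setAng hd hz]

theorem G_setAng (hd : 0 < d) (hz : z ∈ C.domain) (s : ℝ) : C.G (z.setAng s) = C.G z := by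
  rw [G, G, Ctot_setAng hd hz]

theorem Z_setAng (hd : 0 < d) (hz : z ∈ C.domain) (s : ℝ) : C.Z (z.setAng s) = C.Z z := by
  rw [Z, Z, Ctot_setAng hd hz]

theorem r₁_setAng (hd : 0 < d) (hz : z ∈ C.domain) (s : ℝ) : C.r₁ (z.setAng s) = C.r₁ z := by
  rw [r₁, r₁, x₁_setAng hd hz]

theorem Theta_setAng (hd : 0 < d) (hz : z ∈ C.domain) (s : ℝ) :
    C.Theta (z.setAng s) = C.Theta z := by
  rw [Theta, Theta, C₂_setAng hd hz, r₁_setAng hd hz, x₁_setAng hd hz]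

/-- The Hamiltonian vector of `Λ₂` is `-∂/∂ℓ₂`. -/
theorem poisson_L₂ {J : Coord (2 * d - 1) → ℝ}
    (hJ : ∀ w ∈ C.domain, ∀ s, J (w.setAng s) = J w) (hz : z ∈ C.domain) :
    poisson J C.L₂ z = 0 := by
  rw [poisson_eq_of_coordForm (ξ := -(0, 1, 0, 0)), map_neg, fderiv_ang_eq_zero hJ hz, neg_zero]
  intro η
  rw [fderiv_L₂]
  simp [coordForm, Coord.mom, Coord.ang, Coord.u, Coord.v]

theorem poisson_pot_of_rotField (hd : 0 < d) (hd3 : d ≤ 3) (hz : z ∈ C.domain) {n : E 3}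
    {J : Coord (2 * d - 1) → ℝ}
    (hJ : ∀ η, fderiv ℝ J z η = phaseForm (C.rotField n z) (fderiv ℝ C.toFun z η)) :
    poisson C.pot J z = 0 := by
  obtain ⟨ξ, h1, h2⟩ := exists_poisson_eq hd hz hJ
  rw [h2, fderiv_pot hz, h1]
  have : -rot n (C.x₁ z) - -rot n (C.x₂ z) = -rot n (C.x₁ z - C.x₂ z) := by
    rw [rot_sub]; abel
  simp only [rotField]
  rw [this, inner_neg_right, inner_rot_self hd3]
  simp

theorem poisson_calGSq_of_rotField (hd : 0 < d) (hd3 : d ≤ 3) (hz : z ∈ C.domain) {n : E 3}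
    {J : Coord (2 * d - 1) → ℝ}
    (hJ : ∀ η, fderiv ℝ J z η = phaseForm (C.rotField n z) (fderiv ℝ C.toFun z η)) :
    poisson C.calGSq J z = 0 := by
  obtain ⟨ξ, h1, h2⟩ := exists_poisson_eq hd hz hJ
  rw [h2, fderiv_calGSq hd hd3 hz, h1]
  exact dCalGSq_rot hd3 _ _ _ _ _

theorem poisson_r₁_of_rotField (hd : 0 < d) (hd3 : d ≤ 3) (hz : z ∈ C.domain) {n : E 3}
    {J : Coord (2 * d - 1) → ℝ}
    (hJ : ∀ η, fderiv ℝ J z η = phaseForm (C.rotField n z) (fderiv ℝ C.toFun z η)) :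
    poisson C.r₁ J z = 0 := by
  obtain ⟨ξ, h1, h2⟩ := exists_poisson_eq hd hz hJ
  rw [h2, fderiv_r₁ hz, h1]
  simp [rotField, inner_rot_self hd3]

theorem poisson_self (J : Coord (2 * d - 1) → ℝ) (z : Coord (2 * d - 1)) : poisson J J z = 0 := by
  have := poisson_antisymm J J z
  linarith

theorem poisson_pot_r₁ (hd : 0 < d) (hz : z ∈ C.domain) : poisson C.pot C.r₁ z = 0 := by
  obtain ⟨ξ, h1, h2⟩ := exists_poisson_eq hd hz (fderiv_r₁_eq_phaseForm hz)
  rw [h2, fderiv_pot hz, h1]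
  simp

theorem poisson_calGSq_r₁ (hd : 0 < d) (hd3 : d ≤ 3) (hz : z ∈ C.domain) :
    poisson C.calGSq C.r₁ z = 0 := by
  obtain ⟨ξ, h1, h2⟩ := exists_poisson_eq hd hz (fderiv_r₁_eq_phaseForm hz)
  rw [h2, fderiv_calGSq hd hd3 hz, h1]
  simp [dCalGSq]

theorem fderiv_calG (hd : 0 < d) (hd3 : d ≤ 3) (hz : z ∈ C.domain) (hpos : 0 < C.calGSq z) :
    fderiv ℝ C.calG z = (1 / (2 * Real.sqrt (C.calGSq z))) • fderiv ℝ C.calGSq z :=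
  ((differentiableAt_calGSq hd hd3 hz).hasFDerivAt.sqrt hpos.ne').fderiv

theorem differentiableAt_calG (hd : 0 < d) (hd3 : d ≤ 3) (hz : z ∈ C.domain)
    (hpos : 0 < C.calGSq z) : DifferentiableAt ℝ C.calG z :=
  (differentiableAt_calGSq hd hd3 hz).sqrt hpos.ne'

theorem poisson_calG (hd : 0 < d) (hd3 : d ≤ 3) (hz : z ∈ C.domain) (hpos : 0 < C.calGSq z)
    (J : Coord (2 * d - 1) → ℝ) :
    poisson C.calG J z = 1 / (2 * Real.sqrt (C.calGSq z)) * poisson C.calGSq J z := by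
  obtain ⟨ξ, hξ⟩ := exists_coordForm_eq (fderiv ℝ J z)
  rw [poisson_eq_of_coordForm hξ, poisson_eq_of_coordForm hξ, fderiv_calG hd hd3 hz hpos]
  rfl

theorem poisson_avgPotential_eq_zero {J : Coord (2 * d - 1) → ℝ}
    (hJ : ∀ w ∈ C.domain, ∀ s, J (w.setAng s) = J w)
    (h : ∀ w ∈ C.domain, poisson C.pot J w = 0) (hz : z ∈ C.domain) :
    poisson C.avgPotential J z = 0 := by
  rw [poisson_avgPotential hJ hz]
  simp [h _ (setAng_mem hz _)]

theorem poisson_avgPotential_calG (hd : 0 < d) (hd3 : d ≤ 3) (hz : z ∈ C.domain)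
    (hpos : 0 < C.calGSq z) : poisson C.avgPotential C.calG z = 0 := by
  rw [poisson_antisymm, poisson_calG hd hd3 hz hpos, poisson_antisymm,
    poisson_avgPotential_calGSq hd hd3 hz]
  simp

end OuterKeplerMap

/-! ### The spatial integrals `Z` and `Θ` -/

section Spatial

open OuterKeplerMap

variable {C : OuterKeplerMap 3} {z : Coord (2 * 3 - 1)}

theorem toSpace_three (x : E 3) : toSpace x = x := by
  ext i
  simp [toSpace]

theorem rot_three (n x : E 3) : rot n x = cross n x := by
  ext i
  simp [rot, cross, toSpace_three]

theorem fderiv_Z (hz : z ∈ C.domain) (η : Coord (2 * 3 - 1)) :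
    fderiv ℝ C.Z z η =
      phaseForm (C.rotField (EuclideanSpace.single 2 1) z) (fderiv ℝ C.toFun z η) := by
  rw [← fderiv_inner_Ctot le_rfl hz]
  congr 2
  funext w
  simp [Z, EuclideanSpace.inner_single_left]

/-- The derivative of `Θ` along `(X, Y, P) = (δx⁽²⁾, δy⁽²⁾, δx⁽¹⁾)` at
`(x, y, p) = (x⁽²⁾, y⁽²⁾, x⁽¹⁾)`. -/
def dTheta (x y p X Y P : E 3) : ℝ :=
  (inner ℝ (cross x y) P + inner ℝ (cross x Y + cross X y) p) / ‖p‖ -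
    inner ℝ (cross x y) p * inner ℝ p P / ‖p‖ ^ 3

theorem differentiableAt_Theta (hz : z ∈ C.domain) : DifferentiableAt ℝ C.Theta z := by
  have h : C.Theta = fun z => inner ℝ (C.C₂ z) (C.x₁ z) * ‖C.x₁ z‖⁻¹ := by
    funext w
    simp [Theta, toSpace_three, r₁, div_eq_mul_inv]
  rw [h]
  have h1 := (differentiableAt_C₂ hz).inner ℝ (differentiableAt_x₁ hz)
  have h2 := (differentiableAt_x₁ hz).norm ℝ (x₁_ne hz)
  exact h1.fun_mul (h2.fun_inv (norm_ne_zero_iff.2 (x₁_ne hz)))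

theorem fderiv_Theta (hz : z ∈ C.domain) (η : Coord (2 * 3 - 1)) :
    fderiv ℝ C.Theta z η = dTheta (C.x₂ z) (C.y₂ z) (C.x₁ z)
      (fderiv ℝ C.toFun z η).2.2.2 (fderiv ℝ C.toFun z η).2.1 (fderiv ℝ C.toFun z η).2.2.1 := by
  have hz0 : z + (0 : ℝ) • η = z := by simp
  have hr := norm_ne_zero_iff.2 (x₁_ne hz)
  refine fderiv_eq_of_hasDerivAt (differentiableAt_Theta hz) ?_
  have h1 := (hasDerivAt_cross (hasDerivAt_x₂ hz η) (hasDerivAt_y₂ hz η)).inner ℝ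
    (hasDerivAt_x₁ hz η)
  have h2 := hasDerivAt_norm_of_ne (hasDerivAt_x₁ hz η) (by rw [hz0]; exact x₁_ne hz)
  have h3 := h1.div h2 (by rw [hz0]; exact hr)
  have h4 : (fun t : ℝ => C.Theta (z + t • η)) =
      (fun t : ℝ => inner ℝ (cross (C.x₂ (z + t • η)) (C.y₂ (z + t • η))) (C.x₁ (z + t • η))) /
        fun t : ℝ => ‖C.x₁ (z + t • η)‖ := by
    funext t
    simp [Theta, toSpace_three, C₂, r₁]
  rw [h4]
  refine h3.congr_deriv ?_
  simp only [hz0, dTheta]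
  field_simp

/-- Up to sign, `Θ` generates the rotations of the outer body about the direction of `x⁽¹⁾`, with
`x⁽¹⁾` fixed. The dependence of the axis on `x⁽¹⁾` shows only in the motion of `y⁽¹⁾`. -/
theorem fderiv_Theta_eq_phaseForm (hz : z ∈ C.domain) (η : Coord (2 * 3 - 1)) :
    fderiv ℝ C.Theta z η = phaseForm
      (‖C.x₁ z‖⁻¹ • C.C₂ z - (inner ℝ (C.C₂ z) (C.x₁ z) / ‖C.x₁ z‖ ^ 3) • C.x₁ z,
        -rot (‖C.x₁ z‖⁻¹ • C.x₁ z) (C.y₂ z), 0, -rot (‖C.x₁ z‖⁻¹ • C.x₁ z) (C.x₂ z))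
      (fderiv ℝ C.toFun z η) := by
  rw [fderiv_Theta hz]
  have hr := norm_ne_zero_iff.2 (x₁_ne hz)
  set w := fderiv ℝ C.toFun z η
  have h1 : inner ℝ (rot (‖C.x₁ z‖⁻¹ • C.x₁ z) (C.y₂ z)) w.2.2.2 =
      -(inner ℝ (C.x₁ z) (cross w.2.2.2 (C.y₂ z)) / ‖C.x₁ z‖) := by
    rw [real_inner_comm, inner_rot_right le_rfl, inner_rot_left le_rfl, inner_smul_left]
    simp; ring
  have h2 : inner ℝ w.2.1 (rot (‖C.x₁ z‖⁻¹ • C.x₁ z) (C.x₂ z)) =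
      (inner ℝ (C.x₁ z) (cross (C.x₂ z) w.2.1) / ‖C.x₁ z‖) := by
    rw [real_inner_comm, inner_rot_left le_rfl, inner_smul_left]
    simp; ring
  simp only [phaseForm, inner_neg_left, inner_neg_right, h1, h2, inner_sub_left, inner_smul_left,
    inner_zero_right, dTheta, C₂, real_inner_comm (C.x₁ z)]
  simp [inner_add_right]
  field_simp
  ring

theorem rot_smul_self (c : ℝ) (x : E 3) : rot (c • x) x = 0 := by
  rw [rot_three, cross_smul_left, cross_self, smul_zero]

/-- A rotation about `x₁` fixes `x₁`, so the motion generated by `Θ` is a common rotation of the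
three vectors entering `𝒢²`. -/
theorem poisson_calGSq_Theta (hz : z ∈ C.domain) : poisson C.calGSq C.Theta z = 0 := by
  obtain ⟨ξ, h1, h2⟩ := exists_poisson_eq (by norm_num) hz (fderiv_Theta_eq_phaseForm hz)
  rw [h2, fderiv_calGSq (by norm_num) le_rfl hz, h1]
  have := dCalGSq_rot le_rfl C.mass (‖C.x₁ z‖⁻¹ • C.x₁ z) (C.x₂ z) (C.y₂ z) (C.x₁ z)
  rwa [rot_smul_self, neg_zero] at this

theorem poisson_pot_Theta (hz : z ∈ C.domain) : poisson C.pot C.Theta z = 0 := by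
  obtain ⟨ξ, h1, h2⟩ := exists_poisson_eq (by norm_num) hz (fderiv_Theta_eq_phaseForm hz)
  rw [h2, fderiv_pot hz, h1]
  have := inner_rot_self le_rfl (‖C.x₁ z‖⁻¹ • C.x₁ z) (C.x₁ z - C.x₂ z)
  rw [rot_sub, rot_smul_self, zero_sub, inner_neg_right, neg_eq_zero] at this
  simp [this]

theorem poisson_r₁_Theta (hz : z ∈ C.domain) : poisson C.r₁ C.Theta z = 0 := by
  obtain ⟨ξ, h1, h2⟩ := exists_poisson_eq (by norm_num) hz (fderiv_Theta_eq_phaseForm hz)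
  rw [h2, fderiv_r₁ hz, h1]
  simp

theorem poisson_Theta_of_rotField (hz : z ∈ C.domain) {n : E 3}
    {J : Coord (2 * 3 - 1) → ℝ}
    (hJ : ∀ η, fderiv ℝ J z η = phaseForm (C.rotField n z) (fderiv ℝ C.toFun z η)) :
    poisson C.Theta J z = 0 := by
  obtain ⟨ξ, h1, h2⟩ := exists_poisson_eq (by norm_num) hz hJ
  rw [h2, fderiv_Theta hz, h1]
  -- Invariance of the triple product of `x₂`, `y₂`, `x₁` under a common infinitesimal rotation.
  have h3 : inner ℝ (cross (C.x₂ z) (C.y₂ z)) (rot n (C.x₁ z)) +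
      inner ℝ (cross (C.x₂ z) (rot n (C.y₂ z)) + cross (rot n (C.x₂ z)) (C.y₂ z)) (C.x₁ z) = 0 := by
    simp only [rot_three, cross, cross_apply, toSpace_three, PiLp.inner_apply, Fin.sum_univ_three]
    simp
    ring
  have h4 : ∀ x y : E 3, cross x (-y) = -cross x y := fun x y => by
    rw [← neg_one_smul ℝ, cross_smul_right, neg_one_smul]
  have h5 : ∀ x y : E 3, cross (-x) y = -cross x y := fun x y => by
    rw [← neg_one_smul ℝ, cross_smul_left, neg_one_smul]
  simp only [dTheta, rotField, h4, h5, ← neg_add, inner_neg_left, inner_neg_right, h3,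
    inner_rot_self le_rfl]
  simp

theorem poisson_G_of_rotField (hz : z ∈ C.domain) {n : E 3} {J : Coord (2 * 3 - 1) → ℝ}
    (hJ : ∀ η, fderiv ℝ J z η = phaseForm (C.rotField n z) (fderiv ℝ C.toFun z η)) :
    poisson C.G J z = 0 := by
  obtain ⟨ξ, h1, h2⟩ := exists_poisson_eq (by norm_num) hz hJ
  rw [h2, fderiv_G le_rfl hz, h1, ← inner_dCtot le_rfl, inner_smul_left]
  have : inner ℝ (C.Ctot z) (cross (C.x₁ z) (C.rotField n z).1 +
      cross (C.rotField n z).2.2.1 (C.y₁ z) + (cross (C.x₂ z) (C.rotField n z).2.1 +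
      cross (C.rotField n z).2.2.2 (C.y₂ z))) = 0 := by
    simp only [Ctot, C₁, C₂, rotField, rot_three, cross, cross_apply, toSpace_three,
      PiLp.inner_apply, Fin.sum_univ_three]
    simp
    ring
  rw [this, mul_zero]

end Spatial

/-! ### Derivative of the ring potential -/

section RingDerivative

variable {d : ℕ} {X : ℝ → E d} {x : E d}

theorem hasDerivAt_one_div_norm_sub {γ : ℝ → E d} {γ' a : E d} {t : ℝ} (h : HasDerivAt γ γ' t)
    (ha : γ t ≠ a) :
    HasDerivAt (fun t => 1 / ‖γ t - a‖) (-(inner ℝ (γ t - a) γ' / ‖γ t - a‖ ^ 3)) t := by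
  have hne := sub_ne_zero.2 ha
  have hr := norm_ne_zero_iff.2 hne
  have := (hasDerivAt_norm_of_ne (h.sub_const a) hne).inv hr
  simp only [one_div]
  refine this.congr_deriv ?_
  field_simp

theorem hasFDerivAt_one_div_norm_sub {a : E d} (ha : x ≠ a) :
    HasFDerivAt (fun x => 1 / ‖x - a‖) (-((‖x - a‖ ^ 3)⁻¹ • innerSL ℝ (x - a))) x := by
  have hne := sub_ne_zero.2 ha
  have hr := norm_ne_zero_iff.2 hne
  have hs : DifferentiableAt ℝ (fun x : E d => x - a) x := by fun_prop
  have hd : DifferentiableAt ℝ (fun x => 1 / ‖x - a‖) x := by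
    simp only [one_div]
    exact (hs.norm ℝ hne).fun_inv hr
  have : fderiv ℝ (fun x => 1 / ‖x - a‖) x = -((‖x - a‖ ^ 3)⁻¹ • innerSL ℝ (x - a)) := by
    ext w
    have hl : HasDerivAt (fun t : ℝ => x + t • w) w 0 := by
      simpa using ((hasDerivAt_id (0 : ℝ)).smul_const w).const_add x
    have h1 := hasDerivAt_one_div_norm_sub hl (a := a) (by simpa using ha)
    rw [(hd.hasFDerivAt.hasLineDerivAt w).unique h1]
    simp [div_eq_inv_mul, inner_sub_left]
  rw [← this]
  exact hd.hasFDerivAt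

theorem hasFDerivAt_ringPotential (hX : Continuous X) (hx : ∀ s, x ≠ X s) :
    HasFDerivAt (ringPotential X) ((1 / (2 * Real.pi)) • ∫ s in (0 : ℝ)..(2 * Real.pi),
      -((‖x - X s‖ ^ 3)⁻¹ • innerSL ℝ (x - X s))) x := by
  have hW : IsOpen {p : E d × ℝ | p.1 ≠ X p.2} :=
    isOpen_ne_fun continuous_fst (hX.comp continuous_snd)
  have hne : ∀ p ∈ {p : E d × ℝ | p.1 ≠ X p.2}, ‖p.1 - X p.2‖ ≠ 0 := fun p hp =>
    norm_ne_zero_iff.2 (sub_ne_zero.2 hp)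
  have hc : Continuous fun p : E d × ℝ => p.1 - X p.2 :=
    continuous_fst.sub (hX.comp continuous_snd)
  have h := hasFDerivAt_intervalIntegral_of_continuousOn (𝕜 := ℝ)
    (f := fun x s => 1 / ‖x - X s‖)
    (f' := fun x s => -((‖x - X s‖ ^ 3)⁻¹ • innerSL ℝ (x - X s)))
    hW ?_ ?_ ?_ (x₀ := x) (a := 0) (b := 2 * Real.pi) (fun s _ => hx s)
  · exact h.const_smul (1 / (2 * Real.pi))
  · exact continuousOn_const.div hc.norm.continuousOn hne
  · refine ContinuousOn.neg (ContinuousOn.smul (ContinuousOn.inv₀ (by fun_prop)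
      fun p hp => pow_ne_zero 3 (hne p hp)) ?_)
    exact ((innerSL ℝ (E := E d)).continuous.comp hc).continuousOn
  · exact fun p hp => hasFDerivAt_one_div_norm_sub hp

theorem fderiv_ringPotential_apply (hX : Continuous X) (hx : ∀ s, x ≠ X s) (w : E d) :
    fderiv ℝ (ringPotential X) x w = 1 / (2 * Real.pi) * ∫ s in (0 : ℝ)..(2 * Real.pi),
      -((‖x - X s‖ ^ 3)⁻¹ * inner ℝ (x - X s) w) := by
  rw [(hasFDerivAt_ringPotential hX hx).fderiv, smul_apply, smul_eq_mul]
  congr 1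
  have hi : IntervalIntegrable (fun s => -((‖x - X s‖ ^ 3)⁻¹ • innerSL ℝ (x - X s)))
      volume 0 (2 * Real.pi) := by
    refine Continuous.intervalIntegrable ?_ _ _
    have hn : Continuous fun s => ‖x - X s‖ ^ 3 := by fun_prop
    refine Continuous.neg (Continuous.smul (hn.inv₀ fun s => ?_) ?_)
    · exact pow_ne_zero 3 (norm_ne_zero_iff.2 (sub_ne_zero.2 (hx s)))
    · exact (innerSL ℝ (E := E d)).continuous.comp (continuous_const.sub hX)
  rw [ContinuousLinearMap.intervalIntegral_apply hi]
  rfl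

end RingDerivative

/-! ### Finite and infinitesimal rotations of a plane -/

section Turn

variable {d : ℕ} {e f : E d}

/-- The rotation by the angle `φ` of the plane with orthonormal basis `(e, f)`, extended by the
identity on its orthogonal complement. -/
def turn (e f : E d) (φ : ℝ) (v : E d) : E d :=
  v + (Real.cos φ - 1) • (inner ℝ e v • e + inner ℝ f v • f) +
    Real.sin φ • (inner ℝ e v • f - inner ℝ f v • e)

theorem continuous_turn : Continuous fun p : ℝ × E d => turn e f p.1 p.2 := by
  unfold turn
  fun_prop

theorem turn_zero (v : E d) : turn e f 0 v = v := by simp [turn]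

theorem turn_add_smul (φ t : ℝ) (v w : E d) :
    turn e f φ (v + t • w) = turn e f φ v + t • turn e f φ w := by
  simp only [turn, inner_add_right, inner_smul_right]
  module

theorem inner_turn_left (he : ‖e‖ = 1) (hef : inner ℝ e f = 0) (φ : ℝ) (v : E d) :
    inner ℝ e (turn e f φ v) = Real.cos φ * inner ℝ e v - Real.sin φ * inner ℝ f v := by
  simp only [turn, inner_add_right, inner_smul_right, inner_sub_right, hef,
    real_inner_self_eq_norm_sq, he]
  ring

theorem inner_turn_right (hf : ‖f‖ = 1) (hef : inner ℝ e f = 0) (φ : ℝ) (v : E d) :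
    inner ℝ f (turn e f φ v) = Real.sin φ * inner ℝ e v + Real.cos φ * inner ℝ f v := by
  simp only [turn, inner_add_right, inner_smul_right, inner_sub_right, real_inner_comm e f, hef,
    real_inner_self_eq_norm_sq, hf]
  ring

theorem inner_turn_of_orthogonal {n : E d} (he : inner ℝ n e = 0) (hf : inner ℝ n f = 0) (φ : ℝ)
    (v : E d) : inner ℝ n (turn e f φ v) = inner ℝ n v := by
  simp [turn, inner_add_right, inner_smul_right, inner_sub_right, he, hf]

theorem hasDerivAt_turn (he : ‖e‖ = 1) (hf : ‖f‖ = 1) (hef : inner ℝ e f = 0) (φ : ℝ) (v : E d) :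
    HasDerivAt (fun φ => turn e f φ v)
      (inner ℝ e (turn e f φ v) • f - inner ℝ f (turn e f φ v) • e) φ := by
  have h := ((((Real.hasDerivAt_cos φ).sub_const 1).smul_const
    (inner ℝ e v • e + inner ℝ f v • f)).const_add v).add
      ((Real.hasDerivAt_sin φ).smul_const (inner ℝ e v • f - inner ℝ f v • e))
  refine h.congr_deriv ?_
  rw [inner_turn_left he hef, inner_turn_right hf hef]
  module

theorem norm_turn (he : ‖e‖ = 1) (hf : ‖f‖ = 1) (hef : inner ℝ e f = 0) (φ : ℝ) (v : E d) :
    ‖turn e f φ v‖ = ‖v‖ := by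
  have h : ∀ φ, HasDerivAt (fun φ => ‖turn e f φ v‖ ^ 2) 0 φ := fun φ => by
    refine (hasDerivAt_turn he hf hef φ v).norm_sq.congr_deriv ?_
    rw [inner_sub_right, inner_smul_right, inner_smul_right, real_inner_comm e, real_inner_comm f]
    ring
  have := OuterKeplerMap.eq_of_forall_hasDerivAt_zero h φ 0
  simp only [turn_zero] at this
  exact (pow_left_inj₀ (norm_nonneg _) (norm_nonneg _) two_ne_zero).1 this

theorem turn_ne_self (he : ‖e‖ = 1) (hf : ‖f‖ = 1) (hef : inner ℝ e f = 0) {φ : ℝ} (h0 : 0 < φ)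
    (hπ : φ < Real.pi) {v : E d} (hv : inner ℝ e v ≠ 0 ∨ inner ℝ f v ≠ 0) : turn e f φ v ≠ v := by
  intro h
  have h1 := inner_turn_left he hef φ v
  have h2 := inner_turn_right hf hef φ v
  rw [h] at h1 h2
  have hs := Real.sin_pos_of_pos_of_lt_pi h0 hπ
  have h3 : Real.sin φ * (inner ℝ e v ^ 2 + inner ℝ f v ^ 2) = 0 := by
    linear_combination inner ℝ f v * h1 - inner ℝ e v * h2
  have h4 := (mul_eq_zero.1 h3).resolve_left hs.ne'
  rcases hv with hv | hv <;> have := sq_pos_of_ne_zero hv <;>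
    nlinarith [sq_nonneg (inner ℝ e v), sq_nonneg (inner ℝ f v)]

/-- The infinitesimal rotation `v ↦ (x · v) y - (y · v) x` of the plane spanned by `x` and `y`. -/
def planeRot (x y v : E d) : E d := inner ℝ x v • y - inner ℝ y v • x

theorem inner_planeRot_self (x y v : E d) : inner ℝ v (planeRot x y v) = 0 := by
  simp only [planeRot, inner_sub_right, inner_smul_right, real_inner_comm v]
  ring

theorem inner_planeRot (x y v w : E d) : inner ℝ v (planeRot x y w) = -inner ℝ (planeRot x y v) w := by
  simp only [planeRot, inner_sub_right, inner_sub_left, inner_smul_left, inner_smul_right,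
    real_inner_comm v]
  simp
  ring

/-- Gram–Schmidt applied to `x` and `y`. The factor `c` is the area of their parallelogram, so
`planeRot x y` is a positive multiple of the generator of `turn e f`. -/
theorem exists_orthonormal_planeRot {x y : E d} (h : 0 < ‖x‖ ^ 2 * ‖y‖ ^ 2 - inner ℝ x y ^ 2) :
    ∃ (e f : E d) (c : ℝ), ‖e‖ = 1 ∧ ‖f‖ = 1 ∧ inner ℝ e f = 0 ∧ 0 < c ∧
      (∀ v, planeRot x y v = c • (inner ℝ e v • f - inner ℝ f v • e)) ∧
      (∀ n, inner ℝ n x = 0 → inner ℝ n y = 0 → inner ℝ n e = 0 ∧ inner ℝ n f = 0) ∧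
      (∃ a b c' : ℝ, x = a • e ∧ y = b • e + c' • f) := by
  have hx : 0 < ‖x‖ := by
    refine (norm_nonneg x).lt_of_ne fun h0 => ?_
    rw [← h0] at h
    nlinarith [sq_nonneg (inner ℝ x y)]
  set e := ‖x‖⁻¹ • x with he
  have hxe : x = ‖x‖ • e := by rw [he, smul_smul, mul_inv_cancel₀ hx.ne', one_smul]
  have he1 : ‖e‖ = 1 := by rw [he, norm_smul, norm_inv, norm_norm, inv_mul_cancel₀ hx.ne']
  set g := y - inner ℝ e y • e with hg
  have hxy : inner ℝ x y = ‖x‖ * inner ℝ e y := by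
    conv_lhs => rw [hxe]
    rw [inner_smul_left]; simp
  have hgn : ‖g‖ ^ 2 = ‖y‖ ^ 2 - inner ℝ e y ^ 2 := by
    rw [hg, norm_sub_sq_real, inner_smul_right, norm_smul, he1, real_inner_comm, mul_one,
      Real.norm_eq_abs, sq_abs]
    ring
  have hg0 : 0 < ‖g‖ := by
    refine (norm_nonneg g).lt_of_ne fun h0 => ?_
    rw [hxy] at h
    have : ‖x‖ ^ 2 * ‖g‖ ^ 2 > 0 := by rw [hgn]; linarith
    rw [← h0] at this
    simp at this
  set f := ‖g‖⁻¹ • g with hf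
  have hgf : g = ‖g‖ • f := by rw [hf, smul_smul, mul_inv_cancel₀ hg0.ne', one_smul]
  have hf1 : ‖f‖ = 1 := by rw [hf, norm_smul, norm_inv, norm_norm, inv_mul_cancel₀ hg0.ne']
  have hef : inner ℝ e f = 0 := by
    rw [hf, inner_smul_right, hg, inner_sub_right, inner_smul_right, real_inner_self_eq_norm_sq, he1]
    simp
  have hy : y = inner ℝ e y • e + ‖g‖ • f := by rw [← hgf, hg]; abel
  refine ⟨e, f, ‖x‖ * ‖g‖, he1, hf1, hef, by positivity, fun v => ?_, fun n h1 h2 => ?_,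
    ‖x‖, inner ℝ e y, ‖g‖, hxe, hy⟩
  · have h1 : inner ℝ x v = ‖x‖ * inner ℝ e v := by
      conv_lhs => rw [hxe]
      rw [inner_smul_left]; simp
    have h2 : inner ℝ y v = inner ℝ e y * inner ℝ e v + ‖g‖ * inner ℝ f v := by
      have h3 := congrArg (fun u => inner ℝ u v) hy
      simp only [inner_add_left, real_inner_smul_left] at h3
      exact h3
    calc planeRot x y v = (‖x‖ * inner ℝ e v) • (inner ℝ e y • e + ‖g‖ • f) -
          (inner ℝ e y * inner ℝ e v + ‖g‖ * inner ℝ f v) • (‖x‖ • e) := by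
          rw [planeRot, h1, h2, ← hxe, ← hy]
      _ = _ := by module
  · have h3 : inner ℝ n e = 0 := by rw [he, inner_smul_right, h1, mul_zero]
    exact ⟨h3, by rw [hf, inner_smul_right, hg, inner_sub_right, inner_smul_right, h2, h3]; simp⟩

theorem norm_planeRot_sq {x y : E d} (a b : ℝ) :
    ‖planeRot x y (a • x + b • y)‖ ^ 2 =
      (‖x‖ ^ 2 * ‖y‖ ^ 2 - inner ℝ x y ^ 2) * ‖a • x + b • y‖ ^ 2 := by
  simp only [← real_inner_self_eq_norm_sq, planeRot, inner_add_left, inner_add_right,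
    inner_sub_left, inner_sub_right, inner_smul_left, inner_smul_right, real_inner_comm x y]
  simp
  ring

end Turn

/-! ### Entire paths, and functions vanishing near a point -/

theorem entirePath_line {d : ℕ} (a b : E d) : EntirePath fun t => a + t • b :=
  ⟨fun τ i => a i + τ * b i, fun i => by fun_prop, fun t i => by simp⟩

theorem entirePath_polar {d : ℕ} (e f : E d) (r₀ r₁ a₀ a₁ : ℝ) :
    EntirePath fun t => (r₀ + t * r₁) • (Real.cos (a₀ + t * a₁) • e + Real.sin (a₀ + t * a₁) • f) :=
  ⟨fun τ i => (r₀ + τ * r₁) * (Complex.cos (a₀ + τ * a₁) * e i + Complex.sin (a₀ + τ * a₁) * f i),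
    fun i => by fun_prop, fun t i => by simp [mul_add]⟩

section Vanishing

variable {V P : Type*} [NormedAddCommGroup V] [NormedSpace ℝ V] [NormedAddCommGroup P]
  [NormedSpace ℝ P]

/-- The direction may depend on the point, and the conclusion again holds on a neighbourhood, so the
lemma can be iterated. It reduces the claims that a function vanishes on no open set to an explicit
nonzero derivative. -/
theorem eventually_derivative_eq_zero {F : P → V} {p₀ : P} (h : ∀ᶠ p in 𝓝 p₀, F p = 0) (v : P → P)
    {G : P → V} (hG : ∀ᶠ p in 𝓝 p₀, HasDerivAt (fun t : ℝ => F (p + t • v p)) (G p) 0) :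
    ∀ᶠ p in 𝓝 p₀, G p = 0 := by
  filter_upwards [h.eventually_nhds, hG] with p hp hGp
  have hc : ContinuousAt (fun t : ℝ => p + t • v p) 0 := by fun_prop
  have h0 : ∀ᶠ t : ℝ in 𝓝 0, F (p + t • v p) = 0 :=
    hc.eventually (by simpa using hp)
  exact hGp.unique ((hasDerivAt_const 0 (0 : V)).congr_of_eventuallyEq h0)

end Vanishing
-- Moving the inner body over a fixed outer orbit
namespace OuterKeplerMap

variable {d : ℕ} {C : OuterKeplerMap d} {z : Coord (2 * d - 1)}

variable (C) in
/-- The Keplerian orbit `ℓ₂ ↦ x⁽²⁾` through `z`. -/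
def orbit (z : Coord (2 * d - 1)) (s : ℝ) : E d := C.x₂ (z.setAng s)

/-- The map is open, so a property valid near `z` can be tested at every nearby Cartesian phase
point, with the four vectors varied independently. -/
theorem eventually_phase (hd : 0 < d) (hz : z ∈ C.domain) {P : Coord (2 * d - 1) → Prop}
    (h : ∀ᶠ w in 𝓝 z, P w) :
    ∀ᶠ p in 𝓝 (C.toFun z), ∃ w, P w ∧ w ∈ C.domain ∧ C.toFun w = p := by
  rw [← map_nhds hd hz, eventually_map]
  filter_upwards [h, C.isOpen_domain.mem_nhds hz] with w h1 h2
  exact ⟨w, h1, h2, rfl⟩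

theorem eventually_x₁ (hd : 0 < d) (hz : z ∈ C.domain) {P : Coord (2 * d - 1) → Prop}
    (h : ∀ᶠ w in 𝓝 z, P w) :
    ∀ᶠ x in 𝓝 (C.x₁ z), ∃ w, P w ∧ w ∈ C.domain ∧ C.x₁ w = x ∧ C.x₂ w = C.x₂ z ∧
      C.y₂ w = C.y₂ z := by
  have hc : ContinuousAt (fun x : E d => ((C.y₁ z, C.y₂ z, x, C.x₂ z) : Phase d)) (C.x₁ z) := by
    fun_prop
  filter_upwards [hc.eventually (eventually_phase hd hz h)] with x ⟨w, h1, h2, h3⟩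
  exact ⟨w, h1, h2, by rw [x₁, h3], by rw [x₂, h3], by rw [y₂, h3]⟩

theorem ringPotential_orbit_eq (hd : 0 < d) (hd3 : d ≤ 3) {w : Coord (2 * d - 1)}
    (hz : z ∈ C.domain) (hw : w ∈ C.domain) (hx : C.x₂ w = C.x₂ z) (hy : C.y₂ w = C.y₂ z) :
    ringPotential (C.orbit w) = ringPotential (C.orbit z) := by
  funext x
  exact congrArg (fun a => 1 / (2 * Real.pi) * a)
    (intervalIntegral_orbit_eq hd hd3 hz hw hx hy fun a => 1 / ‖x - a‖)

theorem x₁_ne_orbit (hd : 0 < d) (hz : z ∈ C.domain) (s : ℝ) : C.x₁ z ≠ C.orbit z s := by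
  rw [← x₁_setAng hd hz s]
  exact x₁_ne_x₂' (setAng_mem hz s)

theorem continuous_orbit (hd : 0 < d) (hz : z ∈ C.domain) : Continuous (C.orbit z) :=
  continuous_x₂_setAng hd hz

theorem eventually_ne_orbit (hd : 0 < d) (hz : z ∈ C.domain) :
    ∀ᶠ x in 𝓝 (C.x₁ z), ∀ s, x ≠ C.orbit z s := by
  have hp : Function.Periodic (C.orbit z) (2 * Real.pi) := periodic_x₂ hz
  have hcl : IsClosed (range (C.orbit z)) := by
    rw [← hp.image_Icc (by positivity) 0]
    exact (isCompact_Icc.image (continuous_orbit hd hz)).isClosed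
  filter_upwards [hcl.isOpen_compl.mem_nhds (show C.x₁ z ∈ _ from by
    rintro ⟨s, hs⟩; exact x₁_ne_orbit hd hz s hs.symm)] with x hx s hs
  exact hx ⟨s, hs.symm⟩

/-- Through the local inverse, the inner body is moved along a straight line with the outer state
held fixed. The outer orbit is then the same curve up to phase, so the average is the potential of
one fixed ring. -/
theorem fderiv_avgPotential_of_inner (hd : 0 < d) (hd3 : d ≤ 3) (hz : z ∈ C.domain)
    {ξ : Coord (2 * d - 1)} {u w : E d} (h : fderiv ℝ C.toFun z ξ = (u, 0, w, 0)) :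
    fderiv ℝ C.avgPotential z ξ = fderiv ℝ (ringPotential (C.orbit z)) (C.x₁ z) w := by
  have hbij := bijective_fderiv hd hz
  let e : Coord (2 * d - 1) ≃L[ℝ] Phase d := ContinuousLinearEquiv.ofBijective (fderiv ℝ C.toFun z)
    (LinearMap.ker_eq_bot.2 hbij.1) (LinearMap.range_eq_top.2 hbij.2)
  have hs : HasStrictFDerivAt C.toFun (e : Coord (2 * d - 1) →L[ℝ] Phase d) z :=
    (contDiffAt hz).hasStrictFDerivAt (by norm_num)
  let ψ := hs.localInverse C.toFun e z
  have hψz : ψ (C.toFun z) = z := hs.localInverse_apply_image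
  have hψ : HasFDerivAt ψ (e.symm : Phase d →L[ℝ] Coord (2 * d - 1)) (C.toFun z) :=
    hs.to_localInverse.hasFDerivAt
  have hξ : e.symm (u, 0, w, 0) = ξ := by
    rw [← h]; exact e.symm_apply_apply ξ
  have hline : HasDerivAt (fun t : ℝ => C.toFun z + t • ((u, 0, w, 0) : Phase d)) (u, 0, w, 0) 0 := by
    simpa using ((hasDerivAt_id (0 : ℝ)).smul_const ((u, 0, w, 0) : Phase d)).const_add (C.toFun z)
  have h1 : HasDerivAt (fun t : ℝ => ψ (C.toFun z + t • ((u, 0, w, 0) : Phase d))) ξ 0 := by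
    have := HasFDerivAt.comp_hasDerivAt (x := (0 : ℝ)) (l := ψ)
      (f := fun t : ℝ => C.toFun z + t • ((u, 0, w, 0) : Phase d)) (by simpa using hψ) hline
    exact this.congr_deriv hξ
  have h2 : HasDerivAt (fun t : ℝ => C.avgPotential (ψ (C.toFun z + t • ((u, 0, w, 0) : Phase d))))
      (fderiv ℝ C.avgPotential z ξ) 0 := by
    refine HasFDerivAt.comp_hasDerivAt (x := (0 : ℝ)) (l := C.avgPotential) ?_ h1
    rw [zero_smul, add_zero, hψz]
    exact (hasFDerivAt_avgPotential hz).differentiableAt.hasFDerivAt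
  have hx : HasDerivAt (fun t : ℝ => C.x₁ z + t • w) w 0 := by
    simpa using ((hasDerivAt_id (0 : ℝ)).smul_const w).const_add (C.x₁ z)
  have h3 : HasDerivAt (fun t : ℝ => ringPotential (C.orbit z) (C.x₁ z + t • w))
      (fderiv ℝ (ringPotential (C.orbit z)) (C.x₁ z) w) 0 := by
    refine HasFDerivAt.comp_hasDerivAt (x := (0 : ℝ)) (l := ringPotential (C.orbit z)) ?_ hx
    rw [zero_smul, add_zero]
    exact (hasFDerivAt_ringPotential (continuous_orbit hd hz)
      (x₁_ne_orbit hd hz)).differentiableAt.hasFDerivAt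
  refine h2.unique (h3.congr_of_eventuallyEq ?_)
  have hlim : Tendsto (fun t : ℝ => C.toFun z + t • ((u, 0, w, 0) : Phase d)) (𝓝 0)
      (𝓝 (C.toFun z)) := by
    simpa using hline.continuousAt.tendsto
  have hD : ∀ᶠ p in 𝓝 (C.toFun z), ψ p ∈ C.domain :=
    hψ.continuousAt.eventually_mem (by rw [hψz]; exact C.isOpen_domain.mem_nhds hz)
  filter_upwards [hlim.eventually hs.eventually_right_inverse, hlim.eventually hD] with t ht hDt
  have e1 : C.x₂ (ψ (C.toFun z + t • ((u, 0, w, 0) : Phase d))) = C.x₂ z := by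
    rw [x₂, ht]; simp [x₂]
  have e2 : C.y₂ (ψ (C.toFun z + t • ((u, 0, w, 0) : Phase d))) = C.y₂ z := by
    rw [y₂, ht]; simp [y₂]
  have e3 : C.x₁ (ψ (C.toFun z + t • ((u, 0, w, 0) : Phase d))) = C.x₁ z + t • w := by
    rw [x₁, ht]; simp [x₁]
  rw [avgPotential_eq_of_eq hd hd3 hz hDt e1 e2, e3]
  rfl

/-- With the outer state held fixed, the hypothesis says that the rotational derivative of one ring
potential vanishes near `x₁`. Integrating it along arcs gives invariance under small finite
rotations. -/
theorem eventually_ringPotential_turn (hd : 0 < d) (hd3 : d ≤ 3) (hz : z ∈ C.domain)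
    (h : ∀ᶠ w in 𝓝 z, fderiv ℝ (ringPotential (C.orbit w)) (C.x₁ w)
      (planeRot (C.x₂ w) (C.y₂ w) (C.x₁ w)) = 0) {e f : E d} {c : ℝ} (he : ‖e‖ = 1) (hf : ‖f‖ = 1)
    (hef : inner ℝ e f = 0) (hc : 0 < c)
    (hrot : ∀ v, planeRot (C.x₂ z) (C.y₂ z) v = c • (inner ℝ e v • f - inner ℝ f v • e)) :
    ∀ᶠ p : ℝ × E d in 𝓝 (0, C.x₁ z), ringPotential (C.orbit z) (turn e f p.1 p.2) =
      ringPotential (C.orbit z) p.2 := by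
  have h1 : ∀ᶠ x in 𝓝 (C.x₁ z), (∀ s, x ≠ C.orbit z s) ∧
      fderiv ℝ (ringPotential (C.orbit z)) x (planeRot (C.x₂ z) (C.y₂ z) x) = 0 := by
    filter_upwards [eventually_x₁ hd hz h, eventually_ne_orbit hd hz] with x ⟨w, h1, h2, h3, h4, h5⟩ h6
    rw [ringPotential_orbit_eq hd hd3 hz h2 h4 h5, h3, h4, h5] at h1
    exact ⟨h6, h1⟩
  have h2 : Tendsto (fun p : ℝ × E d => turn e f p.1 p.2) (𝓝 (0, C.x₁ z)) (𝓝 (C.x₁ z)) := by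
    have := (continuous_turn (e := e) (f := f)).tendsto (0, C.x₁ z)
    simpa only [turn_zero] using this
  have h3 := h2.eventually h1
  obtain ⟨u, hu, v, hv, huv⟩ := mem_nhds_prod_iff.1 h3
  obtain ⟨ε, hε, hεu⟩ := Metric.mem_nhds_iff.1 hu
  filter_upwards [prod_mem_nhds (Metric.ball_mem_nhds 0 hε) hv] with ⟨φ, x⟩ ⟨hφ, hx⟩
  have hder : ∀ θ ∈ Metric.ball (0 : ℝ) ε,
      HasDerivAt (fun θ => ringPotential (C.orbit z) (turn e f θ x)) 0 θ := by
    intro θ hθ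
    obtain ⟨h5, h6⟩ := huv (show (θ, x) ∈ u ×ˢ v from ⟨hεu hθ, hx⟩)
    have h7 := (hasFDerivAt_ringPotential (continuous_orbit hd hz)
      h5).differentiableAt.hasFDerivAt.comp_hasDerivAt θ (hasDerivAt_turn he hf hef θ x)
    refine h7.congr_deriv ?_
    rw [hrot, map_smul, smul_eq_mul] at h6
    exact (mul_eq_zero.1 h6).resolve_left hc.ne'
  have := (convex_ball (0 : ℝ) ε).norm_image_sub_le_of_norm_hasDerivWithin_le (C := 0)
    (fun θ hθ => (hder θ hθ).hasDerivWithinAt) (by simp) (Metric.mem_ball_self hε) hφ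
  simp only [turn_zero, zero_mul, norm_le_zero_iff] at this
  exact sub_eq_zero.1 this

/-- Along `γ` the potential diverges on reaching the orbit, whereas along the turned path it is
analytic on all of `[0, 1]`. Before the end the turned path avoids the orbit by `hoff`. At the end
it sits at a turned apsis, which has the norm of the apsis but is a different point, hence is off
the noncircular orbit. -/
theorem false_of_ringPotential_turn (hd : 0 < d) (hd3 : d ≤ 3) (hz : z ∈ C.domain)
    (hA : C.lap z ≠ 0) {e f : E d} (he : ‖e‖ = 1) (hf : ‖f‖ = 1) (hef : inner ℝ e f = 0)
    (hturn : ∀ᶠ p : ℝ × E d in 𝓝 (0, C.x₁ z), ringPotential (C.orbit z) (turn e f p.1 p.2) =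
      ringPotential (C.orbit z) p.2)
    {γ : ℝ → E d} (hγ : EntirePath γ) (hγt : ∀ φ, EntirePath fun t => turn e f φ (γ t))
    (h0 : γ 0 = C.x₁ z) {s₀ : ℝ} (h1 : γ 1 = C.orbit z s₀)
    (hs₀ : inner ℝ (C.x₂ (z.setAng s₀)) (C.y₂ (z.setAng s₀)) = 0)
    (hplane : inner ℝ e (C.orbit z s₀) ≠ 0 ∨ inner ℝ f (C.orbit z s₀) ≠ 0)
    (hoff : ∀ t, 0 ≤ t → t < 1 → ∀ φ s, turn e f φ (γ t) ≠ C.orbit z s) : False := by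
  obtain ⟨u, hu, v, hv, huv⟩ := mem_nhds_prod_iff.1 hturn
  obtain ⟨ε, hε, hεu⟩ := Metric.mem_nhds_iff.1 hu
  -- An angle below `ε` for the local invariance, and strictly between `0` and `π` so that the turn
  -- moves the apsis.
  obtain ⟨φ, hφ0, hφ⟩ := exists_between (lt_min hε Real.pi_pos)
  obtain ⟨hφε, hφπ⟩ := lt_min_iff.1 hφ
  obtain ⟨K, hK, hL⟩ := lipschitz_x₂ hd hd3 hz
  refine not_analytic_continuation_ringPotential_sq (continuous_orbit hd hz) (periodic_x₂ hz) hK hL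
    hγ (b := fun t => ringPotential (C.orbit z) (turn e f φ (γ t)) ^ 2) ?_ ?_ ?_ h1
  · intro t ht
    refine (analyticAt_ringPotential_comp (continuous_orbit hd hz) (hγt φ) fun s hs => ?_).pow 2
    rcases ht.2.lt_or_eq with h | rfl
    · exact hoff t ht.1 h φ s hs
    · rw [h1] at hs
      have hn : ‖C.orbit z s‖ = ‖C.orbit z s₀‖ := by rw [← hs, norm_turn he hf hef]
      have := x₂_eq_of_norm_eq hd hz hA hs₀ hn
      exact turn_ne_self he hf hef hφ0 hφπ hplane (hs.trans this)
  · have hc : Tendsto γ (𝓝 0) (𝓝 (C.x₁ z)) := by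
      rw [← h0]; exact hγ.continuous.tendsto 0
    filter_upwards [hc.eventually hv] with t ht
    have : (φ, γ t) ∈ u ×ˢ v := ⟨hεu (by simpa [abs_of_pos hφ0] using hφε), ht⟩
    rw [show _ = _ from huv this]
  · intro s
    rw [h0]
    exact x₁_ne_orbit hd hz s

/-- For a fixed outer state `𝒢²` is affine in `x₁`, so it cannot follow the squared average along
the segment from `x₁` to a point of the orbit, where the latter is singular. -/
theorem exists_ne_ham (hd : 0 < d) (hd3 : d ≤ 3) (hpos : ∀ z ∈ C.domain, 0 < C.calGSq z) :
    ∃ z ∈ C.domain, C.calG z ≠ C.avgPotential z := by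
  by_contra hcon
  push Not at hcon
  obtain ⟨z, hz⟩ := C.nonempty_domain
  obtain ⟨K, hK, hL⟩ := lipschitz_x₂ hd hd3 hz
  refine not_analytic_continuation_ringPotential_sq (continuous_orbit hd hz) (periodic_x₂ hz) hK hL
    (entirePath_line (C.x₁ z) (C.orbit z 0 - C.x₁ z))
    (b := fun t => C.gsq z - (inner ℝ (C.lap z) (C.x₁ z) +
      t * inner ℝ (C.lap z) (C.orbit z 0 - C.x₁ z))) ?_ ?_ ?_ (s₁ := 0) ?_
  · intro t _
    fun_prop
  · have hev := eventually_x₁ hd hz (P := fun _ => True) (Eventually.of_forall fun _ => trivial)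
    have hc : Tendsto (fun t : ℝ => C.x₁ z + t • (C.orbit z 0 - C.x₁ z)) (𝓝 0) (𝓝 (C.x₁ z)) := by
      have : Continuous fun t : ℝ => C.x₁ z + t • (C.orbit z 0 - C.x₁ z) := by fun_prop
      simpa using this.tendsto 0
    filter_upwards [hc.eventually hev] with t ⟨w, _, hw, h1, h2, h3⟩
    have h4 := hcon w hw
    rw [avgPotential_eq_of_eq hd hd3 hz hw h2 h3, h1] at h4
    change _ = ringPotential (C.orbit z) _ at h4
    rw [← h4, calG, Real.sq_sqrt (hpos w hw).le, calGSq_eq hd hd3 hw, gsq, lap, h1, h2, h3,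
      inner_add_right, inner_smul_right]
    rfl
  · intro s
    simpa using x₁_ne_orbit hd hz s
  · simp

/-- Vanishing on an open set would force the Laplace vector to vanish there, and circular orbits do
not fill an open set. -/
theorem not_eventually_inner_lap_planeRot (hd : 0 < d) (hz : z ∈ C.domain) :
    ¬ ∀ᶠ w in 𝓝 z, inner ℝ (C.lap w) (planeRot (C.x₂ w) (C.y₂ w) (C.x₁ w)) = 0 := by
  intro h
  let A : Phase d → E d := fun p => ‖p.2.1‖ ^ 2 • p.2.2.2 - inner ℝ p.2.2.2 p.2.1 • p.2.1 -
    (C.mass / ‖p.2.2.2‖) • p.2.2.2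
  let g : Phase d → ℝ := fun p => ‖p.2.2.2‖ ^ 2 * ‖p.2.1‖ ^ 2 - inner ℝ p.2.2.2 p.2.1 ^ 2
  have hg : ∀ᶠ p in 𝓝 (C.toFun z), g p ≠ 0 := by
    have hc : Continuous g := by fun_prop
    exact hc.continuousAt.eventually_ne (gsq_pos hd hz).ne'
  have h1 : ∀ᶠ p in 𝓝 (C.toFun z), inner ℝ (A p) (planeRot p.2.2.2 p.2.1 p.2.2.1) = 0 := by
    filter_upwards [eventually_phase hd hz h] with p ⟨w, h1, _, h2⟩
    rw [← h2]
    exact h1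
  -- Varying `x₁` along `planeRot x₂ y₂ A` produces `-‖planeRot x₂ y₂ A‖²` by antisymmetry. As `A`
  -- lies in the span of `x₂` and `y₂`, this equals `-g * ‖A‖²`.
  have h2 := eventually_derivative_eq_zero h1
    (fun p => (0, 0, planeRot p.2.2.2 p.2.1 (A p), 0))
    (G := fun p => inner ℝ (A p) (planeRot p.2.2.2 p.2.1 (planeRot p.2.2.2 p.2.1 (A p)))) (by
      refine Eventually.of_forall fun p => ?_
      have : ∀ t : ℝ, inner ℝ (A (p + t • (0, 0, planeRot p.2.2.2 p.2.1 (A p), 0)))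
          (planeRot (p + t • ((0, 0, planeRot p.2.2.2 p.2.1 (A p), 0) : Phase d)).2.2.2
            (p + t • ((0, 0, planeRot p.2.2.2 p.2.1 (A p), 0) : Phase d)).2.1
            (p + t • ((0, 0, planeRot p.2.2.2 p.2.1 (A p), 0) : Phase d)).2.2.1) =
          inner ℝ (A p) (planeRot p.2.2.2 p.2.1 p.2.2.1) + t *
            inner ℝ (A p) (planeRot p.2.2.2 p.2.1 (planeRot p.2.2.2 p.2.1 (A p))) := by
        intro t
        simp only [A, Prod.snd_add, Prod.fst_add, Prod.smul_snd, Prod.smul_fst, smul_zero, add_zero]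
        rw [← inner_smul_right, ← inner_add_right]
        congr 1
        simp only [planeRot, inner_add_right, inner_smul_right]
        module
      simp only [this]
      exact (((hasDerivAt_id (0 : ℝ)).mul_const _).const_add _).congr_deriv (one_mul _))
  have h3 : ∀ᶠ p in 𝓝 (C.toFun z), A p = 0 := by
    filter_upwards [h2, hg] with p hp hgp
    rw [inner_planeRot, real_inner_self_eq_norm_sq, neg_eq_zero] at hp
    have hA : A p = (‖p.2.1‖ ^ 2 - C.mass / ‖p.2.2.2‖) • p.2.2.2 +
        (-inner ℝ p.2.2.2 p.2.1) • p.2.1 := by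
      simp only [A]; module
    rw [hA, norm_planeRot_sq, ← hA] at hp
    simpa using (mul_eq_zero.1 hp).resolve_left hgp
  -- Varying `y₂` along `x₂`: the resulting vector has inner product `-g` with `y₂`, which is
  -- nonzero.
  have h4 := eventually_derivative_eq_zero h3 (fun p => (0, p.2.2.2, 0, 0))
    (G := fun p => inner ℝ p.2.2.2 p.2.1 • p.2.2.2 - ‖p.2.2.2‖ ^ 2 • p.2.1) (by
      refine Eventually.of_forall fun p => ?_
      have hy : HasDerivAt (fun t : ℝ => p.2.1 + t • p.2.2.2) p.2.2.2 0 := by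
        simpa using ((hasDerivAt_id (0 : ℝ)).smul_const p.2.2.2).const_add p.2.1
      have := ((hy.norm_sq.smul_const p.2.2.2).sub
        (((hasDerivAt_const (0 : ℝ) p.2.2.2).inner ℝ hy).smul hy)).sub_const
          ((C.mass / ‖p.2.2.2‖) • p.2.2.2)
      simp only [A, Prod.snd_add, Prod.fst_add, Prod.smul_snd, Prod.smul_fst, smul_zero, add_zero]
      refine this.congr_deriv ?_
      simp only [zero_smul, add_zero, inner_zero_left, real_inner_self_eq_norm_sq,
        real_inner_comm p.2.2.2]
      module)
  obtain ⟨h5, h6⟩ := (h4.and hg).self_of_nhds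
  apply h6
  have h7 := congrArg (fun v => inner ℝ v (C.toFun z).2.1) h5
  simp only [inner_sub_left, real_inner_smul_left, inner_zero_left, real_inner_self_eq_norm_sq] at h7
  simp only [g]
  linarith

end OuterKeplerMap

/-! ### Polar coordinates in the plane -/

section Polar

/-- The point with polar coordinates `(r, a)` in the plane with orthonormal basis `(e, f)`. -/
def polar {d : ℕ} (e f : E d) (r a : ℝ) : E d := r • (Real.cos a • e + Real.sin a • f)

theorem norm_polar {d : ℕ} {e f : E d} (he : ‖e‖ = 1) (hf : ‖f‖ = 1) (hef : inner ℝ e f = 0)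
    (r a : ℝ) : ‖polar e f r a‖ = |r| := by
  have : ‖Real.cos a • e + Real.sin a • f‖ ^ 2 = 1 := by
    rw [norm_add_sq_real, norm_smul, norm_smul, he, hf, inner_smul_left, inner_smul_right, hef,
      Real.norm_eq_abs, Real.norm_eq_abs, mul_one, mul_one, sq_abs, sq_abs]
    simp
  rw [polar, norm_smul, (pow_eq_one_iff_of_nonneg (norm_nonneg _) two_ne_zero).1 this, mul_one,
    Real.norm_eq_abs]

theorem turn_polar {d : ℕ} {e f : E d} (he : ‖e‖ = 1) (hf : ‖f‖ = 1) (hef : inner ℝ e f = 0)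
    (φ r a : ℝ) : turn e f φ (polar e f r a) = polar e f r (a + φ) := by
  simp only [turn, polar, inner_smul_right, inner_add_right, hef, real_inner_comm e f,
    real_inner_self_eq_norm_sq, he, hf, Real.cos_add, Real.sin_add]
  module

theorem exists_polar {e f : E 2} (he : ‖e‖ = 1) (hf : ‖f‖ = 1) (hef : inner ℝ e f = 0) (v : E 2) :
    ∃ a, v = polar e f ‖v‖ a := by
  have ho : Orthonormal ℝ ![e, f] := by
    simp [orthonormal_vecCons_iff, he, hf, hef]
  let b := basisOfOrthonormalOfCardEqFinrank ho (by simp)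
  have hb : ⇑b = ![e, f] := coe_basisOfOrthonormalOfCardEqFinrank ho _
  have h := (b.toOrthonormalBasis (by rw [hb]; exact ho)).sum_repr' v
  simp only [Module.Basis.coe_toOrthonormalBasis, hb, Fin.sum_univ_two] at h
  simp only [Matrix.cons_val_zero, Matrix.cons_val_one] at h
  let c : ℂ := ⟨inner ℝ e v, inner ℝ f v⟩
  have hn : ‖c‖ = ‖v‖ := by
    have h2 : ‖c‖ ^ 2 = ‖v‖ ^ 2 := by
      rw [← Complex.normSq_eq_norm_sq, Complex.normSq_mk]
      conv_rhs => rw [← h]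
      rw [norm_add_sq_real, norm_smul, norm_smul, he, hf, inner_smul_left, inner_smul_right, hef,
        Real.norm_eq_abs, Real.norm_eq_abs, mul_one, mul_one, sq_abs, sq_abs]
      simp
      ring
    exact (pow_left_inj₀ (norm_nonneg _) (norm_nonneg _) two_ne_zero).1 h2
  refine ⟨c.arg, ?_⟩
  rw [polar, smul_add, smul_smul, smul_smul, ← hn, Complex.norm_mul_cos_arg,
    Complex.norm_mul_sin_arg]
  exact h.symm

end Polar

/-! ### The average is not rotation invariant on any open set -/

namespace OuterKeplerMap

section

variable {d : ℕ} {C : OuterKeplerMap d} {z : Coord (2 * d - 1)}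

theorem continuousAt_lap (hz : z ∈ C.domain) : ContinuousAt C.lap z := by
  have h3 : ‖(C.toFun z).2.2.2‖ ≠ 0 := norm_ne_zero_iff.2 (x₂_ne hz)
  have h : ContinuousAt (fun p : Phase d => ‖p.2.1‖ ^ 2 • p.2.2.2 -
      inner ℝ p.2.2.2 p.2.1 • p.2.1 - (C.mass / ‖p.2.2.2‖) • p.2.2.2) (C.toFun z) := by
    fun_prop (disch := exact h3)
  exact h.comp (f := C.toFun) (contDiffAt hz).continuousAt

theorem continuousAt_planeRot (hz : z ∈ C.domain) :
    ContinuousAt (fun w => planeRot (C.x₂ w) (C.y₂ w) (C.x₁ w)) z := by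
  have h : Continuous fun p : Phase d => planeRot p.2.2.2 p.2.1 p.2.2.1 := by
    unfold planeRot
    fun_prop
  exact h.continuousAt.comp (f := C.toFun) (contDiffAt hz).continuousAt

theorem continuousAt_inner_lap_planeRot (hz : z ∈ C.domain) :
    ContinuousAt (fun w => inner ℝ (C.lap w) (planeRot (C.x₂ w) (C.y₂ w) (C.x₁ w))) z :=
  (continuousAt_lap hz).inner (continuousAt_planeRot hz)

theorem inner_ne_zero_of_planeRot {e f : E d} {c : ℝ} (hd : 0 < d) (hz : z ∈ C.domain)
    (hrot : ∀ v, planeRot (C.x₂ z) (C.y₂ z) v = c • (inner ℝ e v • f - inner ℝ f v • e))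
    (h : inner ℝ (C.lap z) (planeRot (C.x₂ z) (C.y₂ z) (C.x₁ z)) ≠ 0) {s : ℝ}
    (hs : inner ℝ (C.x₂ (z.setAng s)) (C.y₂ (z.setAng s)) = 0) :
    inner ℝ e (C.orbit z s) ≠ 0 ∨ inner ℝ f (C.orbit z s) ≠ 0 := by
  by_contra hcon
  push Not at hcon
  obtain ⟨h1, h2⟩ := hcon
  have h3 := lap_eq_of_inner_eq_zero hd hz hs
  change _ = _ • C.orbit z s at h3
  rw [inner_planeRot, hrot, h3, inner_smul_right, inner_smul_right, h1, h2] at h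
  simp at h

theorem inner_periAngle_eq_zero (hd : 0 < d) (hz : z ∈ C.domain) :
    inner ℝ (C.x₂ (z.setAng (C.periAngle z))) (C.y₂ (z.setAng (C.periAngle z))) = 0 :=
  inner_eq_zero_of_isLocalExtr hd hz (Or.inl (Eventually.of_forall (norm_x₂_periAngle_le hd hz)))

variable (C) in
/-- The derivative of the averaged potential when the orbit is kept fixed and `x⁽¹⁾` rotates
in its plane. -/
def ringRot (z : Coord (2 * d - 1)) : ℝ :=
  fderiv ℝ (ringPotential (C.orbit z)) (C.x₁ z) (planeRot (C.x₂ z) (C.y₂ z) (C.x₁ z))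

theorem ringRot_eq (hd : 0 < d) (hz : z ∈ C.domain) :
    C.ringRot z = 1 / (2 * Real.pi) * ∫ s in (0 : ℝ)..(2 * Real.pi),
      -((‖C.x₁ z - C.x₂ (z.setAng s)‖ ^ 3)⁻¹ * inner ℝ (C.x₁ z - C.x₂ (z.setAng s))
        (planeRot (C.x₂ z) (C.y₂ z) (C.x₁ z))) :=
  fderiv_ringPotential_apply (continuous_orbit hd hz) (x₁_ne_orbit hd hz) _

/-- The ring itself varies with `z`, so continuity is read off from the integral formula, whose
integrand is jointly continuous. -/
theorem continuousAt_ringRot (hd : 0 < d) (hz : z ∈ C.domain) : ContinuousAt C.ringRot z := by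
  have hW : IsOpen {p : Coord (2 * d - 1) × ℝ | p.1 ∈ C.domain} :=
    C.isOpen_domain.preimage continuous_fst
  have hX : ContinuousOn (fun p : Coord (2 * d - 1) × ℝ => C.x₁ p.1 - C.x₂ (p.1.setAng p.2))
      {p | p.1 ∈ C.domain} := fun p hp =>
    (((differentiableAt_x₁ hp).continuousAt.comp continuousAt_fst).sub
      (ContinuousAt.comp (f := fun p : Coord (2 * d - 1) × ℝ => p.1.setAng p.2)
        (differentiableAt_x₂ (setAng_mem hp p.2)).continuousAt
        continuous_setAng.continuousAt)).continuousWithinAt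
  have hR : ContinuousOn (fun p : Coord (2 * d - 1) × ℝ =>
      planeRot (C.x₂ p.1) (C.y₂ p.1) (C.x₁ p.1)) {p | p.1 ∈ C.domain} := fun p hp =>
    (ContinuousAt.comp (f := Prod.fst) (g := fun w => planeRot (C.x₂ w) (C.y₂ w) (C.x₁ w))
      (continuousAt_planeRot hp) continuousAt_fst).continuousWithinAt
  have hI : ContinuousOn (fun p : Coord (2 * d - 1) × ℝ =>
      (‖C.x₁ p.1 - C.x₂ (p.1.setAng p.2)‖ ^ 3)⁻¹) {p | p.1 ∈ C.domain} :=
    ContinuousOn.inv₀ (hX.norm.pow 3) fun p hp => pow_ne_zero 3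
      (norm_ne_zero_iff.2 (sub_ne_zero.2 (x₁_ne_orbit hd hp p.2)))
  have hF : ContinuousOn (Function.uncurry fun z s => -((‖C.x₁ z - C.x₂ (z.setAng s)‖ ^ 3)⁻¹ *
      inner ℝ (C.x₁ z - C.x₂ (z.setAng s)) (planeRot (C.x₂ z) (C.y₂ z) (C.x₁ z))))
      {p | p.1 ∈ C.domain} :=
    (hI.mul (hX.inner hR)).neg
  have h := continuousAt_intervalIntegral_of_continuousOn hW hF
    (x₀ := z) (a := 0) (b := 2 * Real.pi) (fun s _ => hz)
  refine (h.const_mul (1 / (2 * Real.pi))).congr ?_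
  filter_upwards [C.isOpen_domain.mem_nhds hz] with w hw
  exact (ringRot_eq hd hw).symm

end

section Space

variable {C : OuterKeplerMap 3} {z : Coord (2 * 3 - 1)}

theorem inner_cross_self_left (x y : E 3) : inner ℝ (cross x y) x = 0 := by
  simp [cross, toSpace_three, cross_apply, PiLp.inner_apply, Fin.sum_univ_three]
  ring

theorem inner_cross_self_right (x y : E 3) : inner ℝ (cross x y) y = 0 := by
  simp [cross, toSpace_three, cross_apply, PiLp.inner_apply, Fin.sum_univ_three]
  ring

theorem not_eventually_inner_C₂_x₁ (hz : z ∈ C.domain) :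
    ¬ ∀ᶠ w in 𝓝 z, inner ℝ (C.C₂ w) (C.x₁ w) = 0 := by
  intro h
  have h1 : ∀ᶠ p in 𝓝 (C.toFun z), inner ℝ (cross p.2.2.2 p.2.1) p.2.2.1 = 0 := by
    filter_upwards [eventually_phase (by norm_num) hz h] with p ⟨w, h1, _, h2⟩
    rw [← h2]
    exact h1
  have h2 := eventually_derivative_eq_zero h1 (fun p => (0, 0, cross p.2.2.2 p.2.1, 0))
    (G := fun p => inner ℝ (cross p.2.2.2 p.2.1) (cross p.2.2.2 p.2.1)) (by
      refine Eventually.of_forall fun p => ?_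
      simp only [Prod.snd_add, Prod.fst_add, Prod.smul_snd, Prod.smul_fst, smul_zero, add_zero,
        inner_add_right, inner_smul_right]
      exact (((hasDerivAt_id (0 : ℝ)).mul_const _).const_add _).congr_deriv (one_mul _))
  have h3 := h2.self_of_nhds
  simp only [real_inner_self_eq_norm_sq] at h3
  rw [norm_cross_sq le_rfl] at h3
  exact (gsq_pos (by norm_num) hz).ne' h3

/-- For `x₁` off the orbital plane, the segment to the perihelion stays off that plane until its
end. Turning preserves the component along `C₂`, so the turned segment avoids the orbit before its
end as well. -/
theorem not_eventually_ringRot_space (hz : z ∈ C.domain) : ¬ ∀ᶠ w in 𝓝 z, C.ringRot w = 0 := by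
  intro h
  -- Two successive perturbations: `w₀` makes the orbit noncircular, and `w` moves `x₁` off the
  -- plane while continuity preserves the condition found at `w₀`.
  obtain ⟨w₀, h0, hw₀, hr₀⟩ := (not_eventually.1
    (not_eventually_inner_lap_planeRot (by norm_num) hz)).and_eventually
      (Eventually.and (C.isOpen_domain.mem_nhds hz) h.eventually_nhds) |>.exists
  obtain ⟨w, h1, hw, hr, h2⟩ := (not_eventually.1 (not_eventually_inner_C₂_x₁ hw₀)).and_eventually
      (Eventually.and (C.isOpen_domain.mem_nhds hw₀) (hr₀.eventually_nhds.and
        ((continuousAt_inner_lap_planeRot hw₀).eventually_ne h0))) |>.exists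
  obtain ⟨e, f, c, he, hf, hef, hc, hrot, horth, -⟩ :=
    exists_orthonormal_planeRot (gsq_pos (by norm_num) hw)
  have hp := inner_periAngle_eq_zero (by norm_num) hw
  have hA : C.lap w ≠ 0 := fun hA => h2 (by rw [hA, inner_zero_left])
  obtain ⟨hne, hnf⟩ := horth (C.C₂ w) (inner_cross_self_left _ _) (inner_cross_self_right _ _)
  have horb : ∀ s, inner ℝ (C.C₂ w) (C.orbit w s) = 0 := fun s => by
    rw [← C₂_setAng (by norm_num) hw s]
    exact inner_cross_self_left _ _
  refine false_of_ringPotential_turn (by norm_num) le_rfl hw hA he hf hef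
    (eventually_ringPotential_turn (by norm_num) le_rfl hw hr he hf hef hc hrot)
    (entirePath_line (C.x₁ w) (C.orbit w (C.periAngle w) - C.x₁ w)) (fun φ => ?_) (by simp)
    (by simp) hp (inner_ne_zero_of_planeRot (by norm_num) hw hrot h2 hp)
    (fun t _ ht φ s hs => ?_)
  · simp only [turn_add_smul]
    exact entirePath_line _ _
  · have h3 := congrArg (inner ℝ (C.C₂ w)) hs
    rw [inner_turn_of_orthogonal hne hnf, inner_add_right, inner_smul_right, inner_sub_right,
      horb, horb] at h3
    have h4 : (1 - t) * inner ℝ (C.C₂ w) (C.x₁ w) = 0 := by linarith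
    exact (mul_ne_zero (sub_ne_zero.2 ht.ne') h1) h4

end Space

section Plane

variable {C : OuterKeplerMap 2} {z : Coord (2 * 2 - 1)}

/-- If `‖x₁‖` is outside the range of radii of the orbit, a polar path with monotone radius leads to
the perihelion or to the aphelion. Turning keeps the radius, so turned paths meet no orbit point
before the end. Otherwise the circle through `x₁` meets the orbit. -/
theorem not_eventually_ringRot_plane (hz : z ∈ C.domain) : ¬ ∀ᶠ w in 𝓝 z, C.ringRot w = 0 := by
  intro h
  obtain ⟨w, h2, hw, hr⟩ := (not_eventually.1
    (not_eventually_inner_lap_planeRot (by norm_num) hz)).and_eventually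
      (Eventually.and (C.isOpen_domain.mem_nhds hz) h.eventually_nhds) |>.exists
  have hd : 0 < 2 := by norm_num
  have hd3 : 2 ≤ 3 := by norm_num
  obtain ⟨e, f, c, he, hf, hef, hc, hrot, -⟩ := exists_orthonormal_planeRot (gsq_pos hd hw)
  have hA : C.lap w ≠ 0 := fun hA => h2 (by rw [hA, inner_zero_left])
  have hturn := eventually_ringPotential_turn hd hd3 hw hr he hf hef hc hrot
  obtain ⟨a₀, ha₀⟩ := exists_polar he hf hef (C.x₁ w)
  have escape : ∀ s₀, inner ℝ (C.x₂ (w.setAng s₀)) (C.y₂ (w.setAng s₀)) = 0 →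
      (∀ t, 0 ≤ t → t < 1 → ∀ s,
        |‖C.x₁ w‖ + t * (‖C.orbit w s₀‖ - ‖C.x₁ w‖)| ≠ ‖C.orbit w s‖) → False := by
    intro s₀ hs₀ hoff
    obtain ⟨a₁, ha₁⟩ := exists_polar he hf hef (C.orbit w s₀)
    refine false_of_ringPotential_turn hd hd3 hw hA he hf hef hturn
      (γ := fun t => polar e f (‖C.x₁ w‖ + t * (‖C.orbit w s₀‖ - ‖C.x₁ w‖)) (a₀ + t * (a₁ - a₀)))
      (entirePath_polar e f _ _ _ _) (fun φ => ?_) (by simpa using ha₀.symm)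
      (by simpa using ha₁.symm) hs₀ (inner_ne_zero_of_planeRot hd hw hrot h2 hs₀)
      fun t h0 h1 φ s hs => hoff t h0 h1 s ?_
    · simp only [turn_polar he hf hef]
      convert entirePath_polar e f ‖C.x₁ w‖ (‖C.orbit w s₀‖ - ‖C.x₁ w‖) (a₀ + φ) (a₁ - a₀) using 2
      rw [polar, add_right_comm]
    · rw [← hs, norm_turn he hf hef, norm_polar he hf hef]
  obtain ⟨sM, hsM⟩ := exists_aphelion hd hw
  have hsm := norm_x₂_periAngle_le hd hw
  rcases lt_or_ge ‖C.x₁ w‖ ‖C.orbit w (C.periAngle w)‖ with hlt | hge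
  · refine escape _ (inner_periAngle_eq_zero hd hw) fun t h0 h1 s hs => ?_
    have h3 : ‖C.orbit w (C.periAngle w)‖ ≤ ‖C.orbit w s‖ := hsm s
    have h4 : 0 ≤ ‖C.x₁ w‖ + t * (‖C.orbit w (C.periAngle w)‖ - ‖C.x₁ w‖) :=
      add_nonneg (norm_nonneg _) (mul_nonneg h0 (sub_nonneg.2 hlt.le))
    rw [abs_of_nonneg h4] at hs
    nlinarith [mul_pos (sub_pos.2 h1) (sub_pos.2 hlt)]
  rcases lt_or_ge ‖C.orbit w sM‖ ‖C.x₁ w‖ with hgt | hle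
  · refine escape sM (inner_eq_zero_of_isLocalExtr hd hw (Or.inr (Eventually.of_forall hsM)))
      fun t h0 h1 s hs => ?_
    have h3 : ‖C.orbit w s‖ ≤ ‖C.orbit w sM‖ := hsM s
    have h4 : 0 ≤ ‖C.x₁ w‖ + t * (‖C.orbit w sM‖ - ‖C.x₁ w‖) := by
      nlinarith [norm_nonneg (C.orbit w sM), norm_nonneg (C.x₁ w)]
    rw [abs_of_nonneg h4] at hs
    nlinarith [mul_pos (sub_pos.2 h1) (sub_pos.2 hgt)]
  -- An orbit point has the radius of `x₁`. Local rotation invariance makes the potential constant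
  -- along a short arc of this circle, so the comparison function is a constant; yet continuing the
  -- arc reaches the orbit.
  · obtain ⟨s₀, hs₀⟩ := mem_range_of_exists_le_of_exists_ge (continuous_orbit hd hw).norm
      ⟨_, hge⟩ ⟨_, hle⟩
    replace hs₀ : ‖C.orbit w s₀‖ = ‖C.x₁ w‖ := hs₀
    obtain ⟨a₁, ha₁⟩ := exists_polar he hf hef (C.orbit w s₀)
    obtain ⟨K, hK, hL⟩ := lipschitz_x₂ hd hd3 hw
    refine not_analytic_continuation_ringPotential_sq (continuous_orbit hd hw) (periodic_x₂ hw) hK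
      hL (entirePath_polar e f ‖C.x₁ w‖ 0 a₀ (a₁ - a₀))
      (b := fun _ => ringPotential (C.orbit w) (C.x₁ w) ^ 2) (fun t _ => analyticAt_const) ?_ ?_
      (s₁ := s₀) ?_
    · have hc : ContinuousAt (fun t : ℝ => ((t * (a₁ - a₀), C.x₁ w) : ℝ × E 2)) 0 := by fun_prop
      have h3 := hc.eventually (by simpa using hturn)
      filter_upwards [h3] with t ht
      rw [← ht, mul_zero, add_zero]
      conv_rhs => rw [ha₀, turn_polar he hf hef]
      rfl
    · intro s
      have h4 := x₁_ne_orbit hd hw s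
      rw [ha₀] at h4
      simpa [polar] using h4
    · rw [ha₁, hs₀]
      simp [polar]

end Plane

end OuterKeplerMap

/-! ### Linear independence of the differentials -/

/-- The set where both `κ₁` and `κ₂` are nonzero is open by continuity. It is dense because `κ₁` can
be made nonzero by a small displacement, and `κ₂` by a further one small enough to preserve this. -/
theorem functionallyIndependent_of_ne_zero {n k : ℕ} {D : Set (Coord n)} (hD : IsOpen D)
    {F : Fin k → Coord n → ℝ} {κ₁ κ₂ : Coord n → ℝ} (hc₁ : ∀ z ∈ D, ContinuousAt κ₁ z)
    (hc₂ : ∀ z ∈ D, ContinuousAt κ₂ z) (hn₁ : ∀ z ∈ D, ¬ ∀ᶠ w in 𝓝 z, κ₁ w = 0)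
    (hn₂ : ∀ z ∈ D, ¬ ∀ᶠ w in 𝓝 z, κ₂ w = 0)
    (hF : ∀ z ∈ D, κ₁ z ≠ 0 → κ₂ z ≠ 0 → (∀ i, DifferentiableAt ℝ (F i) z) ∧
      LinearIndependent ℝ (fun i => fderiv ℝ (F i) z)) : FunctionallyIndependent D F := by
  refine ⟨{z | z ∈ D ∧ κ₁ z ≠ 0 ∧ κ₂ z ≠ 0}, ?_, fun z hz => hz.1, fun z hz => ?_,
    fun z hz => hF z hz.1 hz.2.1 hz.2.2⟩
  · refine isOpen_iff_mem_nhds.2 fun z hz => ?_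
    filter_upwards [hD.mem_nhds hz.1, (hc₁ z hz.1).eventually_ne hz.2.1,
      (hc₂ z hz.1).eventually_ne hz.2.2] with w h1 h2 h3
    exact ⟨h1, h2, h3⟩
  · refine mem_closure_iff_frequently.2 fun h => ?_
    obtain ⟨w, h1, hw, h2⟩ := (not_eventually.1 (hn₁ z hz)).and_eventually
      (Eventually.and (hD.mem_nhds hz) h.eventually_nhds) |>.exists
    refine hn₂ w hw ?_
    filter_upwards [hD.mem_nhds hw, (hc₁ w hw).eventually_ne h1, h2] with w' h3 h4 h5
    by_contra h6
    exact h5 ⟨h3, h4, h6⟩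

namespace OuterKeplerMap

section

variable {d : ℕ} {C : OuterKeplerMap d} {z : Coord (2 * d - 1)}

/-- Variations of the inner body leave the outer energy, hence `Λ₂`, unchanged. These are the test
directions for independence. -/
theorem exists_fderiv_eq (hd : 0 < d) (hz : z ∈ C.domain) (u w : E d) :
    ∃ ξ, fderiv ℝ C.toFun z ξ = (u, 0, w, 0) ∧ ξ.mom = 0 := by
  obtain ⟨ξ, hξ⟩ := (bijective_fderiv hd hz).2 (u, 0, w, 0)
  refine ⟨ξ, hξ, ?_⟩
  have h := fderiv_kepler hz ξ
  have h1 : C.mass ^ 2 / z.mom ^ 3 ≠ 0 :=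
    (div_pos (pow_pos mass_pos 2) (pow_pos (mom_pos hz) 3)).ne'
  rw [hξ] at h
  simp only [inner_zero_right, mul_zero, add_zero] at h
  exact (mul_eq_zero.1 h.symm).resolve_left h1

theorem differentiableAt_G (hz : z ∈ C.domain) (h : C.Ctot z ≠ 0) : DifferentiableAt ℝ C.G z :=
  (differentiableAt_Ctot hz).norm ℝ h

theorem differentiableAt_r₁ (hz : z ∈ C.domain) : DifferentiableAt ℝ C.r₁ z :=
  (differentiableAt_x₁ hz).norm ℝ (x₁_ne hz)

theorem differentiableAt_L₂ : DifferentiableAt ℝ C.L₂ z := differentiableAt_fst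

theorem fderiv_calG_of_inner (hd : 0 < d) (hd3 : d ≤ 3) (hz : z ∈ C.domain)
    (hpos : 0 < C.calGSq z) {ξ : Coord (2 * d - 1)} {u w : E d}
    (h : fderiv ℝ C.toFun z ξ = (u, 0, w, 0)) :
    fderiv ℝ C.calG z ξ = -(1 / (2 * Real.sqrt (C.calGSq z))) * inner ℝ (C.lap z) w := by
  rw [fderiv_calG hd hd3 hz hpos, smul_apply, fderiv_calGSq hd hd3 hz, h, smul_eq_mul]
  simp only [dCalGSq, lap, inner_sub_left, real_inner_smul_left, inner_zero_left, inner_zero_right]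
  ring

theorem phaseForm_rotField (n : E 3) (u w : E d) :
    phaseForm (C.rotField n z) (u, 0, w, 0) =
      inner ℝ u (rot n (C.x₁ z)) - inner ℝ (rot n (C.y₁ z)) w := by
  simp [phaseForm, rotField]
  ring

end

section Plane

variable {C : OuterKeplerMap 2} {z : Coord (2 * 2 - 1)}

theorem inner_rot_rot_plane (n : E 3) (x : E 2) :
    inner ℝ (rot (EuclideanSpace.single 2 1) x) (rot n x) = n 2 * ‖x‖ ^ 2 := by
  simp [rot, toSpace, cross_apply, PiLp.inner_apply, EuclideanSpace.norm_sq_eq]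
  ring

theorem cross_rot_plane (x : E 2) : cross x (rot (EuclideanSpace.single 2 1) x) 2 = ‖x‖ ^ 2 := by
  simp [cross, rot, toSpace, cross_apply, EuclideanSpace.norm_sq_eq]
  ring

theorem continuousAt_Z {d : ℕ} {C : OuterKeplerMap d} {z : Coord (2 * d - 1)} (hz : z ∈ C.domain) :
    ContinuousAt C.Z z := by
  have h : Continuous fun c : E 3 => c 2 := by fun_prop
  exact h.continuousAt.comp (f := C.Ctot) (differentiableAt_Ctot hz).continuousAt

/-- Varying `y₁` along the quarter turn of `x₁` changes `Z` at rate `‖x₁‖²`. -/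
theorem not_eventually_Z_plane (hz : z ∈ C.domain) : ¬ ∀ᶠ w in 𝓝 z, C.Z w = 0 := by
  intro h
  have h1 : ∀ᶠ p in 𝓝 (C.toFun z), (cross p.2.2.1 p.1 + cross p.2.2.2 p.2.1) 2 = 0 := by
    filter_upwards [eventually_phase (by norm_num) hz h] with p ⟨w, h1, _, h2⟩
    rw [← h2]
    exact h1
  have h2 := eventually_derivative_eq_zero h1
    (fun p => (rot (EuclideanSpace.single 2 1) p.2.2.1, 0, 0, 0)) (G := fun p => ‖p.2.2.1‖ ^ 2) (by
      refine Eventually.of_forall fun p => ?_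
      have : ∀ t : ℝ, (cross p.2.2.1 (p.1 + t • rot (EuclideanSpace.single 2 1) p.2.2.1) +
          cross p.2.2.2 p.2.1) 2 = (cross p.2.2.1 p.1 + cross p.2.2.2 p.2.1) 2 +
            t * ‖p.2.2.1‖ ^ 2 := fun t => by
        rw [cross_add_right, cross_smul_right, ← cross_rot_plane]
        simp only [PiLp.add_apply, PiLp.smul_apply, smul_eq_mul]
        ring
      simp only [Prod.snd_add, Prod.fst_add, Prod.smul_snd, Prod.smul_fst, smul_zero, add_zero, this]
      exact (((hasDerivAt_id (0 : ℝ)).mul_const _).const_add _).congr_deriv (one_mul _))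
  have h3 := h2.self_of_nhds
  exact norm_ne_zero_iff.2 (x₁_ne hz) (pow_eq_zero_iff two_ne_zero |>.1 h3)

/-- The coefficients are isolated one by one. Varying `y₁` along the quarter turn of `x₁` sees only
`G`; rotating `x₁` leaves `r₁` fixed and sees `h`; the radial direction sees `r₁`; and `∂/∂Λ₂`
serves for the last coefficient. -/
theorem linearIndependent_planar (hz : z ∈ C.domain) {h : Coord (2 * 2 - 1) → ℝ} {L : E 2 → ℝ}
    (hL : ∀ ξ u w, fderiv ℝ C.toFun z ξ = (u, 0, w, 0) → fderiv ℝ h z ξ = L w)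
    (h1 : L (planeRot (C.x₂ z) (C.y₂ z) (C.x₁ z)) ≠ 0) (h2 : C.Z z ≠ 0) :
    LinearIndependent ℝ fun i => fderiv ℝ
      ((Fin.cons h (planarIntegrals C) : Fin (2 * 2 - 1 + 1) → Coord (2 * 2 - 1) → ℝ) i) z := by
  have hd : 0 < 2 := by norm_num
  have hr : 0 < ‖C.x₁ z‖ := norm_pos_iff.2 (x₁_ne hz)
  have hC : ‖C.Ctot z‖ ≠ 0 := norm_ne_zero_iff.2 fun h => h2 (by rw [Z, h]; rfl)
  have hL0 : L 0 = 0 := by rw [← hL 0 0 0 (by simp; rfl), map_zero]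
  refine Fintype.linearIndependent_iff.2 fun g hg => ?_
  have key : ∀ ξ, g 0 * fderiv ℝ h z ξ + g 1 * fderiv ℝ C.G z ξ + g 2 * fderiv ℝ C.L₂ z ξ +
      g 3 * fderiv ℝ C.r₁ z ξ = 0 := by
    intro ξ
    have hs : (∑ i : Fin 4, g i • fderiv ℝ ((Fin.cons h (planarIntegrals C) :
        Fin (2 * 2 - 1 + 1) → Coord (2 * 2 - 1) → ℝ) i) z) ξ = 0 := by
      rw [show _ = _ from hg]; rfl
    rw [Fin.sum_univ_four] at hs
    exact hs
  have key' : ∀ u w, g 0 * L w + g 1 * (inner ℝ u (rot (‖C.Ctot z‖⁻¹ • C.Ctot z) (C.x₁ z)) -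
      inner ℝ (rot (‖C.Ctot z‖⁻¹ • C.Ctot z) (C.y₁ z)) w) +
      g 3 * (inner ℝ (C.x₁ z) w / ‖C.x₁ z‖) = 0 := by
    intro u w
    obtain ⟨ξ, hξ, hm⟩ := exists_fderiv_eq hd hz u w
    have := key ξ
    rwa [hL ξ u w hξ, fderiv_G (by norm_num) hz, fderiv_L₂, fderiv_r₁ hz, hξ, hm, mul_zero,
      add_zero, phaseForm_rotField] at this
  have g1 : g 1 = 0 := by
    have := key' (rot (EuclideanSpace.single 2 1) (C.x₁ z)) 0
    rw [hL0, inner_rot_rot_plane] at this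
    change _ + _ * (‖C.Ctot z‖⁻¹ * C.Z z * _ - _) + _ = _ at this
    simpa [hC, h2, hr.ne'] using this
  have g0 : g 0 = 0 := by
    have := key' 0 (planeRot (C.x₂ z) (C.y₂ z) (C.x₁ z))
    rw [inner_planeRot_self, g1] at this
    simpa [h1] using this
  have g3 : g 3 = 0 := by
    have := key' 0 (C.x₁ z)
    rw [g0, g1, real_inner_self_eq_norm_sq] at this
    simpa [hr.ne'] using this
  have g2 : g 2 = 0 := by
    have := key (1, 0, 0, 0)
    rw [g0, g1, g3, fderiv_L₂] at this
    simpa [Coord.mom] using this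
  intro i
  change Fin 4 at i
  fin_cases i
  · exact g0
  · exact g1
  · exact g2
  · exact g3

theorem functionallyIndependent_planar {h κ : Coord (2 * 2 - 1) → ℝ}
    {L : Coord (2 * 2 - 1) → E 2 → ℝ} (hh : ∀ z ∈ C.domain, DifferentiableAt ℝ h z)
    (hL : ∀ z ∈ C.domain, ∀ ξ u w, fderiv ℝ C.toFun z ξ = (u, 0, w, 0) → fderiv ℝ h z ξ = L z w)
    (hκ : ∀ z ∈ C.domain, κ z ≠ 0 → L z (planeRot (C.x₂ z) (C.y₂ z) (C.x₁ z)) ≠ 0)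
    (hκc : ∀ z ∈ C.domain, ContinuousAt κ z) (hκn : ∀ z ∈ C.domain, ¬ ∀ᶠ w in 𝓝 z, κ w = 0) :
    FunctionallyIndependent C.domain
      (Fin.cons h (planarIntegrals C) : Fin (2 * 2 - 1 + 1) → Coord (2 * 2 - 1) → ℝ) := by
  refine functionallyIndependent_of_ne_zero C.isOpen_domain hκc (κ₂ := C.Z)
    (fun z hz => continuousAt_Z hz) hκn (fun z hz => not_eventually_Z_plane hz)
    fun z hz h1 h2 => ⟨fun i => ?_, linearIndependent_planar hz (hL z hz) (hκ z hz h1) h2⟩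
  change Fin 4 at i
  fin_cases i
  · exact hh z hz
  · exact differentiableAt_G hz fun h => h2 (by rw [Z, h]; rfl)
  · exact differentiableAt_L₂ (C := C)
  · exact differentiableAt_r₁ hz

end Plane

section Space

variable {C : OuterKeplerMap 3} {z : Coord (2 * 3 - 1)}

variable (C) in
/-- The determinant `C · (k × x⁽¹⁾)`, where `k` is the third basis vector. -/
def vertDet (z : Coord (2 * 3 - 1)) : ℝ :=
  inner ℝ (C.Ctot z) (cross (EuclideanSpace.single 2 1) (C.x₁ z))

theorem continuousAt_vertDet (hz : z ∈ C.domain) : ContinuousAt C.vertDet z :=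
  (differentiableAt_Ctot hz).continuousAt.inner
    (differentiableAt_cross (differentiableAt_const _) (differentiableAt_x₁ hz)).continuousAt

/-- Varying `y₁` along `k` produces `-‖k × x₁‖²`. Its vanishing on an open set would give `k × x₁ =
0` there, which fails on moving `x₁` along the first basis vector. -/
theorem not_eventually_vertDet (hz : z ∈ C.domain) : ¬ ∀ᶠ w in 𝓝 z, C.vertDet w = 0 := by
  intro h
  set k : E 3 := EuclideanSpace.single 2 1 with hk
  have h1 : ∀ᶠ p in 𝓝 (C.toFun z),
      inner ℝ (cross p.2.2.1 p.1 + cross p.2.2.2 p.2.1) (cross k p.2.2.1) = 0 := by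
    filter_upwards [eventually_phase (by norm_num) hz h] with p ⟨w, h1, _, h2⟩
    rw [← h2]
    exact h1
  have h2 := eventually_derivative_eq_zero h1 (fun p => (k, 0, 0, 0))
    (G := fun p => inner ℝ (cross p.2.2.1 k) (cross k p.2.2.1)) (by
      refine Eventually.of_forall fun p => ?_
      simp only [Prod.snd_add, Prod.fst_add, Prod.smul_snd, Prod.smul_fst, smul_zero, add_zero,
        cross_add_right, cross_smul_right, add_right_comm _ (_ • _), inner_add_left _ (_ • _),
        real_inner_smul_left]
      exact (((hasDerivAt_id (0 : ℝ)).mul_const _).const_add _).congr_deriv (one_mul _))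
  have h3 : ∀ᶠ p in 𝓝 (C.toFun z), cross k p.2.2.1 = 0 := by
    filter_upwards [h2] with p hp
    have : cross p.2.2.1 k = -cross k p.2.2.1 := by
      simp only [cross]
      rw [← cross_anticomm]
      rfl
    rw [this, inner_neg_left, neg_eq_zero] at hp
    exact inner_self_eq_zero.1 hp
  have h4 := eventually_derivative_eq_zero h3 (fun p => (0, 0, EuclideanSpace.single 0 1, 0))
    (G := fun p => cross k (EuclideanSpace.single 0 1)) (by
      refine Eventually.of_forall fun p => ?_
      simp only [Prod.snd_add, Prod.fst_add, Prod.smul_snd, Prod.smul_fst,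
        cross_add_right, cross_smul_right]
      exact (((hasDerivAt_id (0 : ℝ)).smul_const _).const_add _).congr_deriv (one_smul _ _))
  have h5 := congrArg (fun v : E 3 => v 1) h4.self_of_nhds
  simp [hk, cross, toSpace_three, cross_apply] at h5

theorem planeRot_three (x y v : E 3) : planeRot x y v = cross (cross x y) v := by
  ext i
  fin_cases i <;>
    simp [planeRot, cross, toSpace_three, cross_apply, PiLp.inner_apply, Fin.sum_univ_three] <;> ring

/-- Varying `y₁` along `C` annihilates `dG` and sees `Z`, and along `k` it annihilates `dZ` and sees
`G`; both pairings are nonzero multiples of `vertDet`. Rotating `x₁` along `C₂ × x₁`, orthogonal to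
`x₁` and to `C₂`, annihilates the differentials of `r₁` and `Θ` and isolates `h`. These two are
separated by the directions `x₁` and `C₂`. -/
theorem linearIndependent_spatial (hz : z ∈ C.domain) {h : Coord (2 * 3 - 1) → ℝ} {L : E 3 → ℝ}
    (hL : ∀ ξ u w, fderiv ℝ C.toFun z ξ = (u, 0, w, 0) → fderiv ℝ h z ξ = L w)
    (h1 : L (planeRot (C.x₂ z) (C.y₂ z) (C.x₁ z)) ≠ 0) (h2 : C.vertDet z ≠ 0) :
    LinearIndependent ℝ fun i => fderiv ℝ
      ((Fin.cons h (spatialIntegrals C) : Fin (2 * 3 - 1 + 1) → Coord (2 * 3 - 1) → ℝ) i) z := by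
  have hd : 0 < 3 := by norm_num
  have hr : 0 < ‖C.x₁ z‖ := norm_pos_iff.2 (x₁_ne hz)
  have hC : ‖C.Ctot z‖ ≠ 0 := norm_ne_zero_iff.2 fun h => h2 (by rw [vertDet, h, inner_zero_left])
  have hL0 : L 0 = 0 := by rw [← hL 0 0 0 (by simp; rfl), map_zero]
  set k : E 3 := EuclideanSpace.single 2 1 with hk
  set n : E 3 := ‖C.Ctot z‖⁻¹ • C.Ctot z with hn
  refine Fintype.linearIndependent_iff.2 fun g hg => ?_
  have key : ∀ ξ, g 0 * fderiv ℝ h z ξ + g 1 * fderiv ℝ C.G z ξ + g 2 * fderiv ℝ C.Z z ξ +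
      g 3 * fderiv ℝ C.L₂ z ξ + g 4 * fderiv ℝ C.r₁ z ξ + g 5 * fderiv ℝ C.Theta z ξ = 0 := by
    intro ξ
    have hs : (∑ i : Fin 6, g i • fderiv ℝ ((Fin.cons h (spatialIntegrals C) :
        Fin (2 * 3 - 1 + 1) → Coord (2 * 3 - 1) → ℝ) i) z) ξ = 0 := by
      rw [show _ = _ from hg]; rfl
    rw [Fin.sum_univ_six] at hs
    exact hs
  have key' : ∀ u w, g 0 * L w +
      g 1 * (inner ℝ u (rot n (C.x₁ z)) - inner ℝ (rot n (C.y₁ z)) w) +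
      g 2 * (inner ℝ u (rot k (C.x₁ z)) - inner ℝ (rot k (C.y₁ z)) w) +
      g 4 * (inner ℝ (C.x₁ z) w / ‖C.x₁ z‖) +
      g 5 * (inner ℝ (C.C₂ z) w / ‖C.x₁ z‖ -
        inner ℝ (C.C₂ z) (C.x₁ z) * inner ℝ (C.x₁ z) w / ‖C.x₁ z‖ ^ 3) = 0 := by
    intro u w
    obtain ⟨ξ, hξ, hm⟩ := exists_fderiv_eq hd hz u w
    have hT : dTheta (C.x₂ z) (C.y₂ z) (C.x₁ z) 0 0 w = inner ℝ (C.C₂ z) w / ‖C.x₁ z‖ -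
        inner ℝ (C.C₂ z) (C.x₁ z) * inner ℝ (C.x₁ z) w / ‖C.x₁ z‖ ^ 3 := by
      have h0 : ∀ x : E 3, cross x 0 = 0 ∧ cross 0 x = 0 := fun x => by
        rw [← zero_smul ℝ (0 : E 3), cross_smul_left, cross_smul_right, zero_smul]
        simp
      rw [dTheta, (h0 _).1, (h0 _).2]
      simp [C₂]
    have := key ξ
    rwa [hL ξ u w hξ, fderiv_G le_rfl hz, fderiv_L₂, fderiv_r₁ hz, fderiv_Z hz, fderiv_Theta hz, hξ,
      hm, mul_zero, add_zero, phaseForm_rotField, phaseForm_rotField, hT] at this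
  have hrn : ∀ u, inner ℝ u (rot n (C.x₁ z)) =
      ‖C.Ctot z‖⁻¹ * inner ℝ u (cross (C.Ctot z) (C.x₁ z)) := fun u => by
    rw [rot_three, hn, cross_smul_left, inner_smul_right]
  have hcc : ∀ a b x : E 3, inner ℝ a (cross b x) = -inner ℝ b (cross a x) := fun a b x => by
    simp [cross, toSpace_three, cross_apply, PiLp.inner_apply, Fin.sum_univ_three]
    ring
  have hself : ∀ a x : E 3, inner ℝ a (cross a x) = 0 := fun a x => by linarith [hcc a a x]
  have g2 : g 2 = 0 := by
    have := key' (C.Ctot z) 0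
    rw [hL0, hrn, hself, rot_three] at this
    simp only [inner_zero_right, mul_zero, zero_div, sub_zero, zero_add, add_zero] at this
    exact (mul_eq_zero.1 this).resolve_right h2
  have g1 : g 1 = 0 := by
    have := key' k 0
    rw [hL0, hrn, hcc, g2] at this
    simp only [inner_zero_right, mul_zero, zero_div, sub_zero, zero_add, add_zero, zero_mul] at this
    have h3 : ‖C.Ctot z‖⁻¹ * -C.vertDet z ≠ 0 := mul_ne_zero (inv_ne_zero hC) (neg_ne_zero.2 h2)
    exact (mul_eq_zero.1 this).resolve_right h3
  have g0 : g 0 = 0 := by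
    have := key' 0 (planeRot (C.x₂ z) (C.y₂ z) (C.x₁ z))
    have h3 : inner ℝ (C.C₂ z) (planeRot (C.x₂ z) (C.y₂ z) (C.x₁ z)) = 0 := by
      rw [planeRot_three]
      exact hself _ _
    rw [inner_planeRot_self, h3, g1, g2] at this
    simpa [h1] using this
  have g5 : g 5 = 0 := by
    have h3 := key' 0 (C.x₁ z)
    have h4 := key' 0 (C.C₂ z)
    -- The Gram determinant of `C₂` and `x₁` is `‖C₂ × x₁‖²`, and this vector is nonzero because `L`
    -- does not vanish on it.
    have h5 : ‖C.C₂ z‖ ^ 2 * ‖C.x₁ z‖ ^ 2 - inner ℝ (C.C₂ z) (C.x₁ z) ^ 2 ≠ 0 := by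
      rw [← norm_cross_sq le_rfl, C₂, ← planeRot_three]
      refine pow_ne_zero 2 (norm_ne_zero_iff.2 fun h0 => h1 ?_)
      rw [h0, hL0]
    have h6 : g 4 = 0 := by
      rw [g0, g1, g2, real_inner_self_eq_norm_sq] at h3
      -- `Θ` is homogeneous of degree zero in `x₁`, so its radial derivative vanishes.
      have h7 : inner ℝ (C.C₂ z) (C.x₁ z) / ‖C.x₁ z‖ -
          inner ℝ (C.C₂ z) (C.x₁ z) * ‖C.x₁ z‖ ^ 2 / ‖C.x₁ z‖ ^ 3 = 0 := by
        field_simp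
        ring
      rw [h7] at h3
      simpa [hr.ne'] using h3
    rw [g0, g1, g2, h6, real_inner_self_eq_norm_sq, real_inner_comm (C.C₂ z) (C.x₁ z)] at h4
    simp only [zero_mul, zero_add, mul_eq_zero] at h4
    refine h4.resolve_right fun h8 => h5 ?_
    field_simp at h8
    linarith
  have g4 : g 4 = 0 := by
    have := key' 0 (C.x₁ z)
    rw [g0, g1, g2, g5, real_inner_self_eq_norm_sq] at this
    simpa [hr.ne'] using this
  have g3 : g 3 = 0 := by
    have := key (1, 0, 0, 0)
    rw [g0, g1, g2, g4, g5, fderiv_L₂] at this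
    simpa [Coord.mom] using this
  intro i
  change Fin 6 at i
  fin_cases i
  · exact g0
  · exact g1
  · exact g2
  · exact g3
  · exact g4
  · exact g5

theorem functionallyIndependent_spatial {h κ : Coord (2 * 3 - 1) → ℝ}
    {L : Coord (2 * 3 - 1) → E 3 → ℝ} (hh : ∀ z ∈ C.domain, DifferentiableAt ℝ h z)
    (hL : ∀ z ∈ C.domain, ∀ ξ u w, fderiv ℝ C.toFun z ξ = (u, 0, w, 0) → fderiv ℝ h z ξ = L z w)
    (hκ : ∀ z ∈ C.domain, κ z ≠ 0 → L z (planeRot (C.x₂ z) (C.y₂ z) (C.x₁ z)) ≠ 0)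
    (hκc : ∀ z ∈ C.domain, ContinuousAt κ z) (hκn : ∀ z ∈ C.domain, ¬ ∀ᶠ w in 𝓝 z, κ w = 0) :
    FunctionallyIndependent C.domain
      (Fin.cons h (spatialIntegrals C) : Fin (2 * 3 - 1 + 1) → Coord (2 * 3 - 1) → ℝ) := by
  refine functionallyIndependent_of_ne_zero C.isOpen_domain hκc (κ₂ := C.vertDet)
    (fun z hz => continuousAt_vertDet hz) hκn (fun z hz => not_eventually_vertDet hz)
    fun z hz h1 h2 => ⟨fun i => ?_, linearIndependent_spatial hz (hL z hz) (hκ z hz h1) h2⟩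
  change Fin 6 at i
  fin_cases i
  · exact hh z hz
  · exact differentiableAt_G hz fun h => h2 (by rw [vertDet, h, inner_zero_left])
  · exact differentiableAt_euclidean.1 (differentiableAt_Ctot hz) 2
  · exact differentiableAt_L₂ (C := C)
  · exact differentiableAt_r₁ hz
  · exact differentiableAt_Theta hz

end Space

end OuterKeplerMap
-- Assembly of the brackets and of the independence statements
namespace OuterKeplerMap

section

variable {d : ℕ} {C : OuterKeplerMap d} {z : Coord (2 * d - 1)}

theorem avgPotential_setAng (z : Coord (2 * d - 1)) (s : ℝ) :
    C.avgPotential (z.setAng s) = C.avgPotential z := rfl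

theorem calG_setAng (hd : 0 < d) (hd3 : d ≤ 3) (hz : z ∈ C.domain) (s : ℝ) :
    C.calG (z.setAng s) = C.calG z := by
  rw [calG, calG, calGSq_setAng hd hd3 hz]

theorem poisson_symm_zero {n : ℕ} {f g : Coord n → ℝ} {z : Coord n} (h : poisson f g z = 0) :
    poisson g f z = 0 := by
  rw [poisson_antisymm, h, neg_zero]

theorem poisson_avgPotential_L₂ (hz : z ∈ C.domain) : poisson C.avgPotential C.L₂ z = 0 :=
  poisson_L₂ (fun w _ s => avgPotential_setAng w s) hz

theorem poisson_avgPotential_G (hd : 0 < d) (hd3 : d ≤ 3) (hz : z ∈ C.domain) :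
    poisson C.avgPotential C.G z = 0 :=
  poisson_avgPotential_eq_zero (fun _ hw => G_setAng hd hw)
    (fun _ hw => poisson_pot_of_rotField hd hd3 hw (fderiv_G hd3 hw)) hz

theorem poisson_avgPotential_r₁ (hd : 0 < d) (hz : z ∈ C.domain) :
    poisson C.avgPotential C.r₁ z = 0 :=
  poisson_avgPotential_eq_zero (fun _ hw => r₁_setAng hd hw) (fun _ hw => poisson_pot_r₁ hd hw) hz

theorem poisson_calG_L₂ (hd : 0 < d) (hd3 : d ≤ 3) (hz : z ∈ C.domain) :
    poisson C.calG C.L₂ z = 0 :=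
  poisson_L₂ (fun _ hw => calG_setAng hd hd3 hw) hz

theorem poisson_calG_G (hd : 0 < d) (hd3 : d ≤ 3) (hz : z ∈ C.domain) (hpos : 0 < C.calGSq z) :
    poisson C.calG C.G z = 0 := by
  rw [poisson_calG hd hd3 hz hpos, poisson_calGSq_of_rotField hd hd3 hz (fderiv_G hd3 hz), mul_zero]

theorem poisson_calG_r₁ (hd : 0 < d) (hd3 : d ≤ 3) (hz : z ∈ C.domain) (hpos : 0 < C.calGSq z) :
    poisson C.calG C.r₁ z = 0 := by
  rw [poisson_calG hd hd3 hz hpos, poisson_calGSq_r₁ hd hd3 hz, mul_zero]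

theorem poisson_G_L₂ (hd : 0 < d) (hz : z ∈ C.domain) : poisson C.G C.L₂ z = 0 :=
  poisson_L₂ (fun _ hw => G_setAng hd hw) hz

theorem poisson_r₁_L₂ (hd : 0 < d) (hz : z ∈ C.domain) : poisson C.r₁ C.L₂ z = 0 :=
  poisson_L₂ (fun _ hw => r₁_setAng hd hw) hz

theorem poisson_r₁_G (hd : 0 < d) (hd3 : d ≤ 3) (hz : z ∈ C.domain) : poisson C.r₁ C.G z = 0 :=
  poisson_r₁_of_rotField hd hd3 hz (fderiv_G hd3 hz)

theorem neg_inv_sqrt_calGSq_mul_ne_zero (hpos : 0 < C.calGSq z) {a : ℝ} (ha : a ≠ 0) :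
    -(1 / (2 * Real.sqrt (C.calGSq z))) * a ≠ 0 :=
  mul_ne_zero (neg_ne_zero.2 (by positivity)) ha

end

theorem inSigma_planar (C : OuterKeplerMap 2) (hpos : ∀ z ∈ C.domain, 0 < C.calGSq z) :
    InSigma C.domain C.avgPotential (planarIntegrals C) C.calG := by
  have hd : 0 < 2 := by norm_num
  have hd3 : 2 ≤ 3 := by norm_num
  have hh : ∀ z ∈ C.domain, DifferentiableAt ℝ C.avgPotential z := fun z hz =>
    (hasFDerivAt_avgPotential hz).differentiableAt
  have hg : ∀ z ∈ C.domain, DifferentiableAt ℝ C.calG z := fun z hz =>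
    differentiableAt_calG hd hd3 hz (hpos z hz)
  refine ⟨hh, fun i z hz => ?_, fun i j z hz => ?_, ?_, hg,
    fun z hz => poisson_avgPotential_calG hd hd3 hz (hpos z hz), fun i z hz => ?_, ?_,
    exists_ne_ham hd hd3 hpos⟩
  · change Fin 3 at i
    fin_cases i
    · exact poisson_avgPotential_G hd hd3 hz
    · exact poisson_avgPotential_L₂ hz
    · exact poisson_avgPotential_r₁ hd hz
  · change Fin 3 at i j
    have h1 := poisson_G_L₂ hd hz
    have h2 := poisson_r₁_L₂ hd hz
    have h3 := poisson_r₁_G hd hd3 hz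
    fin_cases i <;> fin_cases j <;>
      first
        | exact poisson_self _ z | exact h1 | exact h2 | exact h3 | exact poisson_symm_zero h1
        | exact poisson_symm_zero h2 | exact poisson_symm_zero h3
  · exact functionallyIndependent_planar hh
      (fun z hz _ _ _ h => fderiv_avgPotential_of_inner hd hd3 hz h) (κ := C.ringRot)
      (fun _ _ h => h) (fun _ hz => continuousAt_ringRot hd hz)
      fun _ hz => not_eventually_ringRot_plane hz
  · change Fin 3 at i
    fin_cases i
    · exact poisson_calG_G hd hd3 hz (hpos z hz)
    · exact poisson_calG_L₂ hd hd3 hz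
    · exact poisson_calG_r₁ hd hd3 hz (hpos z hz)
  · exact functionallyIndependent_planar hg
      (fun z hz _ _ _ h => fderiv_calG_of_inner hd hd3 hz (hpos z hz) h)
      (fun z hz h => neg_inv_sqrt_calGSq_mul_ne_zero (hpos z hz) h)
      (fun _ hz => continuousAt_inner_lap_planeRot hz)
      fun _ hz => not_eventually_inner_lap_planeRot hd hz

theorem inSigma_spatial (C : OuterKeplerMap 3) (hpos : ∀ z ∈ C.domain, 0 < C.calGSq z) :
    InSigma C.domain C.avgPotential (spatialIntegrals C) C.calG := by
  have hd : 0 < 3 := by norm_num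
  have hd3 : 3 ≤ 3 := le_rfl
  have hh : ∀ z ∈ C.domain, DifferentiableAt ℝ C.avgPotential z := fun z hz =>
    (hasFDerivAt_avgPotential hz).differentiableAt
  have hg : ∀ z ∈ C.domain, DifferentiableAt ℝ C.calG z := fun z hz =>
    differentiableAt_calG hd hd3 hz (hpos z hz)
  refine ⟨hh, fun i z hz => ?_, fun i j z hz => ?_, ?_, hg,
    fun z hz => poisson_avgPotential_calG hd hd3 hz (hpos z hz), fun i z hz => ?_, ?_,
    exists_ne_ham hd hd3 hpos⟩
  · change Fin 5 at i
    fin_cases i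
    · exact poisson_avgPotential_G hd hd3 hz
    · exact poisson_avgPotential_eq_zero (fun _ hw => Z_setAng hd hw)
        (fun _ hw => poisson_pot_of_rotField hd hd3 hw (fderiv_Z hw)) hz
    · exact poisson_avgPotential_L₂ hz
    · exact poisson_avgPotential_r₁ hd hz
    · exact poisson_avgPotential_eq_zero (fun _ hw => Theta_setAng hd hw)
        (fun _ hw => poisson_pot_Theta hw) hz
  · change Fin 5 at i j
    have h1 := poisson_G_L₂ hd hz
    have h2 := poisson_r₁_L₂ hd hz
    have h3 := poisson_r₁_G hd hd3 hz
    have h4 : poisson C.Z C.L₂ z = 0 := poisson_L₂ (fun _ hw => Z_setAng hd hw) hz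
    have h5 : poisson C.Theta C.L₂ z = 0 := poisson_L₂ (fun _ hw => Theta_setAng hd hw) hz
    have h6 : poisson C.G C.Z z = 0 := poisson_G_of_rotField hz (fderiv_Z hz)
    have h7 : poisson C.r₁ C.Z z = 0 := poisson_r₁_of_rotField hd hd3 hz (fderiv_Z hz)
    have h8 : poisson C.Theta C.Z z = 0 := poisson_Theta_of_rotField hz (fderiv_Z hz)
    have h9 : poisson C.Theta C.G z = 0 := poisson_Theta_of_rotField hz (fderiv_G hd3 hz)
    have h10 := poisson_r₁_Theta hz
    fin_cases i <;> fin_cases j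
    · exact poisson_self _ z
    · exact h6
    · exact h1
    · exact poisson_symm_zero h3
    · exact poisson_symm_zero h9
    · exact poisson_symm_zero h6
    · exact poisson_self _ z
    · exact h4
    · exact poisson_symm_zero h7
    · exact poisson_symm_zero h8
    · exact poisson_symm_zero h1
    · exact poisson_symm_zero h4
    · exact poisson_self _ z
    · exact poisson_symm_zero h2
    · exact poisson_symm_zero h5
    · exact h3
    · exact h7
    · exact h2
    · exact poisson_self _ z
    · exact h10
    · exact h9
    · exact h8
    · exact h5
    · exact poisson_symm_zero h10
    · exact poisson_self _ z
  · exact functionallyIndependent_spatial hh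
      (fun z hz _ _ _ h => fderiv_avgPotential_of_inner hd hd3 hz h) (κ := C.ringRot)
      (fun _ _ h => h) (fun _ hz => continuousAt_ringRot hd hz)
      fun _ hz => not_eventually_ringRot_space hz
  · change Fin 5 at i
    fin_cases i
    · exact poisson_calG_G hd hd3 hz (hpos z hz)
    · change poisson C.calG C.Z z = 0
      rw [poisson_calG hd hd3 hz (hpos z hz), poisson_calGSq_of_rotField hd hd3 hz (fderiv_Z hz),
        mul_zero]
    · exact poisson_calG_L₂ hd hd3 hz
    · exact poisson_calG_r₁ hd hd3 hz (hpos z hz)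
    · change poisson C.calG C.Theta z = 0
      rw [poisson_calG hd hd3 hz (hpos z hz), poisson_calGSq_Theta hz, mul_zero]
  · exact functionallyIndependent_spatial hg
      (fun z hz _ _ _ h => fderiv_calG_of_inner hd hd3 hz (hpos z hz) h)
      (fun z hz h => neg_inv_sqrt_calGSq_mul_ne_zero (hpos z hz) h)
      (fun _ hz => continuousAt_inner_lap_planeRot hz)
      fun _ hz => not_eventually_inner_lap_planeRot hd hz

end OuterKeplerMap
end ThreeBody

end

theorem theorem1 :
    (∀ C : ThreeBody.OuterKeplerMap 2,
      ((∀ z ∈ C.domain, ‖C.x₁ z‖ < ‖C.x₂ z‖) → ∀ z ∈ C.domain, 0 < C.calGSq z) ∧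
      ((∀ z ∈ C.domain, 0 < C.calGSq z) →
        ThreeBody.InSigma C.domain C.avgPotential (ThreeBody.planarIntegrals C) C.calG)) ∧
    (∀ C : ThreeBody.OuterKeplerMap 3,
      ((∀ z ∈ C.domain, ‖C.x₁ z‖ < ‖C.x₂ z‖) → ∀ z ∈ C.domain, 0 < C.calGSq z) ∧
      ((∀ z ∈ C.domain, 0 < C.calGSq z) →
        ThreeBody.InSigma C.domain C.avgPotential (ThreeBody.spatialIntegrals C) C.calG)) :=
  ⟨fun C => ⟨fun h _ hz => ThreeBody.OuterKeplerMap.calGSq_pos_of_lt (by norm_num) (by norm_num)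
      h hz, ThreeBody.OuterKeplerMap.inSigma_planar C⟩,
    fun C => ⟨fun h _ hz => ThreeBody.OuterKeplerMap.calGSq_pos_of_lt (by norm_num) le_rfl h hz,
      ThreeBody.OuterKeplerMap.inSigma_spatial C⟩⟩
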